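/- Let $q>0$ be real. Put $[x]=(q^x-q^{-x})/(q-q^{-1})$ (and $[x]=x$ if $q=1$), $[n]!=[n][n-1]\cdots[1]$, $[0]!=1$, $1/[n]!=0$ for integers $n<0$, $(\alpha|q)_n=\prod_{i=0}^{n-1}[\alpha+i]$, $Z_{j_1\dots j_n}=-\sum_i j_i(j_i+1)$, $$\nabla[abc]=\Big(\tfrac{[a+b-c]!\,[a-b+c]!\,[a+b+c+1]!}{[b+c-a]!}\Big)^{1/2},\qquad \Delta[abc]=\Big(\tfrac{[a+b-c]!\,[a-b+c]!\,[b+c-a]!}{[a+b+c+1]!}\Big)^{1/2}.$$ Call $(a,b,c)$ a triad if $b+c-a$, $a+c-b$, $a+b-c$ are non-negative integers. All sums run over the values (in steps of $1$) for which the factorials in the denominators have non-negative integer arguments. The $q$-$6j$ coefficient of $u_q(2)$ is $$\left\{\begin{matrix}a&b&e\\d&c&f\end{matrix}\right\}_q=\frac{\nabla[acf]\nabla[dbf]}{\nabla[abe]\nabla[dce]}\sum_z\frac{(-1)^{a+b+c+d+z}[c+f-a+z]!\,[b+f-d+z]!\,[a+d+e-f-z]!}{[z]!\,[a+c-f-z]!\,[b+d-f-z]!\,[e+f-a-d+z]!\,[2f+z+1]!}$$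 if $(a,b,e),(d,c,e),(a,c,f),(d,b,f)$ are triads, and $0$ otherwise; the $q$-$9j$ coefficient is $$\left\{\begin{matrix}a&b&e\\c&d&f\\h&k&g\end{matrix}\right\}_q=\sum_{j\in\frac12\mathbb Z_{\ge0}}(-1)^{2j}q^{Z_{deh}-j(j+1)}[2j+1]\left\{\begin{matrix}a&c&h\\k&g&j\end{matrix}\right\}_q\left\{\begin{matrix}k&j&c\\f&d&b\end{matrix}\right\}_q\left\{\begin{matrix}a&g&j\\f&b&e\end{matrix}\right\}_q .$$ The Clebsch–Gordan coefficient of $u_q(2)$, for a triad $(j_1,j_2,j)$, projections $m_1,m_2,m$ of $j_1,j_2,j$ (that is, $m_i\in\{-j_i,-j_i+1,\dots,j_i\}$, etc.) and $m=m_1+m_2$, is $$\left[\begin{matrix}j_1&j_2&j\\m_1&m_2&m\end{matrix}\right]_q=q^{\frac12(j_1+j_2-j)(j_1+j_2+j+1)+j_1m_2-j_2m_1}\,\Delta[j_1j_2j]\,\big([j_1+m_1]![j_1-m_1]![j_2+m_2]![j_2-m_2]![j+m]![j-m]![2j+1]\big)^{1/2}$$ $$\times\sum_z\frac{(-1)^zq^{-z(j_1+j_2+j+1)}}{[z]!\,[j_1+j_2-j-z]!\,[j_1-m_1-z]!\,[j_2+m_2-z]!\,[j-j_2+m_1+z]!\,[j-j_1-m_2+z]!},$$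 and $0$ in all other cases. Let $g=e+f$ and let $(a,b,e),(c,d,f),(h,k,g),(a,c,h),(b,d,k)$ be triads. Then the stretched coefficient $X=\left\{\begin{matrix}a&b&e\\c&d&f\\h&k&e+f\end{matrix}\right\}_q$ has the following three expressions. (stdCG) $$X=(-1)^{a+b+c+d-h-k}\frac{([2e]![2f]![g+h-k]![g+h+k+1]!)^{1/2}}{([2g+1]!\,[2k+1])^{1/2}\nabla[hac]\nabla[fcd]\nabla[eab]}\;q^{2af-(a+b-e)(a+d+f-h)+b(g-h)+\frac12(b+d-k)(b+d+k+1)-(a-e)(g+h-b-d+1)+Z_{bdgh}}$$ $$\times\sum_{m=-b}^{b}(-1)^{a-e+m}q^{-m(g+h+1)}\frac{[a+e-m]!\,[c-e+h+m]!}{[a-e+m]!\,[c+e-h-m]!}\Big(\frac{[d+g-h-m]!\,[b+m]!}{[d-g+h+m]!\,[b-m]!}\Big)^{1/2}\left[\begin{matrix}d&b&k\\g-h-m&m&g-h\end{matrix}\right]_q .$$ (stdK) $$X=\frac{([2e]![2f]![h+k-g]![g-h+k]![g+h-k]![g+h+k+1]!)^{1/2}}{([2g+1]!)^{1/2}\nabla[hac]\nabla[fcd]\nabla[eab]\nabla[kbd]}\;q^{(b+d-k)(a+b+f-h+k+1)-(a+b-e)(a+d+f-h)+2af+Z_{bdgh}}\;S,$$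 $$S=\sum_{s,z}\frac{(-1)^{a+b+c+d-h-k+s+z}q^{-s(g+h-k+1)-z(g-h+k+1)}\,[2a-s]!\,[c+h-a+s]!\,[2d-z]!\,[b-d+k+z]!}{[s]!\,[a+c-h-s]!\,[z]!\,[b+d-k-z]!\,[d-a-f+h+s-z]!\,[a-d-e+k-s+z]!}.$$ (stbK) $$X=\Big(\frac{[2e]![2f]![a-b+e]![a+b-e]!}{[2g+1]![e-a+b]![a+b+e+1]!}\Big)^{1/2}\frac{\nabla[ghk]\nabla[bdk]}{\nabla[fcd]\nabla[ach]}\;q^{(c+d-f)(a+b-e+1)-(a+b+e+1)(b+d-k)+2ed+Z_{acgk}}\;S',$$ $$S'=\sum_{s,z}\frac{(-1)^{c+k-b-f+s}q^{-s(a+b-e+1)+z(a+b+e+1)}\,[2c-s]!\,[a-c+h+s]!\,[k-b+d+z]!}{[s]!\,[c+h-a-s]!\,[z]!\,[b+d-k-z]!\,[2k+z+1]!\,[c-b-f+k+z-s]!\,[a-c+g-k-z+s]!}.$$ For $q=1$, where every $[x]$ is $x$, (stdK) is the standard double sum for stretched $9j$ coefficients of SU(2). Symmetry of (stdK): let $R_q\left\{\begin{matrix}a&b&e\\c&d&f\\h&k&g\end{matrix}\right\}$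 be the right-hand side of (stdK) and $A=(-1)^{a+b+c+d+e+f+g+h+k}q^{Z_{deh}+Z_{bcg}+Z_{afk}}$. Then $$R_q\left\{\begin{matrix}a&b&e\\c&d&f\\h&k&g\end{matrix}\right\}=A\,R_{q^{-1}}\left\{\begin{matrix}b&a&e\\d&c&f\\k&h&g\end{matrix}\right\}=A\,R_{q^{-1}}\left\{\begin{matrix}c&d&f\\a&b&e\\h&k&g\end{matrix}\right\}.$$ Kampé de Fériet form: let $${}^{\pm}F^{1:2}_{1:1}\left[\begin{matrix}\alpha\\\gamma\end{matrix}:\begin{matrix}\beta_1,\beta_2\\\delta\end{matrix};\begin{matrix}\beta_1',\beta_2'\\\delta'\end{matrix}\right]=\sum_{s,t\ge0}\frac{(\alpha|q)_{s+t}}{(\gamma|q)_{s+t}}\frac{(\beta_1|q)_s(\beta_2|q)_s(\beta_1'|q)_t(\beta_2'|q)_t}{(\delta|q)_s(\delta'|q)_t}\frac{x^{\pm s}y^{\mp t}}{[s]!\,[t]!},$$ where $x=q^{\alpha+\beta_1+\beta_2-\gamma-\delta+1}$, $y=q^{\alpha+\beta_1'+\beta_2'-\gamma-\delta'+1}$,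 and terms with a vanishing numerator are $0$. (For $q=1$ this is the Kampé de Fériet function $F^{1:2}_{1:1}$ with arguments $1,1$.) Then: (i) if $h+k\ge a+b+f$, $$S=\frac{(-1)^{a+c-h}q^{-(b+d-k)(g-h+k+1)}[2a]![c+h-a]![2b]![d-b+k]!}{[a+c-h]![b+d-k]![a+b-e]![h+k-a-b-f]!}\;{}^{-}F^{1:2}_{1:1}\left[\begin{matrix}e-a-b\\h+k-a-b-f+1\end{matrix}:\begin{matrix}h-a-c,\,c+h-a+1\\-2a\end{matrix};\begin{matrix}k-b-d,\,d-b+k+1\\-2b\end{matrix}\right];$$ (ii) if $h+k\ge c+d+e$, $$S=\frac{(-1)^{b+d-k}q^{-(a+c-h)(g+h-k+1)}[2c]![a+h-c]![2d]![b-d+k]!}{[a+c-h]![b+d-k]![c+d-f]![h+k-c-d-e]!}\;{}^{+}F^{1:2}_{1:1}\left[\begin{matrix}f-c-d\\h+k-c-d-e+1\end{matrix}:\begin{matrix}h-a-c,\,a+h-c+1\\-2c\end{matrix};\begin{matrix}k-b-d,\,b-d+k+1\\-2d\end{matrix}\right];$$ (iii) if $a+g\ge b+c+d$, $$S'=\frac{(-1)^{c+k-b-f}q^{(b+d-k)(a+b+e+1)}[2c]![a+h-c]![2d]!}{[c+h-a]![b+d-k]![b+d+k+1]![c+d-f]![a+g-b-c-d]!}\;{}^{-}F^{1:2}_{1:1}\left[\begin{matrix}f-c-d\\a+g-b-c-d+1\end{matrix}:\begin{matrix}a-c-h,\,a+h-c+1\\-2c\end{matrix};\begin{matrix}k-b-d,\,-b-d-k-1\\-2d\end{matrix}\right];$$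 (iv) if $a+k\ge b+f+h$, $$S'=\frac{(-1)^{2c+h+k-a-b-f}q^{-(c+h-a)(a+b-e+1)}[a+c-h]![2h]![k-b+d]!}{[c+h-a]![b+d-k]![2k+1]![g+h-k]![a+k-b-f-h]!}\;{}^{+}F^{1:2}_{1:1}\left[\begin{matrix}k-g-h\\a+k-b-f-h+1\end{matrix}:\begin{matrix}a-c-h,\,a+c-h+1\\-2h\end{matrix};\begin{matrix}k-b-d,\,k-b+d+1\\2k+2\end{matrix}\right].$$ Without the respective inequality, (i) and (iii) remain true for all admissible spins when $[\gamma-1]!\,(\gamma|q)_{s+t}$ is read as $[\gamma+s+t-1]!$. -/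

import Mathlib

noncomputable section

namespace StretchedNineJ

/-- The `q`-number `[x] = (q ^ x - q ^ (-x)) / (q - q⁻¹)`, equal to `x` for `q = 1`. -/
def qNum (q x : ℝ) : ℝ :=
  if q = 1 then x else (q ^ x - q ^ (-x)) / (q - q⁻¹)

/-- The `q`-factorial `[x]! = [x] [x-1] ⋯ [1]` of a non-negative integer `x` (with `[0]! = 1`).
For negative `x` the value is `0`, so that division by it yields `0`: this is the usual convention
`1 / [x]! = 0` for `x < 0`, by which the denominators bound all the sums below. -/
def qFact (q x : ℝ) : ℝ :=
  if x < 0 then 0 else ∏ i ∈ Finset.range ⌊x⌋₊, qNum q ((i : ℝ) + 1)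

/-- The symmetric `q`-Pochhammer symbol `(α|q)_n = [α] [α+1] ⋯ [α+n-1]`. -/
def qPoch (q α : ℝ) (n : ℕ) : ℝ :=
  ∏ i ∈ Finset.range n, qNum q (α + i)

/-- The sign `(-1) ^ x` of an integer `x`, given as a real number. -/
def sgn (x : ℝ) : ℝ := (-1 : ℝ) ^ ⌊x⌋

/-- `zz j = - j (j + 1)`; the usual `Z_{j₁ … jₙ}` is the sum of these values. -/
def zz (j : ℝ) : ℝ := -(j * (j + 1))

/-- `(a, b, c)` is a triad of angular momenta: the numbers `b + c - a`, `a + c - b` and `a + b - c`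
are non-negative integers. In particular `a, b, c` are then in `{0, 1/2, 1, 3/2, …}` and
`a + b + c` is an integer. -/
def IsTriad (a b c : ℝ) : Prop :=
  (∃ n : ℕ, b + c - a = n) ∧ (∃ n : ℕ, a + c - b = n) ∧ (∃ n : ℕ, a + b - c = n)

/-- `m` is a projection of the angular momentum `j`, that is, `m ∈ {-j, -j+1, …, j}`. -/
def IsProj (j m : ℝ) : Prop :=
  (∃ n : ℕ, j - m = n) ∧ (∃ n : ℕ, j + m = n)

/-- The asymmetric triangle coefficient `∇[abc]`. -/
def nabla (q a b c : ℝ) : ℝ :=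
  Real.sqrt (qFact q (a + b - c) * qFact q (a - b + c) * qFact q (a + b + c + 1) /
    qFact q (b + c - a))

/-- The symmetric triangle coefficient `Δ[abc]`. -/
def triDelta (q a b c : ℝ) : ℝ :=
  Real.sqrt (qFact q (a + b - c) * qFact q (a - b + c) * qFact q (b + c - a) /
    qFact q (a + b + c + 1))

open Classical in
/-- The `q`-6j coefficient `{a b e; d c f}_q` of `u_q(2)` (zero unless `(a,b,e)`, `(d,c,e)`,
`(a,c,f)`, `(d,b,f)` are triads). -/
def sixJ (q a b e d c f : ℝ) : ℝ :=
  if IsTriad a b e ∧ IsTriad d c e ∧ IsTriad a c f ∧ IsTriad d b f then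
    nabla q a c f * nabla q d b f / (nabla q a b e * nabla q d c e) *
      ∑ z ∈ Finset.range (⌊a + c - f⌋₊ + 1),
        sgn (a + b + c + d + z) *
          (qFact q (c + f - a + z) * qFact q (b + f - d + z) * qFact q (a + d + e - f - z)) /
          (qFact q z * qFact q (a + c - f - z) * qFact q (b + d - f - z) *
            qFact q (e + f - a - d + z) * qFact q (2 * f + z + 1))
  else 0

/-- The `q`-9j coefficient `{a b e; c d f; h k g}_q` of `u_q(2)` (listed row by row), as the
expansion in terms of `q`-6j coefficients, summed over `j = n / 2`. The 6j coefficients restrict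
the sum to those `j` for which `(a,g,j)`, `(k,c,j)`, `(f,b,j)` are triads. -/
def nineJ (q a b e c d f h k g : ℝ) : ℝ :=
  ∑ n ∈ Finset.range (⌊2 * (a + g)⌋₊ + 1),
    let j : ℝ := (n : ℝ) / 2
    sgn (2 * j) * q ^ (zz d + zz e + zz h - j * (j + 1)) * qNum q (2 * j + 1) *
      sixJ q a c h k g j * sixJ q k j c f d b * sixJ q a g j f b e

open Classical in
/-- The Clebsch–Gordan coefficient `[j₁ j₂ j; m₁ m₂ m]_q` of `u_q(2)` (the `q`-analogue of the van
der Waerden formula, with the usual phases; zero outside the triangle and projection conditions). -/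
def qCG (q j₁ m₁ j₂ m₂ j m : ℝ) : ℝ :=
  if IsTriad j₁ j₂ j ∧ IsProj j₁ m₁ ∧ IsProj j₂ m₂ ∧ IsProj j m ∧ m = m₁ + m₂ then
    q ^ ((j₁ + j₂ - j) * (j₁ + j₂ + j + 1) / 2 + j₁ * m₂ - j₂ * m₁) *
      triDelta q j₁ j₂ j *
      Real.sqrt (qFact q (j₁ + m₁) * qFact q (j₁ - m₁) * qFact q (j₂ + m₂) * qFact q (j₂ - m₂) *
        qFact q (j + m) * qFact q (j - m) * qNum q (2 * j + 1)) *
      ∑ z ∈ Finset.range (⌊j₁ + j₂ - j⌋₊ + 1),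
        sgn z * q ^ (-(z : ℝ) * (j₁ + j₂ + j + 1)) /
          (qFact q z * qFact q (j₁ + j₂ - j - z) * qFact q (j₁ - m₁ - z) * qFact q (j₂ + m₂ - z) *
            qFact q (j - j₂ + m₁ + z) * qFact q (j - j₁ - m₂ + z))
  else 0

/-- Single sum with a Clebsch–Gordan coefficient; `g = e + f`, summed over `m = -b, -b+1, …, b`. -/
def exprCG (q a b e c d f h k g : ℝ) : ℝ :=
  sgn (a + b + c + d - h - k) *
    Real.sqrt (qFact q (2 * e) * qFact q (2 * f) * qFact q (g + h - k) * qFact q (g + h + k + 1)) /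
    (Real.sqrt (qFact q (2 * g + 1) * qNum q (2 * k + 1)) *
      nabla q h a c * nabla q f c d * nabla q e a b) *
    q ^ (2 * a * f - (a + b - e) * (a + d + f - h) + b * (g - h)
        + (b + d - k) * (b + d + k + 1) / 2 - (a - e) * (g + h - b - d + 1)
        + (zz b + zz d + zz g + zz h)) *
    ∑ n ∈ Finset.range (⌊2 * b⌋₊ + 1),
      let m : ℝ := -b + n
      sgn (a - e + m) * q ^ (-m * (g + h + 1)) *
        (qFact q (a + e - m) * qFact q (c - e + h + m)) /
        (qFact q (a - e + m) * qFact q (c + e - h - m)) *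
        Real.sqrt (qFact q (d + g - h - m) * qFact q (b + m) /
          (qFact q (d - g + h + m) * qFact q (b - m))) *
        qCG q d (g - h - m) b m k (g - h)

/-- The symmetric double sum. -/
def sumK (q a b e c d f h k g : ℝ) : ℝ :=
  ∑ s ∈ Finset.range (⌊a + c - h⌋₊ + 1), ∑ z ∈ Finset.range (⌊b + d - k⌋₊ + 1),
    sgn (a + b + c + d - h - k + s + z) *
      q ^ (-(s : ℝ) * (g + h - k + 1) - (z : ℝ) * (g - h + k + 1)) /
      (qFact q s * qFact q (a + c - h - s) * qFact q z * qFact q (b + d - k - z)) *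
      ((qFact q (2 * a - s) * qFact q (c + h - a + s) *
          qFact q (2 * d - z) * qFact q (b - d + k + z)) /
        (qFact q (d - a - f + h + s - z) * qFact q (a - d - e + k - s + z)))

/-- The expression with the symmetric double sum. -/
def exprK (q a b e c d f h k g : ℝ) : ℝ :=
  Real.sqrt (qFact q (2 * e) * qFact q (2 * f) * qFact q (h + k - g) * qFact q (g - h + k) *
      qFact q (g + h - k) * qFact q (g + h + k + 1)) /
    (Real.sqrt (qFact q (2 * g + 1)) *
      nabla q h a c * nabla q f c d * nabla q e a b * nabla q k b d) *
    q ^ ((b + d - k) * (a + b + f - h + k + 1) - (a + b - e) * (a + d + f - h) + 2 * a * f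
        + (zz b + zz d + zz g + zz h)) *
    sumK q a b e c d f h k g

/-- The further double sum. -/
def sumK' (q a b e c d f h k g : ℝ) : ℝ :=
  ∑ s ∈ Finset.range (⌊c + h - a⌋₊ + 1), ∑ z ∈ Finset.range (⌊b + d - k⌋₊ + 1),
    (qFact q (2 * c - s) * qFact q (a - c + h + s) * qFact q (k - b + d + z)) /
      (qFact q s * qFact q (c + h - a - s) * qFact q z * qFact q (b + d - k - z) *
        qFact q (2 * k + z + 1)) *
      (sgn (c + k - b - f + s) *
          q ^ (-(s : ℝ) * (a + b - e + 1) + (z : ℝ) * (a + b + e + 1)) /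
        (qFact q (c - b - f + k + z - s) * qFact q (a - c + g - k - z + s)))

/-- The expression with the further double sum. -/
def exprK' (q a b e c d f h k g : ℝ) : ℝ :=
  Real.sqrt (qFact q (2 * e) * qFact q (2 * f) * qFact q (a - b + e) * qFact q (a + b - e) /
      (qFact q (2 * g + 1) * qFact q (e - a + b) * qFact q (a + b + e + 1))) *
    (nabla q g h k * nabla q b d k / (nabla q f c d * nabla q a c h)) *
    q ^ ((c + d - f) * (a + b - e + 1) - (a + b + e + 1) * (b + d - k) + 2 * e * d
        + (zz a + zz c + zz g + zz k)) *
    sumK' q a b e c d f h k g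

/-- The phase `(-1)^{a+b+⋯+k} q^{Z_{deh} + Z_{bcg} + Z_{afk}}` by which a `q`-9j coefficient
changes, together with `q → q⁻¹`, under an odd permutation of rows or columns. -/
def oddPhase (q a b e c d f h k g : ℝ) : ℝ :=
  sgn (a + b + c + d + e + f + g + h + k) *
    q ^ ((zz d + zz e + zz h) + (zz b + zz c + zz g) + (zz a + zz f + zz k))

/-- `∏ⱼ (aⱼ|q)_n` over a list of parameters. -/
def qPochs (q : ℝ) (l : List ℝ) (n : ℕ) : ℝ := (l.map fun a => qPoch q a n).prod

/-- The factor `x^{± s} y^{± (1 - 2δ) t} q^{± (A - C) s t}` of the `q`-Kampé de Fériet series, with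
`x = q^{p+1}`, `y = q^{p'+1}`, where `p`, `p'` are the differences of the sums of the upper and of
the lower parameters belonging to `s` and to `t`, and `δ` is `1` if `A = C` and `0` otherwise;
`ε = 1` or `ε = -1` is the superscript sign. -/
def kdfPower (ε q : ℝ) (A C B D B' D' : List ℝ) (s t : ℕ) : ℝ :=
  let x : ℝ := q ^ (A.sum + B.sum - C.sum - D.sum + 1)
  let y : ℝ := q ^ (A.sum + B'.sum - C.sum - D'.sum + 1)
  let δ : ℝ := if A.length = C.length then 1 else 0
  x ^ (ε * s) * y ^ (ε * (1 - 2 * δ) * t) *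
    q ^ (ε * ((A.length : ℝ) - (C.length : ℝ)) * s * t)

/-- The `q`-Kampé de Fériet function `^{±}F^{A:B}_{C:D}[(a);(c) : (b);(d) ; (b');(d')]` with
its special arguments `x = q^{p+1}`, `y = q^{p'+1}`. -/
def qKdF (ε q : ℝ) (A C B D B' D' : List ℝ) : ℝ :=
  ∑' st : ℕ × ℕ,
    qPochs q A (st.1 + st.2) / qPochs q C (st.1 + st.2) *
      (qPochs q B st.1 * qPochs q B' st.2 / (qPochs q D st.1 * qPochs q D' st.2)) *
      (kdfPower ε q A C B D B' D' st.1 st.2 / (qFact q st.1 * qFact q st.2))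

/-- The same series divided by `∏ⱼ [cⱼ - 1]!`, i.e. with `[cⱼ + s + t - 1]!` in place of
`(cⱼ|q)_{s+t}`; it has a meaning for all integers `cⱼ`. -/
def qKdFReg (ε q : ℝ) (A C B D B' D' : List ℝ) : ℝ :=
  ∑' st : ℕ × ℕ,
    qPochs q A (st.1 + st.2) / (C.map fun c => qFact q (c + st.1 + st.2 - 1)).prod *
      (qPochs q B st.1 * qPochs q B' st.2 / (qPochs q D st.1 * qPochs q D' st.2)) *
      (kdfPower ε q A C B D B' D' st.1 st.2 / (qFact q st.1 * qFact q st.2))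

end StretchedNineJ

end

noncomputable section
namespace StretchedNineJ
open Finset

variable {q : ℝ}

/-! The 9j coefficient is a sum over one spin j of products of three 6j coefficients. In Racah's
form (`sixJ_eq_racah`) the condition g = e + f makes the lowest and the highest summation index of
the third 6j coefficient coincide, so that it is a single term (`racah_stretched`). Each triad
containing j occurs in two of the three 6j coefficients; their square roots pair off, and the
summand is a j-free irrational factor `triProd` times a rational expression in q-factorials
(`sixJ_mul_eq`).

The arguments of Racah's sum can be permuted freely, so each of the other two 6j coefficients can be
re-expanded as a defining sum with another spin in the distinguished place. For suitable choices the
dependence on j is that of a very-well-poised series, summed in closed form by `sum_spin`, and a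
double sum remains. With h and j distinguished (`nineJ_eq_of_spin`), one transformation of the sum
over x (`sum_flip`) yields (stdK). With h and k distinguished (`nineJ_eq_of_row`), one
transformation of the sum over z and two of the sum over x yield (stbK). Putting the z-sum of (stdK)
into van der Waerden's form yields (stdCG) (`exprK_eq_exprCG`).

The summation over j suppresses some terms outside a triangle condition that the transformed sums
still contain. They contribute zero, because a q-difference of order n annihilates a product of
fewer than n q-numbers (`sum_qBin_prod_eq_zero`).

All single-sum transformations are terminating 3F2 identities. They follow from q-Vandermonde
applied twice (`qHyp_eq_sum`, `qHyp_transform`), together with reversal of the summation; the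
Saalschütz sums behind Racah's form are a special case. The symmetries of (stdK) are reversals of
both of its summations, and the Kampé de Fériet forms arise by reversing one of the two. -/

/-! ### q-numbers and q-Pochhammer symbols. -/

theorem qNum_add (hq : 0 < q) (x y : ℝ) : qNum q (x + y) = q ^ x * qNum q y + q ^ (-y) * qNum q x := by
  unfold qNum
  split_ifs with h
  · subst h; simp; ring
  · rw [neg_add, Real.rpow_add hq, Real.rpow_add hq]; ring

theorem qNum_zero (q : ℝ) : qNum q 0 = 0 := by simp [qNum]

theorem qNum_neg (q x : ℝ) : qNum q (-x) = -qNum q x := by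
  unfold qNum
  split_ifs
  · rfl
  · rw [neg_neg]; ring

theorem qNum_inv (hq : 0 < q) (x : ℝ) : qNum q⁻¹ x = qNum q x := by
  unfold qNum
  simp only [inv_eq_one, inv_inv]
  rw [Real.inv_rpow hq.le, Real.inv_rpow hq.le, ← Real.rpow_neg hq.le,
    ← Real.rpow_neg hq.le, neg_neg]
  split_ifs
  · rfl
  · rw [← neg_sub (q ^ x), ← neg_sub q, neg_div_neg_eq]

theorem qNum_pos (hq : 0 < q) {x : ℝ} (hx : 0 < x) : 0 < qNum q x := by
  unfold qNum
  split_ifs with h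
  · exact hx
  · rcases lt_or_gt_of_ne h with h | h
    · apply div_pos_of_neg_of_neg
      · have := Real.rpow_lt_rpow_of_exponent_gt hq h (show -x < x by linarith)
        linarith
      · have : 1 < q⁻¹ := (one_lt_inv₀ hq).2 h
        linarith
    · apply div_pos
      · have := Real.rpow_lt_rpow_of_exponent_lt h (show -x < x by linarith)
        linarith
      · have : q⁻¹ < 1 := inv_lt_one_of_one_lt₀ h
        linarith

/-- The addition rule applied to x = y + (x - y). In this form it merges the two terms that Pascal's
rule produces in the proof of q-Vandermonde. -/
theorem qNum_sub (hq : 0 < q) (x y : ℝ) : qNum q x - q ^ (y - x) * qNum q y = q ^ y * qNum q (x - y) := by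
  have := qNum_add hq y (x - y)
  rw [show y + (x - y) = x by ring, neg_sub] at this
  rw [this]; ring

theorem qPoch_zero (q α : ℝ) : qPoch q α 0 = 1 := by simp [qPoch]

theorem qPoch_succ (q α : ℝ) (n : ℕ) : qPoch q α (n + 1) = qPoch q α n * qNum q (α + n) := by
  simp [qPoch, prod_range_succ]

theorem qPoch_succ' (q α : ℝ) (n : ℕ) : qPoch q α (n + 1) = qNum q α * qPoch q (α + 1) n := by
  simp only [qPoch, prod_range_succ', Nat.cast_add, Nat.cast_one, Nat.cast_zero, add_zero]
  rw [mul_comm]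
  congr 1
  exact prod_congr rfl fun i _ => by congr 1; ring

theorem qPoch_add (q α : ℝ) (m n : ℕ) : qPoch q α (m + n) = qPoch q α m * qPoch q (α + m) n := by
  simp only [qPoch, prod_range_add, Nat.cast_add]
  congr 1
  exact prod_congr rfl fun i _ => by congr 1; ring

theorem qPoch_inv (hq : 0 < q) (α : ℝ) (n : ℕ) : qPoch q⁻¹ α n = qPoch q α n := by
  simp only [qPoch, qNum_inv hq]

theorem qPoch_reverse (q α : ℝ) (n : ℕ) : qPoch q α n = (-1) ^ n * qPoch q (1 - α - n) n := by
  unfold qPoch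
  rw [← prod_range_reflect, ← card_range n, ← prod_const, card_range, ← prod_mul_distrib]
  refine prod_congr rfl fun i hi => ?_
  have := mem_range.1 hi
  rw [neg_one_mul, ← qNum_neg]
  congr 1
  rw [Nat.sub_sub, Nat.cast_sub (by omega)]
  push_cast
  ring

/-! ### q-factorials. -/

theorem qFact_natCast (q : ℝ) (n : ℕ) : qFact q n = ∏ i ∈ range n, qNum q ((i : ℝ) + 1) := by
  simp [qFact]

theorem qFact_of_neg (q : ℝ) {x : ℝ} (hx : x < 0) : qFact q x = 0 := by simp [qFact, hx]

theorem qFact_zero (q : ℝ) : qFact q 0 = 1 := by simp [qFact]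

theorem qFact_natCast_succ (q : ℝ) (n : ℕ) : qFact q ((n : ℝ) + 1) = qNum q ((n : ℝ) + 1) * qFact q n := by
  have := qFact_natCast q (n + 1)
  push_cast at this
  rw [this, prod_range_succ, qFact_natCast, mul_comm]

theorem qFact_inv (hq : 0 < q) (x : ℝ) : qFact q⁻¹ x = qFact q x := by
  simp only [qFact, qNum_inv hq]

theorem qFact_natCast_pos (hq : 0 < q) (n : ℕ) : 0 < qFact q n := by
  rw [qFact_natCast]
  exact prod_pos fun i _ => qNum_pos hq (by positivity)

theorem qFact_pos (hq : 0 < q) {x : ℝ} (hx : 0 ≤ x) : 0 < qFact q x := by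
  have : qFact q x = qFact q (⌊x⌋₊ : ℝ) := by simp [qFact, hx.not_gt]
  rw [this]
  exact qFact_natCast_pos hq _

theorem qFact_nonneg (hq : 0 < q) (x : ℝ) : 0 ≤ qFact q x := by
  rcases lt_or_ge x 0 with h | h
  · rw [qFact_of_neg q h]
  · exact (qFact_pos hq h).le

/-! ### Symmetric q-binomial coefficients and the q-Vandermonde sum. -/

/-- The symmetric `q`-binomial coefficient. -/
def qBin (q : ℝ) (n k : ℕ) : ℝ := qFact q n / (qFact q k * qFact q ((n : ℝ) - k))

theorem qBin_inv (hq : 0 < q) (n k : ℕ) : qBin q⁻¹ n k = qBin q n k := by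
  simp only [qBin, qFact_inv hq]

theorem qBin_of_lt (q : ℝ) {n k : ℕ} (h : n < k) : qBin q n k = 0 := by
  rw [qBin, qFact_of_neg q (x := (n : ℝ) - k) (by rw [sub_neg]; exact_mod_cast h)]
  simp

theorem qBin_zero (hq : 0 < q) (n : ℕ) : qBin q n 0 = 1 := by
  simp [qBin, qFact_zero, (qFact_natCast_pos hq n).ne']

theorem qBin_self (hq : 0 < q) (n : ℕ) : qBin q n n = 1 := by
  simp [qBin, qFact_zero, (qFact_natCast_pos hq n).ne']

theorem qBin_symm (q : ℝ) {n k : ℕ} (h : k ≤ n) : qBin q n (n - k) = qBin q n k := by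
  rw [qBin, qBin, Nat.cast_sub h, sub_sub_cancel, mul_comm (qFact q k)]

theorem qBin_succ_succ (hq : 0 < q) {n k : ℕ} (h : k ≤ n) :
    qBin q (n + 1) (k + 1) =
      q ^ (-((k : ℝ) + 1)) * qBin q n (k + 1) + q ^ ((n : ℝ) - k) * qBin q n k := by
  obtain ⟨m, rfl⟩ := Nat.exists_eq_add_of_le h
  have hk := (qFact_natCast_pos hq k).ne'
  have hm := (qFact_natCast_pos hq m).ne'
  have hk1 := (qNum_pos hq (show (0 : ℝ) < k + 1 by positivity)).ne'
  simp only [qBin]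
  push_cast
  rw [show (k : ℝ) + m + 1 - (k + 1) = m by ring, show (k : ℝ) + m - k = m by ring,
    qFact_natCast_succ, ← Nat.cast_add, qFact_natCast_succ]
  push_cast
  rw [show (k : ℝ) + m + 1 = m + (k + 1) by ring, qNum_add hq m]
  cases m with
  | zero =>
    -- At the edge n = k the coefficient with lower index n + 1 is a quotient by [-1]! = 0, hence 0
    -- as it should be.
    rw [show (k : ℝ) + (0 : ℕ) - (k + 1) = -1 by push_cast; ring, qFact_of_neg q (x := -1) (by norm_num)]
    simp only [Nat.cast_zero, qNum_zero, qFact_zero]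
    field_simp
    simp [mul_comm]
  | succ m =>
    have hm' := (qFact_natCast_pos hq m).ne'
    have hm1 := (qNum_pos hq (show (0 : ℝ) < m + 1 by positivity)).ne'
    push_cast
    rw [show (k : ℝ) + (m + 1) - (k + 1) = m by ring, qFact_natCast_succ q m]
    field_simp
    ring

theorem qBin_mul (hq : 0 < q) {n r i : ℕ} (h : r + i ≤ n) :
    qBin q n (r + i) * qBin q (r + i) r = qBin q n r * qBin q (n - r) i := by
  obtain ⟨m, rfl⟩ := Nat.exists_eq_add_of_le h
  have h1 := (qFact_natCast_pos hq r).ne'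
  have h2 := (qFact_natCast_pos hq i).ne'
  have h3 := (qFact_natCast_pos hq m).ne'
  have h4 := (qFact_natCast_pos hq (r + i)).ne'
  have h5 := (qFact_natCast_pos hq (i + m)).ne'
  rw [show r + i + m - r = i + m by omega]
  simp only [qBin]
  push_cast at h4 h5 ⊢
  rw [show (r : ℝ) + i + m - (r + i) = m by ring, show (r : ℝ) + i - r = i by ring,
    show (r : ℝ) + i + m - r = i + m by ring, show (i : ℝ) + m - i = m by ring]
  field_simp

/-- Pascal's rule under the summation sign: the induction step for alternating sums with q-binomial
weights. -/
theorem sum_qBin_succ (hq : 0 < q) (n : ℕ) (f : ℕ → ℝ) :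
    ∑ k ∈ range (n + 2), qBin q (n + 1) k * f k =
      ∑ k ∈ range (n + 1), qBin q n k * (q ^ (-(k : ℝ)) * f k + q ^ ((n : ℝ) - k) * f (k + 1)) := by
  simp only [mul_add, sum_add_distrib]
  rw [sum_range_succ', sum_congr rfl fun k hk =>
    show qBin q (n + 1) (k + 1) * f (k + 1) = qBin q n (k + 1) * (q ^ (-(((k + 1 : ℕ) : ℝ))) * f (k + 1))
      + qBin q n k * (q ^ ((n : ℝ) - k) * f (k + 1)) by
      rw [qBin_succ_succ hq (Nat.lt_succ_iff.1 (mem_range.1 hk))]; push_cast; ring]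
  rw [sum_add_distrib, qBin_zero hq, sum_range_succ, qBin_of_lt q (Nat.lt_succ_self n),
    sum_range_succ' (fun k => qBin q n k * (q ^ (-(k : ℝ)) * f k)), qBin_zero hq]
  simp
  ring

/-- The `q`-Vandermonde summation. -/
theorem qVandermonde (hq : 0 < q) (n : ℕ) (a d : ℝ) :
    ∑ k ∈ range (n + 1), (-1) ^ k * qBin q n k * qPoch q a k * qPoch q (d + k) (n - k) *
      q ^ ((k : ℝ) * (a - d - n + 1)) = q ^ (a * n) * qPoch q (d - a) n := by
  induction n generalizing d with
  | zero => simp [qPoch_zero, qBin_zero hq]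
  | succ n ih =>
    have h1 := sum_qBin_succ hq n (fun k => (-1) ^ k * qPoch q a k * qPoch q (d + k) (n + 1 - k) *
      q ^ ((k : ℝ) * (a - d - n)))
    calc _ = ∑ k ∈ range (n + 2), qBin q (n + 1) k * ((-1) ^ k * qPoch q a k *
          qPoch q (d + k) (n + 1 - k) * q ^ ((k : ℝ) * (a - d - n))) := by
          refine sum_congr rfl fun k _ => ?_
          rw [show a - d - ((n + 1 : ℕ) : ℝ) + 1 = a - d - n by push_cast; ring]
          ring
      _ = _ := h1
      _ = ∑ k ∈ range (n + 1), q ^ a * qNum q (d - a) * ((-1) ^ k * qBin q n k * qPoch q a k *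
            qPoch q (d + 1 + k) (n - k) * q ^ ((k : ℝ) * (a - (d + 1) - n + 1))) := by
          refine sum_congr rfl fun k hk => ?_
          have hk := Nat.lt_succ_iff.1 (mem_range.1 hk)
          -- The two terms from Pascal's rule combine to [d+k] - q^(a-d) [a+k] = q^(a+k) [d-a]. The
          -- factor q^k cancels the weight q^(-k), leaving the sum of length n with d + 1 in place
          -- of d.
          have e1 := qNum_sub hq (d + k) (a + k)
          rw [show d + (k : ℝ) - (a + k) = d - a by ring, show a + (k : ℝ) - (d + k) = a - d by ring,
            Real.rpow_add hq] at e1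
          rw [Nat.succ_sub hk, qPoch_succ', qPoch_succ, show n + 1 - (k + 1) = n - k by omega]
          have e2 : q ^ (((k + 1 : ℕ) : ℝ) * (a - d - n)) =
            q ^ ((k : ℝ) * (a - d - n)) * q ^ (a - d) * q ^ (-(n : ℝ)) := by
            rw [← Real.rpow_add hq, ← Real.rpow_add hq]; congr 1; push_cast; ring
          have e3 : q ^ ((n : ℝ) - k) = q ^ (n : ℝ) * q ^ (-(k : ℝ)) := by
            rw [← Real.rpow_add hq]; rfl
          have e4 : q ^ (n : ℝ) * q ^ (-(n : ℝ)) = 1 := by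
            rw [← Real.rpow_add hq]; simp
          have e5 : q ^ (k : ℝ) * q ^ (-(k : ℝ)) = 1 := by
            rw [← Real.rpow_add hq]; simp
          rw [e2, e3, show a - (d + 1) - (n : ℝ) + 1 = a - d - n by ring,
            show d + ((k + 1 : ℕ) : ℝ) = d + 1 + k by push_cast; ring,
            show d + (k : ℝ) + 1 = d + 1 + k by ring, pow_succ]
          generalize qPoch q (d + 1 + k) (n - k) = P
          generalize q ^ ((k : ℝ) * (a - d - n)) = E
          linear_combination (qBin q n k * (-1) ^ k * qPoch q a k * P * E) *
            (q ^ (-(k : ℝ)) * e1 - q ^ (-(k : ℝ)) * q ^ (a - d) * qNum q (a + k) * e4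
              + q ^ a * qNum q (d - a) * e5)
      _ = _ := by
          rw [← mul_sum, ih, qPoch_succ', show d + 1 - a = d - a + 1 by ring,
            show a * ((n + 1 : ℕ) : ℝ) = a + a * n by push_cast; ring, Real.rpow_add hq a]
          ring

/-- q-numbers are invariant under q → q⁻¹, so only the powers of q change: every summation has such
a mirror image. -/
theorem qVandermonde_inv (hq : 0 < q) (n : ℕ) (a d : ℝ) :
    ∑ k ∈ range (n + 1), (-1) ^ k * qBin q n k * qPoch q a k * qPoch q (d + k) (n - k) *
      q ^ (-((k : ℝ) * (a - d - n + 1))) = q ^ (-(a * n)) * qPoch q (d - a) n := by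
  have := qVandermonde (inv_pos.2 hq) n a d
  simpa only [qBin_inv hq, qPoch_inv hq, Real.inv_rpow hq.le, ← Real.rpow_neg hq.le] using this

/-! ### Terminating 3F2 series and their transformations. -/

/-- The terminating balanced-argument `q`-hypergeometric sum of type `3F2`, multiplied by the
denominator parameters so that it is a polynomial in all `[·]`. -/
def qHyp (q : ℝ) (n : ℕ) (a b d e : ℝ) : ℝ :=
  ∑ k ∈ range (n + 1), (-1) ^ k * qBin q n k * (qPoch q a k * qPoch q b k *
    qPoch q (d + k) (n - k) * qPoch q (e + k) (n - k)) * q ^ ((k : ℝ) * (a + b - d - e - n + 1))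

theorem qHyp_comm_left (q : ℝ) (n : ℕ) (a b d e : ℝ) : qHyp q n a b d e = qHyp q n b a d e :=
  sum_congr rfl fun k _ => by
    rw [mul_comm (qPoch q a k), show a + b - d - e - (n : ℝ) + 1 = b + a - d - e - n + 1 by ring]

theorem qHyp_comm_right (q : ℝ) (n : ℕ) (a b d e : ℝ) : qHyp q n a b d e = qHyp q n a b e d :=
  sum_congr rfl fun k _ => by
    rw [mul_right_comm _ (qPoch q (d + k) _),
      show a + b - d - e - (n : ℝ) + 1 = a + b - e - d - n + 1 by ring]

theorem neg_one_pow_mul_self (n : ℕ) : (-1 : ℝ) ^ n * (-1) ^ n = 1 := by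
  rw [← mul_pow]; simp

theorem neg_one_pow_sub {n k : ℕ} (h : k ≤ n) : (-1 : ℝ) ^ (n - k) = (-1) ^ n * (-1) ^ k := by
  obtain ⟨m, rfl⟩ := Nat.exists_eq_add_of_le h
  rw [Nat.add_sub_cancel_left, pow_add, mul_right_comm, neg_one_pow_mul_self, one_mul]

theorem sum_range_triangle (N : ℕ) (f : ℕ → ℕ → ℝ) :
    ∑ k ∈ range N, ∑ r ∈ range (k + 1), f k r =
      ∑ r ∈ range N, ∑ i ∈ range (N - r), f (r + i) r := by
  rw [sum_comm' (t' := range N) (s' := fun r => Ico r N)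
    (by intro x y; simp only [mem_range, mem_Ico]; omega)]
  exact sum_congr rfl fun r _ => sum_Ico_eq_sum_range _ _ _

/-- Expand (a)_k by q-Vandermonde with parameters d - a and d in base q⁻¹ and exchange the two
summations; the sum over k, now starting at k = r, is again of Vandermonde type. -/
theorem qHyp_eq_sum (hq : 0 < q) (n : ℕ) (a b d e : ℝ) :
    qHyp q n a b d e = q ^ (b * n) * ∑ r ∈ range (n + 1), qBin q n r * (qPoch q b r *
      qPoch q (d - a) r * qPoch q (d + r) (n - r) * qPoch q (e - b) (n - r)) *
        q ^ ((r : ℝ) * (a - e)) := by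
  have hT : ∀ k ∈ range (n + 1), (-1) ^ k * qBin q n k * (qPoch q a k * qPoch q b k *
      qPoch q (d + k) (n - k) * qPoch q (e + k) (n - k)) *
        q ^ ((k : ℝ) * (a + b - d - e - n + 1)) =
      ∑ r ∈ range (k + 1), (-1) ^ (k - r) * qBin q n r * qBin q (n - r) (k - r) *
        (qPoch q b r * qPoch q (b + r) (k - r) * qPoch q (e + k) (n - k) * qPoch q (d - a) r *
          qPoch q (d + r) (n - r)) *
        q ^ (((k - r : ℕ) : ℝ) * ((b + r) - (e + r) - ((n - r : ℕ) : ℝ) + 1)) *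
        q ^ ((r : ℝ) * (a + b - e - n + r)) := by
    intro k hk
    have hk := Nat.lt_succ_iff.1 (mem_range.1 hk)
    have h1 := qVandermonde_inv hq k (d - a) d
    rw [sub_sub_cancel] at h1
    have h2 : qPoch q a k = q ^ ((d - a) * k) * (q ^ (-((d - a) * k)) * qPoch q a k) := by
      rw [← mul_assoc, ← Real.rpow_add hq]; simp
    rw [h2, ← h1]
    simp only [mul_sum, sum_mul]
    refine sum_congr rfl fun r hr => ?_
    have hr := Nat.lt_succ_iff.1 (mem_range.1 hr)
    have h3 := qBin_mul hq (n := n) (r := r) (i := k - r) (by omega)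
    rw [Nat.add_sub_cancel' hr] at h3
    have h4 := qPoch_add q b r (k - r)
    rw [Nat.add_sub_cancel' hr] at h4
    have h5 := qPoch_add q (d + r) (k - r) (n - k)
    rw [show k - r + (n - k) = n - r by omega, Nat.cast_sub hr,
      show d + (r : ℝ) + (k - r) = d + k by ring] at h5
    have h6 : q ^ (((k - r : ℕ) : ℝ) * ((b + r) - (e + r) - ((n - r : ℕ) : ℝ) + 1)) *
        q ^ ((r : ℝ) * (a + b - e - n + r)) = q ^ ((d - a) * k) *
          q ^ (-((r : ℝ) * (d - a - d - k + 1))) * q ^ ((k : ℝ) * (a + b - d - e - n + 1)) := by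
      simp only [← Real.rpow_add hq]
      rw [Nat.cast_sub hr, Nat.cast_sub (hr.trans hk)]
      congr 1; ring
    rw [mul_assoc _ (q ^ (((k - r : ℕ) : ℝ) * _)), h6, h5, h4, neg_one_pow_sub hr]
    linear_combination ((-1) ^ k * (-1) ^ r * qPoch q b r * qPoch q (b + r) (k - r) *
      qPoch q (e + k) (n - k) * qPoch q (d - a) r * qPoch q (d + r) (k - r) * qPoch q (d + k) (n - k) *
      q ^ ((d - a) * k) * q ^ (-((r : ℝ) * (d - a - d - k + 1))) *
        q ^ ((k : ℝ) * (a + b - d - e - n + 1))) * h3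
  rw [qHyp, sum_congr rfl hT, mul_sum]
  rw [sum_range_triangle]
  refine sum_congr rfl fun r hr => ?_
  have hr := Nat.lt_succ_iff.1 (mem_range.1 hr)
  have h1 := qVandermonde hq (n - r) (b + r) (e + r)
  rw [show e + (r : ℝ) - (b + r) = e - b by ring] at h1
  have h2 : q ^ (b * n) * q ^ ((r : ℝ) * (a - e)) =
      q ^ ((b + r) * ((n - r : ℕ) : ℝ)) * q ^ ((r : ℝ) * (a + b - e - n + r)) := by
    rw [← Real.rpow_add hq, ← Real.rpow_add hq, Nat.cast_sub hr]; congr 1; ring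
  calc _ = qBin q n r * (qPoch q b r * qPoch q (d - a) r * qPoch q (d + r) (n - r)) *
        q ^ ((r : ℝ) * (a + b - e - n + r)) * (q ^ ((b + r) * ((n - r : ℕ) : ℝ)) *
          qPoch q (e - b) (n - r)) := by
        rw [← h1, mul_sum, Nat.sub_add_comm hr]
        refine sum_congr rfl fun i hi => ?_
        rw [Nat.add_sub_cancel_left, Nat.cast_add, ← add_assoc, Nat.sub_sub]
        ring
    _ = _ := by linear_combination (-(qBin q n r * (qPoch q b r * qPoch q (d - a) r *
        qPoch q (d + r) (n - r)) * qPoch q (e - b) (n - r))) * h2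

/-- Reversing the one factor (e - b)_{n-r} in `qHyp_eq_sum` turns that expansion into a series of
the same kind in base q⁻¹. This is the q-analogue of Sheppard's 3F2 transformation; the later ones
are composed of it and of reversal. -/
theorem qHyp_transform (hq : 0 < q) (n : ℕ) (a b d e : ℝ) :
    qHyp q n a b d e = (-1) ^ n * q ^ (b * n) * qHyp q⁻¹ n b (d - a) d (b - e - n + 1) := by
  rw [qHyp_eq_sum hq, qHyp, mul_sum, mul_sum]
  refine sum_congr rfl fun r hr => ?_
  have hr := Nat.lt_succ_iff.1 (mem_range.1 hr)
  simp only [qBin_inv hq, qPoch_inv hq, Real.inv_rpow hq.le, ← Real.rpow_neg hq.le]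
  rw [qPoch_reverse q (b - e - n + 1 + r), Nat.cast_sub hr,
    show 1 - (b - e - (n : ℝ) + 1 + r) - (n - r) = e - b by ring,
    show -((r : ℝ) * (b + (d - a) - d - (b - e - n + 1) - n + 1)) = r * (a - e) by ring,
    neg_one_pow_sub hr]
  linear_combination (-(q ^ (b * n) * (qBin q n r * (qPoch q b r *
      qPoch q (d - a) r * qPoch q (d + r) (n - r) * qPoch q (e - b) (n - r)) *
        q ^ ((r : ℝ) * (a - e))))) * (neg_one_pow_mul_self n * ((-1) ^ r * (-1) ^ r) + neg_one_pow_mul_self r)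

/-- Under k → n - k upper and lower parameters exchange their roles and the base is inverted. -/
theorem qHyp_reverse (hq : 0 < q) (n : ℕ) (a b d e : ℝ) :
    qHyp q n a b d e = (-1) ^ n * q ^ (n * (a + b - d - e - n + 1)) *
      qHyp q⁻¹ n (1 - d - n) (1 - e - n) (1 - a - n) (1 - b - n) := by
  rw [qHyp, ← sum_range_reflect, qHyp, mul_sum]
  refine sum_congr rfl fun k hk => ?_
  have hk := Nat.lt_succ_iff.1 (mem_range.1 hk)
  simp only [qBin_inv hq, qPoch_inv hq, Real.inv_rpow hq.le, ← Real.rpow_neg hq.le]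
  rw [show n + 1 - 1 - k = n - k by omega, qBin_symm q hk, Nat.sub_sub_self hk,
    qPoch_reverse q a, qPoch_reverse q b, qPoch_reverse q (d + _), qPoch_reverse q (e + _),
    Nat.cast_sub hk,
    show 1 - a - ((n : ℝ) - k) = 1 - a - n + k by ring,
    show 1 - b - ((n : ℝ) - k) = 1 - b - n + k by ring,
    show 1 - (d + ((n : ℝ) - k)) - k = 1 - d - n by ring,
    show 1 - (e + ((n : ℝ) - k)) - k = 1 - e - n by ring,
    show ((n : ℝ) - k) * (a + b - d - e - n + 1) = n * (a + b - d - e - n + 1) +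
      -(k * (1 - d - n + (1 - e - n) - (1 - a - n) - (1 - b - n) - n + 1)) by ring,
    Real.rpow_add hq, neg_one_pow_sub hk]
  generalize qPoch q (1 - a - n + k) (n - k) = P1
  generalize qPoch q (1 - b - n + k) (n - k) = P2
  generalize q ^ (n * (a + b - d - e - n + 1)) = E
  generalize q ^ (-(k * (1 - d - n + (1 - e - n) - (1 - a - n) - (1 - b - n) - n + 1))) = E'
  have h1 := neg_one_pow_mul_self n
  have h2 := neg_one_pow_mul_self k
  generalize (-1 : ℝ) ^ n = u at *
  generalize (-1 : ℝ) ^ k = v at *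
  linear_combination (u * v * qBin q n k * (P1 * P2 * qPoch q (1 - d - n) k * qPoch q (1 - e - n) k)
    * E * E') * (u * u * (v * v + 1) * h2 + h1)

/-- The `q`-analogue of the Pfaff--Saalschütz summation. -/
theorem qHyp_saalschutz (hq : 0 < q) (n : ℕ) (a b d e : ℝ) (h : e = a + b - d - n + 1) :
    qHyp q n a b d e = (-1) ^ n * qPoch q (d - a) n * qPoch q (d - b) n := by
  -- Balance makes the new lower parameter equal to the upper parameter d - a. The two merge into a
  -- factor (d - a)_n free of the summation index, and a Vandermonde sum remains.
  rw [qHyp_transform hq, show b - e - (n : ℝ) + 1 = d - a by rw [h]; ring, qHyp]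
  have h1 := qVandermonde_inv hq n b d
  have h2 : qPoch q (d - b) n = q ^ (b * n) * (q ^ (-(b * n)) * qPoch q (d - b) n) := by
    rw [← mul_assoc, ← Real.rpow_add hq]; simp
  rw [h2, ← h1]
  simp only [mul_sum]
  refine sum_congr rfl fun r hr => ?_
  have hr := Nat.lt_succ_iff.1 (mem_range.1 hr)
  have h4 := qPoch_add q (d - a) r (n - r)
  rw [Nat.add_sub_cancel' hr] at h4
  simp only [qBin_inv hq, qPoch_inv hq, Real.inv_rpow hq.le, ← Real.rpow_neg hq.le]
  rw [h4, show b + (d - a) - d - (d - a) - (n : ℝ) + 1 = b - d - n + 1 by ring]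
  ring

theorem inv_rpow_eq (hq : 0 < q) (x : ℝ) : q⁻¹ ^ x = q ^ (-x) := by
  rw [Real.inv_rpow hq.le, Real.rpow_neg hq.le]

/-- `qHyp_transform` applied twice: the base returns to q and the signs cancel. -/
theorem qHyp_euler (hq : 0 < q) (n : ℕ) (a b d e : ℝ) :
    qHyp q n a b d e = q ^ ((a + b - d) * n) * qHyp q n (d - a) (d - b) d (d + e - a - b) := by
  rw [qHyp_transform hq, qHyp_transform (inv_pos.2 hq), inv_inv, inv_rpow_eq hq,
    show d - a - (b - e - (n : ℝ) + 1) - n + 1 = d + e - a - b by ring,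
    show (a + b - d) * (n : ℝ) = b * n + -((d - a) * n) by ring, Real.rpow_add hq]
  linear_combination (q ^ (b * n) * q ^ (-((d - a) * n)) *
    qHyp q n (d - a) (d - b) d (d + e - a - b)) * neg_one_pow_mul_self n

/-- The left side after `qHyp_euler` and the right side after `qHyp_transform` and reversal are the
same series. The result keeps the base and carries no prefactor. -/
theorem qHyp_flip (hq : 0 < q) (n : ℕ) (a b d e : ℝ) :
    qHyp q n a b d e =
      qHyp q n b (a + b - d - e - n + 1) (1 + b - d - n) (1 + b - e - n) := by
  rw [qHyp_euler hq n a b, qHyp_transform hq n b, qHyp_reverse (inv_pos.2 hq), inv_inv,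
    inv_rpow_eq hq, qHyp_comm_left, qHyp_comm_right,
    show 1 - (1 + b - d - (n : ℝ)) - n = d - b by ring,
    show 1 - (a + b - d - e - n + 1 - (1 + b - e - (n : ℝ)) - n + 1) - n = d - a by ring,
    show 1 - (a + b - d - e - (n : ℝ) + 1) - n = d + e - a - b by ring,
    show 1 - (1 + b - d - (n : ℝ) - b) - n = d by ring,
    show (a + b - d) * (n : ℝ) = (a + b - d - e - n + 1) * n + -(n * (a + b - d - e - n + 1 +
      (1 + b - d - n - b) - (1 + b - d - n) - (a + b - d - e - n + 1 - (1 + b - e - n) - n + 1)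
        - n + 1)) by ring, Real.rpow_add hq]
  rw [qHyp_comm_right q n (d - b), qHyp_comm_left q n (d - b)]
  generalize qHyp q n _ _ _ _ = X
  generalize q ^ ((a + b - d - e - n + 1) * (n : ℝ)) = Y
  linear_combination (-(Y * q ^ (-(n * (a + b - d - e - n + 1 +
      (1 + b - d - n - b) - (1 + b - d - n) - (a + b - d - e - n + 1 - (1 + b - e - n) - n + 1)
        - n + 1))) * X)) * neg_one_pow_mul_self n

/-! ### Integers among the reals; factorials as Pochhammer symbols. -/

/-- `x` is a non-negative integer. -/
def IsNat (x : ℝ) : Prop := ∃ n : ℕ, x = n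

/-- `x` is an integer. -/
def IsInt (x : ℝ) : Prop := ∃ n : ℤ, x = n

theorem IsNat.isInt {x : ℝ} (h : IsNat x) : IsInt x := by
  obtain ⟨n, rfl⟩ := h; exact ⟨n, by simp⟩

theorem IsNat.nonneg {x : ℝ} (h : IsNat x) : 0 ≤ x := by
  obtain ⟨n, rfl⟩ := h; positivity

theorem IsInt.isNat {x : ℝ} (h : IsInt x) (h0 : 0 ≤ x) : IsNat x := by
  obtain ⟨n, rfl⟩ := h
  lift n to ℕ using (by exact_mod_cast h0)
  exact ⟨n, by simp⟩

theorem isNat_natCast (n : ℕ) : IsNat n := ⟨n, rfl⟩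

theorem IsNat.add {x y : ℝ} (hx : IsNat x) (hy : IsNat y) : IsNat (x + y) := by
  obtain ⟨m, rfl⟩ := hx; obtain ⟨n, rfl⟩ := hy; exact ⟨m + n, by push_cast; rfl⟩

theorem IsInt.add {x y : ℝ} (hx : IsInt x) (hy : IsInt y) : IsInt (x + y) := by
  obtain ⟨m, rfl⟩ := hx; obtain ⟨n, rfl⟩ := hy; exact ⟨m + n, by push_cast; rfl⟩

theorem IsInt.neg {x : ℝ} (hx : IsInt x) : IsInt (-x) := by
  obtain ⟨m, rfl⟩ := hx; exact ⟨-m, by push_cast; rfl⟩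

theorem IsInt.sub {x y : ℝ} (hx : IsInt x) (hy : IsInt y) : IsInt (x - y) := by
  rw [sub_eq_add_neg]; exact hx.add hy.neg

theorem IsInt.neg_or_isNat {x : ℝ} (hx : IsInt x) : x < 0 ∨ IsNat x :=
  (lt_or_ge x 0).imp_right hx.isNat

theorem IsInt.le_neg_one {x : ℝ} (hx : IsInt x) (h : x < 0) : x ≤ -1 := by
  obtain ⟨m, rfl⟩ := hx
  have : m < 0 := by exact_mod_cast h
  exact_mod_cast (show m ≤ -1 by omega)

theorem qFact_ne_zero (hq : 0 < q) {x : ℝ} (hx : IsNat x) : qFact q x ≠ 0 :=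
  (qFact_pos hq hx.nonneg).ne'

theorem qFact_inv_of_neg (q : ℝ) {x : ℝ} (hx : x < 0) : (qFact q x)⁻¹ = 0 := by
  rw [qFact_of_neg q hx, inv_zero]

theorem qPoch_pos (hq : 0 < q) {x : ℝ} (hx : 0 < x) (n : ℕ) : 0 < qPoch q x n :=
  prod_pos fun i _ => qNum_pos hq (by positivity)

theorem qPoch_eq_zero (q : ℝ) {x : ℝ} {n : ℕ} (hx : IsInt x) (h0 : x ≤ 0) (h1 : 0 < x + n) :
    qPoch q x n = 0 := by
  obtain ⟨m, hm⟩ := hx.neg.isNat (neg_nonneg.2 h0)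
  refine prod_eq_zero (i := m) (mem_range.2 ?_) ?_
  · have : (m : ℝ) < n := by linarith
    exact_mod_cast this
  · rw [← hm, add_neg_cancel, qNum_zero]

theorem qFact_add_natCast (q : ℝ) {U : ℝ} (hU : IsNat U) (x : ℕ) :
    qFact q (U + x) = qFact q U * qPoch q (U + 1) x := by
  obtain ⟨u, rfl⟩ := hU
  induction x with
  | zero => simp [qPoch_zero]
  | succ x ih =>
    have := qFact_natCast_succ q (u + x)
    push_cast at this
    rw [qPoch_succ, ← mul_assoc, ← ih, Nat.cast_succ, ← add_assoc, this, mul_comm,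
      add_right_comm (u : ℝ) 1]

theorem qFact_add_upper (q : ℝ) {U : ℝ} (hU : IsNat U) (n : ℕ) :
    ∀ x ≤ n, qFact q (U + x) = qFact q U * 1 ^ x * qPoch q (U + 1) x := fun x _ => by
  rw [one_pow, mul_one, qFact_add_natCast q hU]

/-- True beyond x = W as well: there the inverse factorial is 0 by convention and the Pochhammer
symbol contains [0]. -/
theorem qFact_sub_upper (hq : 0 < q) {W : ℝ} (hW : IsNat W) (n : ℕ) :
    ∀ x ≤ n, (qFact q (W - x))⁻¹ = (qFact q W)⁻¹ * (-1) ^ x * qPoch q (-W) x := fun x _ => by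
  rcases (hW.isInt.sub (isNat_natCast x).isInt).neg_or_isNat with h | h
  · rw [qFact_inv_of_neg q h, qPoch_eq_zero q hW.isInt.neg (by linarith [hW.nonneg]) (by linarith),
      mul_zero]
  · have h1 := qFact_add_natCast q h x
    rw [sub_add_cancel, qPoch_reverse, show 1 - (W - (x : ℝ) + 1) - x = -W by ring] at h1
    have h2 := qFact_ne_zero hq h
    have h3 := qFact_ne_zero hq hW
    rw [inv_mul_eq_div, ← mul_div_right_comm, inv_eq_one_div, div_eq_div_iff h2 h3, one_mul, h1]
    ring

/-- C itself may be negative; only C + n must be a natural number. To allow this, `qHyp` carries (d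
+ k)_{n-k} in the numerator rather than (d)_k in the denominator. -/
theorem qFact_add_lower (hq : 0 < q) {C : ℝ} {n : ℕ} (hC : IsNat (C + n)) :
    ∀ x ≤ n, (qFact q (C + x))⁻¹ = (qFact q (C + n))⁻¹ * 1 ^ x * qPoch q (C + 1 + x) (n - x) :=
  fun x hx => by
  have hI : IsInt (C + x) := by
    have := hC.isInt.sub (isNat_natCast (n - x)).isInt
    rwa [Nat.cast_sub hx, show C + n - ((n : ℝ) - x) = C + x by ring] at this
  rcases hI.neg_or_isNat with h | h
  · have := hI.le_neg_one h
    rw [qFact_inv_of_neg q h, qPoch_eq_zero q _ (by linarith) _, mul_zero]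
    · convert hI.add (isNat_natCast 1).isInt using 1; push_cast; ring
    · rw [Nat.cast_sub hx]; linarith [hC.nonneg]
  · have h1 := qFact_add_natCast q h (n - x)
    rw [Nat.cast_sub hx, show C + x + ((n : ℝ) - x) = C + n by ring,
      show C + (x : ℝ) + 1 = C + 1 + x by ring] at h1
    have h2 := qFact_ne_zero hq h
    have h3 := qFact_ne_zero hq hC
    rw [one_pow, mul_one, inv_mul_eq_div, inv_eq_one_div, div_eq_div_iff h2 h3, h1]
    ring

theorem qFact_sub_lower (q : ℝ) {V : ℝ} {n : ℕ} (hV : IsNat (V - n)) :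
    ∀ x ≤ n, qFact q (V - x) = qFact q (V - n) * (-1) ^ n * (-1) ^ x * qPoch q (-V + x) (n - x) :=
  fun x hx => by
  have h1 := qFact_add_natCast q hV (n - x)
  rw [qPoch_reverse, Nat.cast_sub hx, show V - (n : ℝ) + (n - x) = V - x by ring,
    show 1 - (V - (n : ℝ) + 1) - (n - x) = -V + x by ring, neg_one_pow_sub hx] at h1
  rw [h1]; ring

/-- A sum with factors proportional to two upper and two lower Pochhammer symbols, as a
hypergeometric sum. -/
theorem sum_eq_qHyp {n : ℕ} {a b d e s₀ s₁ s₂ s₃ s₄ κ₁ κ₂ κ₃ κ₄ σ : ℝ} {φ₁ φ₂ φ₃ φ₄ : ℕ → ℝ}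
    (hq : 0 < q)
    (h₁ : ∀ x ≤ n, φ₁ x = κ₁ * s₁ ^ x * qPoch q a x)
    (h₂ : ∀ x ≤ n, φ₂ x = κ₂ * s₂ ^ x * qPoch q b x)
    (h₃ : ∀ x ≤ n, φ₃ x = κ₃ * s₃ ^ x * qPoch q (d + x) (n - x))
    (h₄ : ∀ x ≤ n, φ₄ x = κ₄ * s₄ ^ x * qPoch q (e + x) (n - x))
    (hs : s₀ * s₁ * s₂ * s₃ * s₄ = -1) (hσ : σ = a + b - d - e - n + 1) :
    ∑ x ∈ range (n + 1), s₀ ^ x * (φ₁ x * φ₂ x * φ₃ x * φ₄ x * (qFact q x)⁻¹ *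
        (qFact q ((n : ℝ) - x))⁻¹) * q ^ ((x : ℝ) * σ) =
      κ₁ * κ₂ * κ₃ * κ₄ * (qFact q n)⁻¹ * qHyp q n a b d e := by
  rw [qHyp, mul_sum]
  refine sum_congr rfl fun x hx => ?_
  have hx := Nat.lt_succ_iff.1 (mem_range.1 hx)
  have hn := (qFact_natCast_pos hq n).ne'
  have hn' := inv_mul_cancel₀ hn
  rw [h₁ x hx, h₂ x hx, h₃ x hx, h₄ x hx, ← hs, ← hσ, qBin, div_eq_mul_inv, mul_inv]
  generalize (qFact q n)⁻¹ = u at *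
  generalize (qFact q x)⁻¹ = v at *
  generalize (qFact q ((n : ℝ) - x))⁻¹ = w at *
  linear_combination (-(s₀ ^ x * (κ₁ * s₁ ^ x * qPoch q a x * (κ₂ * s₂ ^ x * qPoch q b x) *
    (κ₃ * s₃ ^ x * qPoch q (d + x) (n - x)) * (κ₄ * s₄ ^ x * qPoch q (e + x) (n - x)) * v * w) *
      q ^ ((x : ℝ) * σ))) * hn'

theorem sum_eq_qHyp_inv {n : ℕ} {a b d e s₀ s₁ s₂ s₃ s₄ κ₁ κ₂ κ₃ κ₄ σ : ℝ} {φ₁ φ₂ φ₃ φ₄ : ℕ → ℝ}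
    (hq : 0 < q)
    (h₁ : ∀ x ≤ n, φ₁ x = κ₁ * s₁ ^ x * qPoch q a x)
    (h₂ : ∀ x ≤ n, φ₂ x = κ₂ * s₂ ^ x * qPoch q b x)
    (h₃ : ∀ x ≤ n, φ₃ x = κ₃ * s₃ ^ x * qPoch q (d + x) (n - x))
    (h₄ : ∀ x ≤ n, φ₄ x = κ₄ * s₄ ^ x * qPoch q (e + x) (n - x))
    (hs : s₀ * s₁ * s₂ * s₃ * s₄ = -1) (hσ : σ = -(a + b - d - e - n + 1)) :
    ∑ x ∈ range (n + 1), s₀ ^ x * (φ₁ x * φ₂ x * φ₃ x * φ₄ x * (qFact q x)⁻¹ *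
        (qFact q ((n : ℝ) - x))⁻¹) * q ^ ((x : ℝ) * σ) =
      κ₁ * κ₂ * κ₃ * κ₄ * (qFact q n)⁻¹ * qHyp q⁻¹ n a b d e := by
  have := sum_eq_qHyp (q := q⁻¹) (σ := -σ) (inv_pos.2 hq) (by simpa only [qPoch_inv hq] using h₁)
    (by simpa only [qPoch_inv hq] using h₂) (by simpa only [qPoch_inv hq] using h₃)
    (by simpa only [qPoch_inv hq] using h₄) hs (by rw [hσ, neg_neg])
  simpa only [inv_rpow_eq hq, mul_neg, neg_neg, qFact_inv hq] using this

/-! ### The very-well-poised sum and the summation over a spin. -/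

theorem sum_range_eq_of_zero {f : ℕ → ℝ} {m n : ℕ} (h : m ≤ n) (hf : ∀ i, m ≤ i → f i = 0) :
    ∑ i ∈ range n, f i = ∑ i ∈ range m, f i :=
  (sum_subset (range_mono h) fun i _ hi => hf i (by simpa using hi)).symm

theorem qBin_eq_succ (hq : 0 < q) (n k : ℕ) (hk : k ≤ n + 1) :
    qBin q n k = qNum q ((n : ℝ) + 1 - k) / qNum q ((n : ℝ) + 1) * qBin q (n + 1) k := by
  have h1 := (qNum_pos hq (show (0 : ℝ) < n + 1 by positivity)).ne'
  rcases Nat.lt_or_eq_of_le hk with hk | rfl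
  · obtain ⟨m, rfl⟩ := Nat.exists_eq_add_of_le (Nat.lt_succ_iff.1 hk)
    have h2 := (qNum_pos hq (show (0 : ℝ) < m + 1 by positivity)).ne'
    have h3 := (qFact_natCast_pos hq k).ne'
    have h4 := (qFact_natCast_pos hq m).ne'
    simp only [qBin]
    push_cast at h1 ⊢
    rw [show (k : ℝ) + m - k = m by ring, show (k : ℝ) + m + 1 - k = m + 1 by ring,
      qFact_natCast_succ, ← Nat.cast_add, qFact_natCast_succ]
    push_cast
    field_simp
  · rw [qBin_of_lt q (Nat.lt_succ_self n)]
    push_cast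
    rw [sub_self, qNum_zero]; simp

theorem qBin_succ_mul (hq : 0 < q) (n k : ℕ) (hk : k ≤ n) :
    qNum q ((k : ℝ) + 1) * qBin q n (k + 1) = qNum q ((n : ℝ) - k) * qBin q n k := by
  obtain ⟨m, rfl⟩ := Nat.exists_eq_add_of_le hk
  have h1 := (qNum_pos hq (show (0 : ℝ) < k + 1 by positivity)).ne'
  have h3 := (qFact_natCast_pos hq k).ne'
  simp only [qBin]
  push_cast
  rw [show (k : ℝ) + m - k = m by ring, show (k : ℝ) + m - (k + 1) = m - 1 by ring, qFact_natCast_succ]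
  cases m with
  | zero => simp [qNum_zero, qFact_of_neg]
  | succ m =>
    have h2 := (qNum_pos hq (show (0 : ℝ) < m + 1 by positivity)).ne'
    have h4 := (qFact_natCast_pos hq m).ne'
    push_cast
    rw [show (m : ℝ) + 1 - 1 = m by ring, qFact_natCast_succ]
    field_simp

/-- The telescoping relation in `sum_very_well_poised` with M = N + 1, freed of its common factors.
For q ≠ 1 it is a Laurent polynomial identity in q^α, q^β, q^M and q^k. -/
theorem qNum_wz (hq : 0 < q) (α β M k : ℝ) :
    qNum q M * qNum q (α + 2 * k) * qNum q (α - β + M)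
      - q ^ (-β) * qNum q (M - k) * qNum q (α + 2 * k) * qNum q (α + k + M) =
    -(q ^ (-(k + α + M)) * qNum q (M - k) * qNum q (β + k) * qNum q (α + k))
      + q ^ (k - M) * qNum q k * qNum q (α - β + k) * qNum q (α + k + M) := by
  by_cases h : q = 1
  · subst h; simp only [qNum, if_true, Real.one_rpow]; ring
  · simp only [qNum, if_neg h]
    have h1 : q - q⁻¹ ≠ 0 := by
      intro h2
      have h3 : q * q = 1 := by
        rw [← mul_inv_cancel₀ hq.ne', ← sub_eq_zero.1 h2]
      exact h ((mul_self_eq_one_iff.1 h3).resolve_right (by linarith))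
    generalize q - q⁻¹ = δ at *
    have e : ∀ x y : ℝ, q ^ (x + y) = q ^ x * q ^ y := fun x y => Real.rpow_add hq x y
    simp only [neg_add, sub_eq_add_neg, neg_neg, two_mul, e]
    have hi : ∀ x : ℝ, q ^ (-x) = (q ^ x)⁻¹ := fun x => Real.rpow_neg hq.le x
    simp only [hi]
    have hα := (Real.rpow_pos_of_pos hq α).ne'
    have hβ := (Real.rpow_pos_of_pos hq β).ne'
    have hM := (Real.rpow_pos_of_pos hq M).ne'
    have hk := (Real.rpow_pos_of_pos hq k).ne'
    generalize q ^ α = A at *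
    generalize q ^ β = B at *
    generalize q ^ M = X at *
    generalize q ^ k = Y at *
    field_simp
    ring

/-- A q-analogue of the terminating very-well-poised 4F3 of argument -1, proved by the
Wilf–Zeilberger method: passing from N to N + 1 multiplies the sum by q^(-β), since the difference
of the summands telescopes. -/
theorem sum_very_well_poised (hq : 0 < q) (N : ℕ) {α : ℝ} (hα : 0 < α) (β : ℝ) :
    ∑ k ∈ range (N + 1), qBin q N k * q ^ (-((k : ℝ) * (k + α))) * qNum q (α + 2 * k) *
      qPoch q β k * qPoch q (α + 1 - β + k) (N - k) / qPoch q (α + k) (N + 1) =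
    q ^ (-(N * β)) := by
  induction N with
  | zero => simp [qPoch_zero, qPoch_succ, qBin_zero hq, (qNum_pos hq hα).ne']
  | succ N ih =>
    -- The telescoping certificate. It vanishes at k = 0 through [k] and at k = N + 2 through the
    -- q-binomial coefficient.
    set G : ℕ → ℝ := fun k => -(q ^ (-((k : ℝ) * (k + α)) + (k - 1 - N)) * (qNum q k / qNum q (N + 1)) *
      qBin q (N + 1) k * qPoch q β k * qPoch q (α - β + k) (N + 1 - k) / qPoch q (α + k) (N + 1)) with hG
    set t : ℕ → ℕ → ℝ := fun N k => qBin q N k * q ^ (-((k : ℝ) * (k + α))) * qNum q (α + 2 * k) *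
      qPoch q β k * qPoch q (α + 1 - β + k) (N - k) / qPoch q (α + k) (N + 1) with ht
    have key : ∀ k ∈ range (N + 2), t (N + 1) k - q ^ (-β) * t N k = G (k + 1) - G k := by
      intro k hk
      have hk := Nat.lt_succ_iff.1 (mem_range.1 hk)
      have hN := (qNum_pos hq (show (0 : ℝ) < N + 1 by positivity)).ne'
      have ha : ∀ n, qPoch q (α + k) n ≠ 0 := fun n => (qPoch_pos hq (by positivity) n).ne'
      have ha' : ∀ n, qPoch q (α + k + 1) n ≠ 0 := fun n => (qPoch_pos hq (by positivity) n).ne'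
      have hb := (qNum_pos hq (show (0 : ℝ) < α + k by positivity)).ne'
      have hc := (qNum_pos hq (show (0 : ℝ) < α + k + (N + 1) by positivity)).ne'
      simp only [ht, hG]
      rw [qBin_eq_succ hq N k hk]
      have e1 := qBin_succ_mul hq (N + 1) k hk
      have e2 : qPoch q (α + k) (N + 1 + 1) = qNum q (α + k) * qPoch q (α + k + 1) (N + 1) :=
        qPoch_succ' _ _ _
      have e3 : qPoch q (α + k) (N + 1 + 1) = qPoch q (α + k) (N + 1) * qNum q (α + k + (N + 1)) := by
        rw [qPoch_succ]; push_cast; rfl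
      rcases Nat.lt_or_eq_of_le hk with hk' | rfl
      · have hk' := Nat.lt_succ_iff.1 hk'
        have e4 : qPoch q (α - β + k) (N + 1 - k) =
            qNum q (α - β + k) * qPoch q (α + 1 - β + k) (N - k) := by
          rw [Nat.succ_sub hk', qPoch_succ']; congr 2; ring
        have e5 : qPoch q (α + 1 - β + k) (N + 1 - k) =
            qPoch q (α + 1 - β + k) (N - k) * qNum q (α - β + (N + 1)) := by
          rw [Nat.succ_sub hk', qPoch_succ, Nat.cast_sub hk']; congr 2; ring
        have e6 : q ^ (-((((k + 1 : ℕ) : ℝ)) * (((k + 1 : ℕ) : ℝ) + α)) + (((k + 1 : ℕ) : ℝ) - 1 - N)) =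
            q ^ (-((k : ℝ) * (k + α))) * q ^ (-(k + α + (N + 1))) := by
          rw [← Real.rpow_add hq]; congr 1; push_cast; ring
        have e7 : q ^ (-((k : ℝ) * (k + α)) + (k - 1 - N)) =
            q ^ (-((k : ℝ) * (k + α))) * q ^ (k - ((N : ℝ) + 1)) := by
          rw [← Real.rpow_add hq]; congr 1; ring
        have e8 : qPoch q (α + ((k + 1 : ℕ) : ℝ)) (N + 1) =
            qPoch q (α + k) (N + 1) * qNum q (α + k + (N + 1)) / qNum q (α + k) := by
          rw [eq_div_iff hb, ← e3, e2, mul_comm]; push_cast; rw [add_assoc]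
        have e9 : qPoch q (α - β + ((k + 1 : ℕ) : ℝ)) (N + 1 - (k + 1)) =
            qPoch q (α + 1 - β + k) (N - k) := by
          rw [show N + 1 - (k + 1) = N - k by omega]; congr 1; push_cast; ring
        have e10 : qNum q ((k + 1 : ℕ) : ℝ) * qBin q (N + 1) (k + 1) =
            qNum q ((N : ℝ) + 1 - k) * qBin q (N + 1) k := by
          rw [Nat.cast_succ, e1]; push_cast; rfl
        have e11 : qBin q (N + 1) (k + 1) =
            qNum q ((N : ℝ) + 1 - k) * qBin q (N + 1) k / qNum q ((k + 1 : ℕ) : ℝ) := by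
          rw [← e10, mul_div_cancel_left₀]
          exact (qNum_pos hq (by positivity)).ne'
        have hk1 : qNum q ((k + 1 : ℕ) : ℝ) ≠ 0 := (qNum_pos hq (by positivity)).ne'
        have e12 := qNum_wz hq α β (N + 1) k
        rw [e3, e4, e5, e6, e7, e8, e9, e11, qPoch_succ q β k]
        have hD := ha (N + 1)
        have e13 : ∀ a b c d m x y z w v E P Q B D k₁ p₁ p₂ p₃: ℝ, m ≠ 0 → D ≠ 0 → b ≠ 0 → c ≠ 0 →
            k₁ ≠ 0 → m * a * d - p₁ * x * a * c = -(p₂ * x * y * b) + p₃ * z * w * c →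
            B * E * a * P * (Q * d) / (D * c) - p₁ * (x / m * B * E * a * P * Q / D) =
            -(E * p₂ * (k₁ / m) * (x * B / k₁) * (P * y) * Q / (D * c / b)) -
              -(E * p₃ * (z / m) * B * P * (w * Q) / D) := by
          intro a b c d m x y z w v E P Q B D k₁ p₁ p₂ p₃ hm hD hb hc hk h
          field_simp
          linear_combination (B * E * P * Q) * h
        exact e13 _ _ _ _ _ _ _ _ _ 0 _ _ _ _ _ _ _ _ _ hN hD hb hc hk1 e12
      -- At the top index k = N + 1 the summand of length N and G (k + 1) both vanish, so the claim
      -- is that the new summand equals -G k.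
      · have e4 : α + 2 * ((N + 1 : ℕ) : ℝ) = α + ((N + 1 : ℕ) : ℝ) + (N + 1) := by push_cast; ring
        have hm : qNum q ((N + 1 : ℕ) : ℝ) ≠ 0 := (qNum_pos hq (by positivity)).ne'
        have hD := ha (N + 1)
        rw [qBin_of_lt q (Nat.lt_succ_self (N + 1)), e3, e4, qBin_self hq,
          show ((N + 1 : ℕ) : ℝ) - 1 - N = 0 by push_cast; ring, add_zero,
          show (N : ℝ) + 1 - ((N + 1 : ℕ) : ℝ) = 0 by push_cast; ring, qNum_zero, Nat.sub_self,
          qPoch_zero, qPoch_zero, ← Nat.cast_succ, div_self hm]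
        rw [← Nat.cast_succ] at hc
        field_simp
        ring
    have h := sum_congr rfl key
    rw [sum_range_sub G, sum_sub_distrib, ← mul_sum, sum_range_succ (t N)] at h
    have h0 : t N (N + 1) = 0 := by simp [ht, qBin_of_lt]
    have h1 : G 0 = 0 := by simp [hG, qNum_zero]
    have h2 : G (N + 2) = 0 := by simp [hG, qBin_of_lt]
    rw [h0, h1, h2, ih, add_zero, sub_zero, sub_eq_zero] at h
    rw [h, ← Real.rpow_add hq]
    congr 1; push_cast; ring

attribute [local irreducible] qFact qPoch qNum qBin

/-- For Y ≤ X the inverse factorials confine j = J₀ + i to X ≤ j ≤ A. With j = X + k this is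
`sum_very_well_poised` for α = 2X + 1, β = X + Y + 1 and N = A - X. -/
theorem sum_spin_of_le (hq : 0 < q) {J₀ X Y A : ℝ} {M : ℕ} (h1 : J₀ < 1)
    (hX : IsInt (X - J₀)) (hY : IsInt (Y - J₀)) (hA : IsInt (A - J₀)) (hXY : IsNat (X + Y))
    (hM : A - J₀ < M) (hle : Y ≤ X) :
    ∑ i ∈ range M, q ^ (-((J₀ + i) * (J₀ + i + 1))) * qNum q (2 * (J₀ + i) + 1) *
      (qFact q (J₀ + i + X) * qFact q (J₀ + i + Y) * (qFact q (J₀ + i - X))⁻¹ *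
        (qFact q (J₀ + i - Y))⁻¹ * (qFact q (A - (J₀ + i)))⁻¹ * (qFact q (A + (J₀ + i) + 1))⁻¹) =
    q ^ (-(A * (X + Y + 1) - X * Y)) * (qFact q (X + Y) * (qFact q (A - X))⁻¹ *
      (qFact q (A - Y))⁻¹) := by
  have hX0 : 0 ≤ X := by linarith [hXY.nonneg]
  -- Since X ≥ 0 and J₀ < 1, the smallest contributing spin j = X is not below the start J₀ of the
  -- summation.
  have hm : IsNat (X - J₀) := hX.isNat (by
    by_contra h
    have := hX.le_neg_one (not_le.1 h)
    linarith)
  have hAX : IsInt (A - X) := by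
    have := hA.sub hX; rwa [sub_sub_sub_cancel_right] at this
  rcases hAX.neg_or_isNat with h | ⟨N, hN⟩
  · rw [qFact_inv_of_neg q h, mul_zero, zero_mul, mul_zero]
    refine sum_eq_zero fun i _ => ?_
    rcases lt_or_ge (J₀ + i) X with h' | h'
    · rw [qFact_inv_of_neg q (sub_neg.2 h')]; simp only [mul_zero, zero_mul]
    · rw [qFact_inv_of_neg q (show A - (J₀ + i) < 0 by linarith)]; simp only [mul_zero, zero_mul]
  obtain ⟨m, hm⟩ := hm
  have hmM : m + (N + 1) ≤ M := by
    have : ((m + N : ℕ) : ℝ) < M := by push_cast; linarith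
    have : m + N < M := by exact_mod_cast this
    omega
  have h2X : IsNat (2 * X) := by
    refine IsInt.isNat ?_ (by linarith)
    have := hXY.isInt.add (hX.sub hY)
    rwa [show X + Y + (X - J₀ - (Y - J₀)) = 2 * X by ring] at this
  have hXmY : IsNat (X - Y) := by
    refine IsInt.isNat ?_ (by linarith)
    have := hX.sub hY
    rwa [sub_sub_sub_cancel_right] at this
  obtain ⟨y, hy⟩ := hXmY
  rw [sum_range_eq_of_zero hmM, sum_range_add, sum_eq_zero, zero_add]
  · have hvwp := sum_very_well_poised hq N (α := 2 * X + 1) (by linarith) (X + Y + 1)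
    have e0 : q ^ (-(A * (X + Y + 1) - X * Y)) = q ^ (-(X * (X + 1))) * q ^ (-(N * (X + Y + 1))) := by
      rw [← Real.rpow_add hq, ← hN]; congr 1; ring
    rw [e0, ← hvwp, mul_sum, sum_mul]
    refine sum_congr rfl fun k hk => ?_
    have hk := Nat.lt_succ_iff.1 (mem_range.1 hk)
    have hj : J₀ + ((m + k : ℕ) : ℝ) = X + k := by push_cast; linarith
    have hA' : A = X + N := by linarith
    have hY' : Y = X - y := by linarith
    rw [hj]
    have e1 := qFact_add_natCast q h2X k
    have e2 := qFact_add_natCast q hXY k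
    have e3 := qFact_add_lower hq (C := X - Y) (n := N) (by rw [hy]; exact (isNat_natCast y).add (isNat_natCast N)) k hk
    have e4 := qFact_add_natCast q (U := 2 * X + k) (h2X.add (isNat_natCast k)) (N + 1)
    have e5 : q ^ (-((X + k) * (X + k + 1))) = q ^ (-(X * (X + 1))) * q ^ (-((k : ℝ) * (k + (2 * X + 1)))) := by
      rw [← Real.rpow_add hq]; congr 1; ring
    rw [show X + (k : ℝ) + X = 2 * X + k by ring, show X + (k : ℝ) + Y = X + Y + k by ring,
      add_sub_cancel_left, show X + (k : ℝ) - Y = X - Y + k by ring, e3,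
      show A - (X + (k : ℝ)) = N - k by linarith,
      show A + (X + (k : ℝ)) + 1 = 2 * X + k + ((N + 1 : ℕ) : ℝ) by push_cast; linarith, e4, e2, e5, hN,
      show A - Y = X - Y + N by linarith, show 2 * (X + (k : ℝ)) + 1 = 2 * X + 1 + 2 * k by ring,
      show 2 * X + 1 + 1 - (X + Y + 1) + (k : ℝ) = X - Y + 1 + k by ring,
      show 2 * X + (k : ℝ) + 1 = 2 * X + 1 + k by ring, qBin, one_pow]
    have n1 : qFact q (2 * X + k) ≠ 0 := qFact_ne_zero hq (h2X.add (isNat_natCast k))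
    have n2 := (qFact_natCast_pos hq N).ne'
    have e6 : qFact q (2 * X + k) * (qFact q (2 * X + k))⁻¹ = 1 := mul_inv_cancel₀ n1
    have e7 : qFact q N * (qFact q N)⁻¹ = 1 := mul_inv_cancel₀ n2
    simp only [div_eq_mul_inv, mul_inv]
    generalize (qFact q (2 * X + k))⁻¹ = g₁ at *
    generalize (qFact q N)⁻¹ = g₂ at *
    generalize qFact q (2 * X + k) = g₃ at *
    generalize qFact q N = g₄ at *
    generalize (qPoch q (2 * X + 1 + k) (N + 1))⁻¹ = g₅
    generalize qPoch q (X + Y + 1) k = g₆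
    generalize qPoch q (X - Y + 1 + k) (N - k) = g₇
    generalize (qFact q ((N : ℝ) - k))⁻¹ = g₈
    generalize (qFact q (k : ℝ))⁻¹ = g₉
    generalize (qFact q (X - Y + N))⁻¹ = f₁
    generalize q ^ (-(X * (X + 1))) = f₂
    generalize q ^ (-((k : ℝ) * (k + (2 * X + 1)))) = f₃
    linear_combination (f₂ * f₃ * qNum q (2 * X + 1 + 2 * k) * qFact q (X + Y) * g₆ * g₉ * g₇ * f₁ *
      g₈ * g₅) * (e6 - e7)
  · intro i hi
    have : (i : ℝ) < m := by exact_mod_cast mem_range.1 hi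
    rw [qFact_inv_of_neg q (show J₀ + i - X < 0 by linarith)]; simp only [mul_zero, zero_mul]
  · intro i hi
    have : ((m + (N + 1) : ℕ) : ℝ) ≤ i := by exact_mod_cast hi
    push_cast at this
    rw [qFact_inv_of_neg q (show A - (J₀ + i) < 0 by linarith)]; simp only [mul_zero, zero_mul]

/-- Both sides are symmetric in X and Y, so the ordering may be assumed. Every summation over the
intermediate spin of the 9j coefficient is done by this formula. -/
theorem sum_spin (hq : 0 < q) {J₀ X Y A : ℝ} {M : ℕ} (h1 : J₀ < 1)
    (hX : IsInt (X - J₀)) (hY : IsInt (Y - J₀)) (hA : IsInt (A - J₀)) (hXY : IsNat (X + Y))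
    (hM : A - J₀ < M) :
    ∑ i ∈ range M, q ^ (-((J₀ + i) * (J₀ + i + 1))) * qNum q (2 * (J₀ + i) + 1) *
      (qFact q (J₀ + i + X) * qFact q (J₀ + i + Y) * (qFact q (J₀ + i - X))⁻¹ *
        (qFact q (J₀ + i - Y))⁻¹ * (qFact q (A - (J₀ + i)))⁻¹ * (qFact q (A + (J₀ + i) + 1))⁻¹) =
    q ^ (-(A * (X + Y + 1) - X * Y)) * (qFact q (X + Y) * (qFact q (A - X))⁻¹ *
      (qFact q (A - Y))⁻¹) := by
  rcases le_total Y X with h | h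
  · exact sum_spin_of_le hq h1 hX hY hA hXY hM h
  · rw [add_comm] at hXY
    have := sum_spin_of_le hq h1 hY hX hA hXY hM h
    rw [add_comm Y X, mul_comm Y X] at this
    rw [mul_right_comm (qFact q (X + Y)), ← this]
    exact sum_congr rfl fun i _ => by ring

/-! ### Saalschütz sums in factorial form. -/

/-- The balanced sum with all parameters integral. -/
theorem sum_saalschutz_sub (hq : 0 < q) {A B C : ℝ} (hA : IsNat A) (hB : IsNat B)
    (hC : IsInt C) (hAC : IsNat (A + C)) (hBC : IsNat (B + C)) (hABC : IsNat (A + B + C)) (n : ℕ) :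
    ∑ k ∈ range (n + 1), qFact q (A + B + C + n - k) * (qFact q (A - k))⁻¹ * (qFact q (B - k))⁻¹ *
      (qFact q (C + k))⁻¹ * (qFact q k)⁻¹ * (qFact q ((n : ℝ) - k))⁻¹ =
    qFact q (A + B + C) * qFact q (A + C + n) * qFact q (B + C + n) * (qFact q A)⁻¹ *
      (qFact q B)⁻¹ * (qFact q n)⁻¹ * (qFact q (A + C))⁻¹ * (qFact q (B + C))⁻¹ *
      (qFact q (C + n))⁻¹ := by
  -- If C + n is negative, each C + k with k ≤ n is negative too, and both sides are 0.
  rcases (hC.add (isNat_natCast n).isInt).neg_or_isNat with h | h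
  · rw [qFact_inv_of_neg q h, mul_zero]
    refine sum_eq_zero fun k hk => ?_
    have : (k : ℝ) ≤ n := by exact_mod_cast Nat.lt_succ_iff.1 (mem_range.1 hk)
    rw [qFact_inv_of_neg q (show C + (k : ℝ) < 0 by linarith)]; simp only [mul_zero, zero_mul]
  · have h1 := sum_eq_qHyp (s₀ := 1) (σ := 0) hq (qFact_sub_upper hq hA n) (qFact_sub_upper hq hB n)
      (qFact_add_lower hq h) (qFact_sub_lower q (V := A + B + C + n) (n := n) (by simpa using hABC))
      (by norm_num) (by ring)
    rw [qHyp_saalschutz hq _ _ _ _ _ (by ring), add_sub_cancel_right] at h1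
    have e1 := qFact_add_natCast q hAC n
    have e2 := qFact_add_natCast q hBC n
    rw [show C + 1 - -A = A + C + 1 by ring, show C + 1 - -B = B + C + 1 by ring] at h1
    calc _ = _ := sum_congr rfl fun k _ => by
            rw [one_pow, one_mul, mul_zero, Real.rpow_zero, mul_one]; ring
      _ = _ := h1
      _ = _ := by
        have n1 := qFact_ne_zero hq hAC
        have n2 := qFact_ne_zero hq hBC
        rw [e1, e2]
        have := neg_one_pow_mul_self n
        generalize (qFact q n)⁻¹ = u
        generalize (qFact q A)⁻¹ = v
        generalize (qFact q B)⁻¹ = w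
        generalize (qFact q (C + n))⁻¹ = w'
        field_simp
        linear_combination (qFact q (A + B + C) * qPoch q (A + C + 1) n * qPoch q (B + C + 1) n
          * u * v * w * w') * this

/-- The hypothesis `h` is the balancing condition, by which no power of q appears. C - V - 1 may be
negative; then both sides vanish. -/
theorem sum_saalschutz_alt (hq : 0 < q) {V S B C : ℝ} {n : ℕ} (hV : IsNat V) (hB : IsNat B)
    (hS : IsNat (S - n)) (hC : IsNat (C + n)) (hCB : IsNat (C + B)) (hCV : IsNat (C - V + n - 1))
    (h : V + S + 1 = n + B + C) :
    ∑ i ∈ range (n + 1), (-1) ^ i * (qFact q (V + i) * qFact q (S - i) * (qFact q i)⁻¹ *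
      (qFact q ((n : ℝ) - i))⁻¹ * (qFact q (B - i))⁻¹ * (qFact q (C + i))⁻¹) =
    qFact q V * qFact q (S - n) * (qFact q n)⁻¹ * (qFact q B)⁻¹ * (qFact q (C + n))⁻¹ *
      (qFact q (C + B + n) * (qFact q (C + B))⁻¹) *
      (qFact q (C - V + n - 1) * (qFact q (C - V - 1))⁻¹) := by
  have h1 := sum_eq_qHyp (s₀ := -1) (σ := 0) hq (qFact_add_upper q hV n) (qFact_sub_upper hq hB n)
      (qFact_add_lower hq hC) (qFact_sub_lower q hS) (by norm_num) (by linarith)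
  rw [qHyp_saalschutz hq _ _ _ _ _ (by linarith)] at h1
  have e1 := qFact_add_natCast q hCB n
  -- The case x = 0 evaluates (C - V)_n as a quotient of factorials even when C - V - 1 is negative.
  have e2 := qFact_add_lower hq (C := C - V - 1) (n := n)
    (by rwa [show C - V - 1 + n = C - V + n - 1 by ring]) 0 (Nat.zero_le n)
  rw [show C + 1 - -B = C + B + 1 by ring, show C + 1 - (V + 1) = C - V by ring] at h1
  calc _ = _ := sum_congr rfl fun k _ => by
          rw [mul_zero, Real.rpow_zero, mul_one]; ring
    _ = _ := h1
    _ = _ := by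
      have n1 := qFact_ne_zero hq hCB
      have n2 := qFact_ne_zero hq hCV
      rw [Nat.cast_zero, add_zero, add_zero, Nat.sub_zero, sub_add_cancel, pow_zero, mul_one,
        show C - V - 1 + (n : ℝ) = C - V + n - 1 by ring] at e2
      rw [e1, e2]
      have := neg_one_pow_mul_self n
      generalize (qFact q n)⁻¹ = u
      generalize (qFact q B)⁻¹ = v
      generalize (qFact q (C + n))⁻¹ = w
      field_simp
      linear_combination (qFact q V * v * w * qFact q (S - ↑n) * u * qPoch q (C - V) n *
        qPoch q (C + B + 1) n) * this

/-! ### Racah's form of the 6j sum. -/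

theorem sum_range_eq_of_vanish {f : ℕ → ℝ} {x : ℝ} {M N : ℕ} (h : ∀ i : ℕ, x < i → f i = 0)
    (hM : x < M) (hN : x < N) : ∑ i ∈ range M, f i = ∑ i ∈ range N, f i := by
  rcases le_total M N with hMN | hMN
  · exact (sum_range_eq_of_zero hMN fun i hi => h i (hM.trans_le (by exact_mod_cast hi))).symm
  · exact sum_range_eq_of_zero hMN fun i hi => h i (hN.trans_le (by exact_mod_cast hi))

/-- Racah's single sum for the 6j coefficient, without the triangle coefficients. -/
def racah (q T₁ T₂ T₃ T₄ Q₁ Q₂ Q₃ : ℝ) : ℝ :=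
  ∑' t : ℕ, (-1) ^ t * (qFact q (t + 1) * (qFact q (t - T₁))⁻¹ * (qFact q (t - T₂))⁻¹ *
    (qFact q (t - T₃))⁻¹ * (qFact q (t - T₄))⁻¹ * (qFact q (Q₁ - t))⁻¹ * (qFact q (Q₂ - t))⁻¹ *
    (qFact q (Q₃ - t))⁻¹)

theorem racah_eq_sum (q T₁ T₂ T₃ T₄ : ℝ) {Q₁ : ℝ} (Q₂ Q₃ : ℝ) {M : ℕ} (hM : Q₁ < M) :
    racah q T₁ T₂ T₃ T₄ Q₁ Q₂ Q₃ = ∑ t ∈ range M,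
      (-1) ^ t * (qFact q (t + 1) * (qFact q (t - T₁))⁻¹ * (qFact q (t - T₂))⁻¹ *
      (qFact q (t - T₃))⁻¹ * (qFact q (t - T₄))⁻¹ * (qFact q (Q₁ - t))⁻¹ * (qFact q (Q₂ - t))⁻¹ *
      (qFact q (Q₃ - t))⁻¹) := by
  refine tsum_eq_sum fun t ht => ?_
  have : (M : ℝ) ≤ t := by simpa using ht
  rw [qFact_inv_of_neg q (show Q₁ - t < 0 by linarith)]
  simp only [mul_zero, zero_mul]

/-- No t satisfies both T₂ ≤ t and t ≤ Q₂. In this way Racah's sum detects triangle conditions that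
are invisible in the defining sum. -/
theorem racah_eq_zero (q T₁ : ℝ) {T₂ : ℝ} (T₃ T₄ Q₁ : ℝ) {Q₂ : ℝ} (Q₃ : ℝ) (h : Q₂ < T₂) :
    racah q T₁ T₂ T₃ T₄ Q₁ Q₂ Q₃ = 0 := by
  rw [racah, ← tsum_zero (α := ℝ) (β := ℕ)]
  congr 1
  funext t
  rcases lt_or_ge (t : ℝ) T₂ with h' | h'
  · rw [qFact_inv_of_neg q (show t - T₂ < 0 by linarith)]; simp only [mul_zero, zero_mul]
  · rw [qFact_inv_of_neg q (show Q₂ - t < 0 by linarith)]; simp only [mul_zero, zero_mul]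

/-- The defining sum of the 6j coefficient in Racah's form. -/
theorem sixJ_sum_eq_racah (hq : 0 < q) {a b e d c f : ℝ} {M N : ℕ}
    (h1 : IsNat (c + d - e)) (h2 : IsNat (a + b - e)) (h3 : IsNat (c + f - a))
    (h4 : IsNat (b + f - d)) (h5 : IsNat (d + e - c)) (h6 : IsNat (a + e - b))
    (h7 : IsInt (a + c - f)) (h8 : IsInt (b + d - f)) (h9 : IsNat (a + c + f))
    (h10 : IsNat (b + d + f)) (hN : a + b + c + d = N) (hM : a + c - f < M) :
    ∑ z ∈ range M, (-1) ^ z * (qFact q (c + f - a + z) * qFact q (b + f - d + z) *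
      qFact q (a + d + e - f - z) * (qFact q z)⁻¹ * (qFact q (a + c - f - z))⁻¹ *
      (qFact q (b + d - f - z))⁻¹ * (qFact q (e + f - a - d + z))⁻¹ * (qFact q (2 * f + z + 1))⁻¹) =
    (-1) ^ N * (qFact q (c + d - e) * qFact q (a + b - e) * qFact q (c + f - a) *
      qFact q (b + f - d) * qFact q (d + e - c) * qFact q (a + e - b) *
      (qFact q (a + c + f + 1))⁻¹ * (qFact q (b + d + f + 1))⁻¹) *
      racah q (a + b + e) (d + c + e) (a + c + f) (d + b + f) (a + b + c + d) (a + d + e + f)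
        (b + c + e + f) := by
  have hC : IsInt (e + f - a - d) := by
    have := h3.isInt.sub h1.isInt
    rwa [show c + f - a - (c + d - e) = e + f - a - d by ring] at this
  have hV : IsNat (b + c + f - e) := by
    refine IsInt.isNat ?_ ?_
    · have := (hC.add h1.isInt).add h2.isInt
      rwa [show e + f - a - d + (c + d - e) + (a + b - e) = b + c + f - e by ring] at this
    · linarith [h1.nonneg, h2.nonneg, h3.nonneg, h4.nonneg]
  have hVF := qFact_ne_zero hq hV
  -- The z-dependent quotient [c+f-a+z]! [b+f-d+z]! / ([z]! [e+f-a-d+z]!) is expanded by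
  -- `sum_saalschutz_sub` as a sum over k ≤ z.
  have e1 : ∀ z ∈ range M, (-1) ^ z * (qFact q (c + f - a + z) * qFact q (b + f - d + z) *
      qFact q (a + d + e - f - z) * (qFact q z)⁻¹ * (qFact q (a + c - f - z))⁻¹ *
      (qFact q (b + d - f - z))⁻¹ * (qFact q (e + f - a - d + z))⁻¹ * (qFact q (2 * f + z + 1))⁻¹) =
      ∑ k ∈ range (z + 1), (qFact q (c + d - e) * qFact q (a + b - e) * qFact q (c + f - a) *
        qFact q (b + f - d) * (qFact q (b + c + f - e))⁻¹ * (-1) ^ z *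
        (qFact q (a + d + e - f - z) * (qFact q (a + c - f - z))⁻¹ *
      (qFact q (b + d - f - z))⁻¹ * (qFact q (2 * f + z + 1))⁻¹)) *
        (qFact q (b + c + f - e + z - k) * (qFact q (c + d - e - k))⁻¹ *
          (qFact q (a + b - e - k))⁻¹ * (qFact q (e + f - a - d + k))⁻¹ * (qFact q k)⁻¹ *
          (qFact q ((z : ℝ) - k))⁻¹) := by
    intro z _
    have h := sum_saalschutz_sub hq h1 h2 hC
      (by rwa [show c + d - e + (e + f - a - d) = c + f - a by ring])
      (by rwa [show a + b - e + (e + f - a - d) = b + f - d by ring])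
      (by rwa [show c + d - e + (a + b - e) + (e + f - a - d) = b + c + f - e by ring]) z
    rw [show c + d - e + (e + f - a - d) = c + f - a by ring,
      show a + b - e + (e + f - a - d) = b + f - d by ring,
      show c + d - e + (a + b - e) + (e + f - a - d) = b + c + f - e by ring] at h
    rw [← mul_sum, h]
    have n1 := mul_inv_cancel₀ (qFact_ne_zero hq h1)
    have n2 := mul_inv_cancel₀ (qFact_ne_zero hq h2)
    have n3 := mul_inv_cancel₀ (qFact_ne_zero hq h3)
    have n4 := mul_inv_cancel₀ (qFact_ne_zero hq h4)
    have n5 := mul_inv_cancel₀ hVF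
    generalize (-1 : ℝ) ^ z = s
    rw [show ∀ x₁ x₂ x₃ x₄ x₅ y₁ y₂ y₃ y₄ y₅ u₁ u₂ u₃ u₄ u₅ u₆ u₇ u₈ : ℝ,
      x₁ * x₂ * x₃ * x₄ * y₅ * s * (u₁ * u₂ * u₃ * u₄) *
        (x₅ * u₅ * u₆ * y₁ * y₂ * u₇ * y₃ * y₄ * u₈) =
      (x₁ * y₁) * (x₂ * y₂) * (x₃ * y₃) * (x₄ * y₄) * (x₅ * y₅) * (s * (u₁ * u₂ * u₃ * u₄) *
        (u₅ * u₆ * u₇ * u₈)) by intros; ring, n1, n2, n3, n4, n5]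
    ring
  rw [sum_congr rfl e1, sum_range_triangle]
  -- After the exchange of summations the sum over i = z - k is balanced, and `sum_saalschutz_alt`
  -- evaluates it; the sum over k that survives is Racah's.
  have e2 : ∀ k ∈ range M, ∑ i ∈ range (M - k), (qFact q (c + d - e) * qFact q (a + b - e) *
        qFact q (c + f - a) * qFact q (b + f - d) * (qFact q (b + c + f - e))⁻¹ * (-1) ^ (k + i) *
        (qFact q (a + d + e - f - (k + i : ℕ)) * (qFact q (a + c - f - (k + i : ℕ)))⁻¹ *
      (qFact q (b + d - f - (k + i : ℕ)))⁻¹ * (qFact q (2 * f + (k + i : ℕ) + 1))⁻¹)) *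
        (qFact q (b + c + f - e + (k + i : ℕ) - k) * (qFact q (c + d - e - k))⁻¹ *
          (qFact q (a + b - e - k))⁻¹ * (qFact q (e + f - a - d + k))⁻¹ * (qFact q k)⁻¹ *
          (qFact q (((k + i : ℕ) : ℝ) - k))⁻¹) =
      qFact q (c + d - e) * qFact q (a + b - e) * qFact q (c + f - a) *
      qFact q (b + f - d) * qFact q (d + e - c) * qFact q (a + e - b) *
      (qFact q (a + c + f + 1))⁻¹ * (qFact q (b + d + f + 1))⁻¹ * ((-1) ^ k *
        ((qFact q k)⁻¹ * (qFact q (c + d - e - k))⁻¹ * (qFact q (a + b - e - k))⁻¹ *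
          (qFact q (e + f - a - d + k))⁻¹ * (qFact q (a + c - f - k))⁻¹ *
          (qFact q (b + d - f - k))⁻¹ * qFact q (a + b + c + d - k + 1) *
          (qFact q (e + f - b - c + k))⁻¹)) := by
    intro k hk
    have e3 : ∑ i ∈ range (M - k), (-1) ^ i * (qFact q (b + c + f - e + i) *
        qFact q (a + d + e - f - k - i) * (qFact q i)⁻¹ * (qFact q (a + c - f - k - i))⁻¹ *
        (qFact q (b + d - f - k - i))⁻¹ * (qFact q (2 * f + k + 1 + i))⁻¹) =
        qFact q (b + c + f - e) * qFact q (d + e - c) * (qFact q (a + c - f - k))⁻¹ *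
          (qFact q (b + d - f - k))⁻¹ * (qFact q (a + c + f + 1))⁻¹ *
          (qFact q (a + b + c + d - k + 1) * (qFact q (b + d + f + 1))⁻¹) *
          (qFact q (a + e - b) * (qFact q (e + f - b - c + k))⁻¹) := by
      rcases (h7.sub (isNat_natCast k).isInt).neg_or_isNat with h | ⟨n, hn⟩
      · rw [qFact_inv_of_neg q h]; simp only [mul_zero, zero_mul]
        refine sum_eq_zero fun i _ => ?_
        have : (0 : ℝ) ≤ i := by positivity
        rw [qFact_inv_of_neg q (show a + c - f - k - i < 0 by linarith)]
        simp only [mul_zero, zero_mul]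
      rcases (h8.sub (isNat_natCast k).isInt).neg_or_isNat with h | h
      · rw [qFact_inv_of_neg q h]; simp only [mul_zero, zero_mul]
        refine sum_eq_zero fun i _ => ?_
        have : (0 : ℝ) ≤ i := by positivity
        rw [qFact_inv_of_neg q (show b + d - f - k - i < 0 by linarith)]
        simp only [mul_zero, zero_mul]
      have hkM := mem_range.1 hk
      rw [sum_range_eq_of_vanish (x := a + c - f - k) (N := n + 1)]
      · have h11 := isNat_natCast 1
        push_cast at h11
        have := sum_saalschutz_alt hq (S := a + d + e - f - k) (C := 2 * f + k + 1) (n := n) hV h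
          (by rwa [← hn, show a + d + e - f - k - (a + c - f - k) = d + e - c by ring])
          (by rw [← hn, show 2 * f + k + 1 + (a + c - f - k) = a + c + f + 1 by ring]; exact h9.add h11)
          (by rw [show 2 * f + k + 1 + (b + d - f - k) = b + d + f + 1 by ring]; exact h10.add h11)
          (by rwa [← hn, show 2 * f + k + 1 - (b + c + f - e) + (a + c - f - k) - 1 = a + e - b by ring])
          (by rw [← hn]; ring)
        rw [← hn, show a + d + e - f - k - (a + c - f - k) = d + e - c by ring,
          show 2 * f + k + 1 + (a + c - f - k) = a + c + f + 1 by ring,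
          show 2 * f + k + 1 + (b + d - f - k) = b + d + f + 1 by ring,
          show 2 * f + k + 1 - (b + c + f - e) + (a + c - f - k) - 1 = a + e - b by ring,
          show b + d + f + 1 + (a + c - f - k) = a + b + c + d - k + 1 by ring,
          show 2 * f + k + 1 - (b + c + f - e) - 1 = e + f - b - c + k by ring] at this
        exact this
      · intro i hi
        rw [qFact_inv_of_neg q (show a + c - f - k - i < 0 by linarith)]
        simp only [mul_zero, zero_mul]
      · rw [Nat.cast_sub hkM.le]; linarith
      · push_cast; linarith
    have n5 := mul_inv_cancel₀ hVF
    generalize hR : qFact q (c + d - e) * qFact q (a + b - e) * qFact q (c + f - a) *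
      qFact q (b + f - d) = R
    generalize hW : (qFact q k)⁻¹ * (qFact q (c + d - e - k))⁻¹ * (qFact q (a + b - e - k))⁻¹ *
          (qFact q (e + f - a - d + k))⁻¹ = W
    calc _ = (R * (qFact q (b + c + f - e))⁻¹ * (-1) ^ k * W) * ∑ i ∈ range (M - k), (-1) ^ i * (qFact q (b + c + f - e + i) *
        qFact q (a + d + e - f - k - i) * (qFact q i)⁻¹ * (qFact q (a + c - f - k - i))⁻¹ *
        (qFact q (b + d - f - k - i))⁻¹ * (qFact q (2 * f + k + 1 + i))⁻¹) := by
          rw [mul_sum]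
          refine sum_congr rfl fun i _ => ?_
          push_cast
          rw [add_sub_cancel_left, ← hW, pow_add, ← sub_sub, ← sub_sub, ← sub_sub,
            show 2 * f + ((k : ℝ) + i) + 1 = 2 * f + k + 1 + i by ring,
            show b + c + f - e + ((k : ℝ) + i) - k = b + c + f - e + i by ring]
          ring
      _ = _ := by
          rw [e3]
          generalize (qFact q (b + c + f - e))⁻¹ = w at *
          generalize qFact q (b + c + f - e) = w' at *
          linear_combination (R * (-1) ^ k * W * (qFact q (d + e - c) * (qFact q (a + c - f - k))⁻¹ *
          (qFact q (b + d - f - k))⁻¹ * (qFact q (a + c + f + 1))⁻¹ *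
          (qFact q (a + b + c + d - k + 1) * (qFact q (b + d + f + 1))⁻¹) *
          (qFact q (a + e - b) * (qFact q (e + f - b - c + k))⁻¹))) * n5
  rw [sum_congr rfl e2, ← mul_sum, mul_comm ((-1 : ℝ) ^ N), mul_assoc _ ((-1 : ℝ) ^ N)]
  congr 1
  have hN1 : a + c - f < (N + 1 : ℕ) := by push_cast; linarith [h10.nonneg]
  -- Racah's index is t = N - k, where N = a + b + c + d.
  rw [sum_range_eq_of_vanish (x := a + c - f) _ hM hN1, racah_eq_sum (M := N + 1),
    ← sum_range_reflect, mul_sum]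
  · refine sum_congr rfl fun t ht => ?_
    have ht := Nat.lt_succ_iff.1 (mem_range.1 ht)
    rw [Nat.add_sub_cancel, Nat.cast_sub ht, ← hN, neg_one_pow_sub ht, sub_sub_cancel,
      show c + d - e - (a + b + c + d - t) = t - (a + b + e) by ring,
      show a + b - e - (a + b + c + d - t) = t - (d + c + e) by ring,
      show e + f - a - d + (a + b + c + d - t) = b + c + e + f - t by ring,
      show a + c - f - (a + b + c + d - t) = t - (d + b + f) by ring,
      show b + d - f - (a + b + c + d - t) = t - (a + c + f) by ring,
      show e + f - b - c + (a + b + c + d - t) = a + d + e + f - t by ring]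
    ring
  · push_cast; linarith
  · intro i hi
    rw [qFact_inv_of_neg q (show a + c - f - i < 0 by linarith)]
    simp only [mul_zero, zero_mul]

/-! ### Spins through their doubles; signs. -/

/-- Spins are represented by the integers 2x, so that triangle conditions become parities and linear
inequalities between integers. This is the bridge back to real arguments. -/
theorem isInt_of_half {x : ℝ} {m : ℤ} (h : 2 * x = m) (h2 : m % 2 = 0) : IsInt x := by
  refine ⟨m / 2, ?_⟩
  have : (m : ℝ) = 2 * ((m / 2 : ℤ) : ℝ) := by exact_mod_cast (by omega : m = 2 * (m / 2))
  linarith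

theorem isNat_of_half {x : ℝ} {m : ℤ} (h : 2 * x = m) (h2 : m % 2 = 0) (h0 : 0 ≤ m) : IsNat x := by
  refine (isInt_of_half h h2).isNat ?_
  have : (0 : ℝ) ≤ m := by exact_mod_cast h0
  linarith

theorem IsTriad.ints {a b c : ℝ} {A B C : ℤ} (h : IsTriad a b c) (hA : 2 * a = A) (hB : 2 * b = B)
    (hC : 2 * c = C) : (A + B + C) % 2 = 0 ∧ 0 ≤ B + C - A ∧ 0 ≤ A + C - B ∧ 0 ≤ A + B - C := by
  obtain ⟨⟨l, hl⟩, ⟨m, hm⟩, ⟨n, hn⟩⟩ := h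
  have h1 : B + C - A = 2 * l := by
    have : ((B + C - A : ℤ) : ℝ) = ((2 * l : ℤ) : ℝ) := by push_cast; linarith
    exact_mod_cast this
  have h2 : A + C - B = 2 * m := by
    have : ((A + C - B : ℤ) : ℝ) = ((2 * m : ℤ) : ℝ) := by push_cast; linarith
    exact_mod_cast this
  have h3 : A + B - C = 2 * n := by
    have : ((A + B - C : ℤ) : ℝ) = ((2 * n : ℤ) : ℝ) := by push_cast; linarith
    exact_mod_cast this
  omega

theorem IsTriad.two_mul_left {a b c : ℝ} (h : IsTriad a b c) : ∃ A : ℤ, 2 * a = A := by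
  obtain ⟨_, ⟨m, hm⟩, ⟨n, hn⟩⟩ := h
  exact ⟨m + n, by push_cast; linarith⟩

theorem IsTriad.perm₁₂ {a b c : ℝ} (h : IsTriad a b c) : IsTriad b a c := by
  obtain ⟨h1, h2, h3⟩ := h
  exact ⟨h2, h1, by rwa [add_comm b a]⟩

theorem IsTriad.perm₂₃ {a b c : ℝ} (h : IsTriad a b c) : IsTriad a c b := by
  obtain ⟨h1, h2, h3⟩ := h
  exact ⟨by rwa [add_comm c b], h3, h2⟩

/-- The spins of a stretched coefficient as halves of integers. -/
structure Spins (a b e c d f h k g : ℝ) (A B E C D F H K : ℤ) : Prop where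
  a2 : 2 * a = A
  b2 : 2 * b = B
  e2 : 2 * e = E
  c2 : 2 * c = C
  d2 : 2 * d = D
  f2 : 2 * f = F
  h2 : 2 * h = H
  k2 : 2 * k = K
  g_eq : g = e + f
  abe : (A + B + E) % 2 = 0 ∧ 0 ≤ B + E - A ∧ 0 ≤ A + E - B ∧ 0 ≤ A + B - E
  cdf : (C + D + F) % 2 = 0 ∧ 0 ≤ D + F - C ∧ 0 ≤ C + F - D ∧ 0 ≤ C + D - F
  ach : (A + C + H) % 2 = 0 ∧ 0 ≤ C + H - A ∧ 0 ≤ A + H - C ∧ 0 ≤ A + C - H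
  bdk : (B + D + K) % 2 = 0 ∧ 0 ≤ D + K - B ∧ 0 ≤ B + K - D ∧ 0 ≤ B + D - K
  hkg : 0 ≤ K + (E + F) - H ∧ 0 ≤ H + (E + F) - K ∧ 0 ≤ H + K - (E + F)

theorem exists_spins {a b e c d f h k g : ℝ} (hg : g = e + f)
    (habe : IsTriad a b e) (hcdf : IsTriad c d f) (hhkg : IsTriad h k g)
    (hach : IsTriad a c h) (hbdk : IsTriad b d k) :
    ∃ A B E C D F H K : ℤ, Spins a b e c d f h k g A B E C D F H K := by
  obtain ⟨A, hA⟩ := habe.two_mul_left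
  obtain ⟨B, hB⟩ := habe.perm₁₂.two_mul_left
  obtain ⟨E, hE⟩ := habe.perm₂₃.perm₁₂.two_mul_left
  obtain ⟨C, hC⟩ := hcdf.two_mul_left
  obtain ⟨D, hD⟩ := hcdf.perm₁₂.two_mul_left
  obtain ⟨F, hF⟩ := hcdf.perm₂₃.perm₁₂.two_mul_left
  obtain ⟨H, hH⟩ := hhkg.two_mul_left
  obtain ⟨K, hK⟩ := hhkg.perm₁₂.two_mul_left
  have hG : 2 * g = ((E + F : ℤ) : ℝ) := by push_cast; linarith
  exact ⟨A, B, E, C, D, F, H, K, hA, hB, hE, hC, hD, hF, hH, hK, hg, habe.ints hA hB hE,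
    hcdf.ints hC hD hF, hach.ints hA hC hH, hbdk.ints hB hD hK, (hhkg.ints hH hK hG).2⟩

theorem sgn_natCast (n : ℕ) : sgn n = (-1) ^ n := by simp [sgn]

theorem sgn_add {x y : ℝ} (hx : IsInt x) (hy : IsInt y) : sgn (x + y) = sgn x * sgn y := by
  obtain ⟨m, rfl⟩ := hx
  obtain ⟨n, rfl⟩ := hy
  rw [sgn, sgn, sgn, ← Int.cast_add, Int.floor_intCast, Int.floor_intCast, Int.floor_intCast,
    zpow_add₀ (by norm_num)]

theorem sgn_mul_self (x : ℝ) : sgn x * sgn x = 1 := by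
  rw [sgn, ← mul_zpow]; simp

/-- Integers of equal parity have equal signs. -/
theorem sgn_eq_of_half {x y : ℝ} {n : ℤ} (hx : IsInt x) (h : x - y = 2 * n) : sgn x = sgn y := by
  obtain ⟨m, rfl⟩ := hx
  have : y = ((m - 2 * n : ℤ) : ℝ) := by push_cast; linarith
  rw [this, sgn, sgn, Int.floor_intCast, Int.floor_intCast, zpow_sub₀ (by norm_num), zpow_mul]
  norm_num

/-! ### Triangle coefficients and the 6j coefficient in Racah's form. -/

/-- The square of `Δ[abc]`. -/
def triSq (q a b c : ℝ) : ℝ :=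
  qFact q (a + b - c) * qFact q (a - b + c) * qFact q (b + c - a) * (qFact q (a + b + c + 1))⁻¹

theorem triDelta_mul_self (hq : 0 < q) (a b c : ℝ) :
    triDelta q a b c * triDelta q a b c = triSq q a b c := by
  have := qFact_nonneg hq
  rw [triDelta, Real.mul_self_sqrt, triSq, div_eq_mul_inv]
  exact div_nonneg (mul_nonneg (mul_nonneg (this _) (this _)) (this _)) (this _)

theorem triDelta_perm₁₂ (q a b c : ℝ) : triDelta q b a c = triDelta q a b c := by
  rw [triDelta, triDelta]; congr 1
  rw [show b + a - c = a + b - c by ring, show b - a + c = b + c - a by ring,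
    show a + c - b = a - b + c by ring, show b + a + c + 1 = a + b + c + 1 by ring]
  ring

theorem triDelta_perm₂₃ (q a b c : ℝ) : triDelta q a c b = triDelta q a b c := by
  rw [triDelta, triDelta]; congr 1
  rw [show a + c - b = a - b + c by ring, show a - c + b = a + b - c by ring,
    show c + b - a = b + c - a by ring, show a + c + b + 1 = a + b + c + 1 by ring]
  ring

theorem IsTriad.isNat {a b c : ℝ} (h : IsTriad a b c) :
    IsNat (a + b - c) ∧ IsNat (a - b + c) ∧ IsNat (b + c - a) ∧ IsNat (a + b + c) ∧
      IsNat (a + b + c + 1) := by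
  obtain ⟨⟨l, hl⟩, ⟨m, hm⟩, ⟨n, hn⟩⟩ := h
  exact ⟨⟨n, hn⟩, ⟨m, by linarith⟩, ⟨l, hl⟩, ⟨l + m + n, by push_cast; linarith⟩,
    ⟨l + m + n + 1, by push_cast; linarith⟩⟩

theorem triDelta_pos (hq : 0 < q) {a b c : ℝ} (h : IsTriad a b c) : 0 < triDelta q a b c := by
  obtain ⟨h1, h2, h3, -, h4⟩ := h.isNat
  exact Real.sqrt_pos.2 (div_pos (mul_pos (mul_pos (qFact_pos hq h1.nonneg) (qFact_pos hq h2.nonneg))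
    (qFact_pos hq h3.nonneg)) (qFact_pos hq h4.nonneg))

/-- Separates ∇ into the fully symmetric irrational Δ and a rational factor. -/
theorem nabla_eq (hq : 0 < q) {a b c : ℝ} (h : IsTriad a b c) : nabla q a b c =
    triDelta q a b c * (qFact q (a + b + c + 1) * (qFact q (b + c - a))⁻¹) := by
  obtain ⟨h1, h2, h3, -, h4⟩ := h.isNat
  have p3 := qFact_pos hq h3.nonneg
  have p4 := qFact_pos hq h4.nonneg
  rw [nabla, triDelta, Real.sqrt_eq_iff_mul_self_eq, mul_mul_mul_comm, Real.mul_self_sqrt]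
  · field_simp
  · have := qFact_nonneg hq; exact div_nonneg (mul_nonneg (mul_nonneg (this _) (this _)) (this _)) (this _)
  · have := qFact_nonneg hq; exact div_nonneg (mul_nonneg (mul_nonneg (this _) (this _)) (this _)) (this _)
  · positivity

theorem racah_swap (q T₁ T₂ T₃ T₄ Q₁ Q₂ Q₃ : ℝ) :
    racah q T₁ T₂ T₃ T₄ Q₁ Q₂ Q₃ = racah q T₂ T₁ T₃ T₄ Q₁ Q₂ Q₃ :=
  tsum_congr fun t => by ring

/-- The definition distinguishes the spin f. Here the symmetries become permutations of the
arguments of `racah`; reading `sixJ_sum_eq_racah` backwards after such a permutation puts another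
spin in the distinguished place. -/
theorem sixJ_eq_racah (hq : 0 < q) {a b e d c f : ℝ} (h1 : IsTriad a b e) (h2 : IsTriad d c e)
    (h3 : IsTriad a c f) (h4 : IsTriad d b f) :
    sixJ q a b e d c f = triDelta q a b e * triDelta q d c e * triDelta q a c f * triDelta q d b f *
      racah q (a + b + e) (d + c + e) (a + c + f) (d + b + f) (a + b + c + d) (a + d + e + f)
        (b + c + e + f) := by
  rw [sixJ, if_pos ⟨h1, h2, h3, h4⟩]
  obtain ⟨u1, u2, u3, u4, u5⟩ := h1.isNat
  obtain ⟨v1, v2, v3, v4, v5⟩ := h2.isNat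
  obtain ⟨w1, w2, w3, w4, w5⟩ := h3.isNat
  obtain ⟨x1, x2, x3, x4, x5⟩ := h4.isNat
  have hN : IsNat (a + b + c + d) := by
    refine IsInt.isNat ?_ (by linarith [u1.nonneg, v2.nonneg, v1.nonneg, u2.nonneg, v3.nonneg, u3.nonneg])
    have := w1.isInt.add x4.isInt
    rwa [show a + c - f + (d + b + f) = a + b + c + d by ring] at this
  obtain ⟨N, hN⟩ := hN
  have hR := sixJ_sum_eq_racah hq (M := ⌊a + c - f⌋₊ + 1)
    (by rwa [add_comm c d]) u1 w3 x3 (by rwa [show d + e - c = d - c + e by ring])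
    (by rwa [show a + e - b = a - b + e by ring]) w1.isInt (by rw [add_comm b d]; exact x1.isInt) w4
    (by rwa [add_comm b d]) hN (by push_cast; exact Nat.lt_floor_add_one _)
  have hs : ∑ z ∈ range (⌊a + c - f⌋₊ + 1), sgn (a + b + c + d + z) *
          (qFact q (c + f - a + z) * qFact q (b + f - d + z) * qFact q (a + d + e - f - z)) /
          (qFact q z * qFact q (a + c - f - z) * qFact q (b + d - f - z) *
            qFact q (e + f - a - d + z) * qFact q (2 * f + z + 1)) = (-1) ^ N *
      ∑ z ∈ range (⌊a + c - f⌋₊ + 1), (-1) ^ z * (qFact q (c + f - a + z) * qFact q (b + f - d + z) *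
      qFact q (a + d + e - f - z) * (qFact q z)⁻¹ * (qFact q (a + c - f - z))⁻¹ *
      (qFact q (b + d - f - z))⁻¹ * (qFact q (e + f - a - d + z))⁻¹ * (qFact q (2 * f + z + 1))⁻¹) := by
    rw [mul_sum]
    refine sum_congr rfl fun z _ => ?_
    rw [hN, ← Nat.cast_add, sgn_natCast, pow_add, div_eq_mul_inv]
    simp only [mul_inv]
    ring
  rw [hs, hR, nabla_eq hq h1, nabla_eq hq h2, nabla_eq hq h3, nabla_eq hq h4]
  have t1 := triDelta_mul_self hq a b e
  have t2 := triDelta_mul_self hq d c e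
  have p1 := (triDelta_pos hq h1).ne'
  have p2 := (triDelta_pos hq h2).ne'
  rw [triSq] at t1 t2
  have m1 := qFact_ne_zero hq u5
  have m2 := qFact_ne_zero hq v5
  have m3 := qFact_ne_zero hq w5
  have m4 := qFact_ne_zero hq x5
  have m5 := qFact_ne_zero hq u3
  have m6 := qFact_ne_zero hq v3
  have m7 := qFact_ne_zero hq w3
  have m8 := qFact_ne_zero hq x3
  have s := neg_one_pow_mul_self N
  rw [show c + d - e = d + c - e by ring, show d + e - c = d - c + e by ring,
    show a + e - b = a - b + e by ring, show b + d + f + 1 = d + b + f + 1 by ring]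
  generalize racah q (a + b + e) (d + c + e) (a + c + f) (d + b + f) (a + b + c + d) (a + d + e + f)
        (b + c + e + f) = R
  generalize triDelta q a b e = D1 at *
  generalize triDelta q d c e = D2 at *
  generalize triDelta q a c f = D3 at *
  generalize triDelta q d b f = D4 at *
  generalize (-1 : ℝ) ^ N = S at *
  generalize qFact q (a + b + e + 1) = F1 at *
  generalize qFact q (d + c + e + 1) = F2 at *
  generalize qFact q (a + c + f + 1) = F3 at *
  generalize qFact q (d + b + f + 1) = F4 at *
  generalize qFact q (b + e - a) = F5 at *
  generalize qFact q (c + e - d) = F6 at *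
  generalize qFact q (c + f - a) = F7 at *
  generalize qFact q (b + f - d) = F8 at *
  generalize qFact q (a + b - e) = F9 at *
  generalize qFact q (a - b + e) = G1 at *
  generalize qFact q (d + c - e) = G2 at *
  generalize qFact q (d - c + e) = G3 at *
  have e1 : F9 * G1 * F5 = D1 * D1 * F1 := by rw [t1]; field_simp
  have e2 : G2 * G3 * F6 = D2 * D2 * F2 := by rw [t2]; field_simp
  have e3 : F9 * G1 * F5 * (G2 * G3 * F6) * (S * S) = D1 * D1 * F1 * (D2 * D2 * F2) := by
    rw [e1, e2, s, mul_one]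
  field_simp
  linear_combination (D3 * D4 * R) * e3

/-! ### The 9j coefficient as a sum over one class of spins. -/

/-- The rational part of the product of 6j coefficients in the expansion of a 9j coefficient. -/
def nineTerm (q a b e c d f h k g j : ℝ) : ℝ :=
  triSq q a g j * triSq q k c j * triSq q f b j *
    (racah q (a + c + h) (k + g + h) (a + g + j) (k + c + j) (a + c + g + k) (a + k + h + j)
      (c + g + h + j) *
    racah q (k + j + c) (f + d + c) (k + d + b) (f + j + b) (k + j + d + f) (k + f + c + b)
      (j + d + c + b) *
    racah q (a + g + j) (f + b + j) (a + b + e) (f + g + e) (a + g + b + f) (a + f + j + e)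
      (g + b + j + e))

/-- The product of the triangle coefficients that do not involve the summation spin. -/
def triProd (q a b e c d f h k g : ℝ) : ℝ :=
  triDelta q a c h * triDelta q k g h * triDelta q f d c * triDelta q k d b * triDelta q a b e *
    triDelta q f g e

/-- This vanishing takes over the role of the triad conditions, so that the sum over j may run over
a whole class modulo 1. -/
theorem triSq_eq_zero (q : ℝ) {a b c : ℝ} (h : a + b - c < 0 ∨ a - b + c < 0 ∨ b + c - a < 0) :
    triSq q a b c = 0 := by
  unfold triSq
  rcases h with h | h | h
  · rw [qFact_of_neg q h]; simp only [zero_mul]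
  · rw [qFact_of_neg q h]; simp only [mul_zero, zero_mul]
  · rw [qFact_of_neg q h]; simp only [mul_zero, zero_mul]

theorem isTriad_or_triSq_eq_zero (q : ℝ) {a b c : ℝ} {A B C : ℤ} (hA : 2 * a = A) (hB : 2 * b = B)
    (hC : 2 * c = C) (h : (A + B + C) % 2 = 0) : IsTriad a b c ∨ triSq q a b c = 0 := by
  have h1 : IsInt (a + b - c) := isInt_of_half (m := A + B - C) (by push_cast; linarith) (by omega)
  have h2 : IsInt (a - b + c) := isInt_of_half (m := A - B + C) (by push_cast; linarith) (by omega)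
  have h3 : IsInt (b + c - a) := isInt_of_half (m := B + C - A) (by push_cast; linarith) (by omega)
  rcases h1.neg_or_isNat with h1 | h1
  · exact Or.inr (triSq_eq_zero q (Or.inl h1))
  rcases h2.neg_or_isNat with h2 | h2
  · exact Or.inr (triSq_eq_zero q (Or.inr (Or.inl h2)))
  rcases h3.neg_or_isNat with h3 | h3
  · exact Or.inr (triSq_eq_zero q (Or.inr (Or.inr h3)))
  exact Or.inl ⟨h3, by rwa [show a + c - b = a - b + c by ring], h1⟩

theorem sixJ_of_not_isTriad₂ (q : ℝ) {a b e d c f : ℝ} (h : ¬ IsTriad d c e) :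
    sixJ q a b e d c f = 0 := if_neg fun t => h t.2.1

theorem sixJ_of_not_isTriad₃ (q : ℝ) {a b e d c f : ℝ} (h : ¬ IsTriad a c f) :
    sixJ q a b e d c f = 0 := if_neg fun t => h t.2.2.1

theorem sixJ_of_not_isTriad₄ (q : ℝ) {a b e d c f : ℝ} (h : ¬ IsTriad d b f) :
    sixJ q a b e d c f = 0 := if_neg fun t => h t.2.2.2

/-- Each of the triads (a,g,j), (k,c,j), (f,b,j) occurs in two of the three 6j coefficients, so the
triangle coefficients containing j appear squared. The triad (k,c,j) fixes the parity of 2j; for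
that parity only the triangle inequalities can fail, and then both sides are 0. -/
theorem sixJ_mul_eq (hq : 0 < q) {a b e c d f h k g : ℝ} {A B E C D F H K : ℤ}
    (S : Spins a b e c d f h k g A B E C D F H K)
    (habe : IsTriad a b e) (hcdf : IsTriad c d f) (hhkg : IsTriad h k g)
    (hach : IsTriad a c h) (hbdk : IsTriad b d k) (n : ℕ) :
    sixJ q a c h k g (n / 2) * sixJ q k (n / 2) c f d b * sixJ q a g (n / 2) f b e =
      if ((n : ℤ) + C + K) % 2 = 0 then triProd q a b e c d f h k g *
        nineTerm q a b e c d f h k g (n / 2) else 0 := by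
  obtain ⟨a2, b2, e2, c2, d2, f2, h2, k2, g_eq, abe, cdf, ach, bdk, hkg⟩ := S
  have g2 : 2 * g = ((E + F : ℤ) : ℝ) := by push_cast; linarith
  have j2 : 2 * ((n : ℝ) / 2) = ((n : ℤ) : ℝ) := by push_cast; ring
  have hef : IsTriad f g e := by
    refine ⟨isNat_of_half (m := 2 * E) (by push_cast; linarith) (by omega) (by omega),
      isNat_of_half (m := 0) (by push_cast; linarith) (by omega) (by omega),
      isNat_of_half (m := 2 * F) (by push_cast; linarith) (by omega) (by omega)⟩
  split_ifs with hn
  · by_cases h3 : IsTriad a g (n / 2) ∧ IsTriad k c (n / 2) ∧ IsTriad f b (n / 2)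
    · obtain ⟨t1, t2, t3⟩ := h3
      rw [sixJ_eq_racah hq hach hhkg.perm₁₂.perm₂₃ t1 t2,
        sixJ_eq_racah hq t2.perm₂₃ hcdf.perm₂₃.perm₁₂.perm₂₃ hbdk.perm₂₃.perm₁₂.perm₂₃ t3.perm₂₃,
        sixJ_eq_racah hq t1 t3 habe hef, triDelta_perm₂₃ q k c, triDelta_perm₂₃ q f b, nineTerm,
        ← triDelta_mul_self hq, ← triDelta_mul_self hq, ← triDelta_mul_self hq, triProd]
      ring
    · have h0 : triSq q a g (n / 2) * triSq q k c (n / 2) * triSq q f b (n / 2) = 0 := by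
        rcases isTriad_or_triSq_eq_zero q a2 g2 j2 (by omega) with u1 | u1
        · rcases isTriad_or_triSq_eq_zero q k2 c2 j2 (by omega) with u2 | u2
          · rcases isTriad_or_triSq_eq_zero q f2 b2 j2 (by omega) with u3 | u3
            · exact absurd ⟨u1, u2, u3⟩ h3
            · rw [u3, mul_zero]
          · rw [u2, mul_zero, zero_mul]
        · rw [u1, zero_mul, zero_mul]
      rw [nineTerm, h0, zero_mul, mul_zero]
      by_cases t1 : IsTriad a g (n / 2)
      · by_cases t2 : IsTriad k c (n / 2)
        · have t3 : ¬ IsTriad f b (n / 2) := fun t3 => h3 ⟨t1, t2, t3⟩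
          rw [sixJ_of_not_isTriad₂ q t3, mul_zero]
        · rw [sixJ_of_not_isTriad₄ q t2, zero_mul, zero_mul]
      · rw [sixJ_of_not_isTriad₃ q t1, zero_mul, zero_mul]
  · have t2 : ¬ IsTriad k c (n / 2) := fun t => hn (by have := (t.ints k2 c2 j2).1; omega)
    rw [sixJ_of_not_isTriad₄ q t2, zero_mul, zero_mul]

theorem sum_range_two_mul (f : ℕ → ℝ) (M : ℕ) :
    ∑ n ∈ range (2 * M), f n = ∑ i ∈ range M, (f (2 * i) + f (2 * i + 1)) := by
  induction M with
  | zero => simp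
  | succ M ih => rw [mul_add, mul_one, sum_range_succ, sum_range_succ, ih, sum_range_succ, add_assoc]

/-- The defining sum of a 9j coefficient as a sum over one class of spins modulo `1`. -/
theorem nineJ_eq_sum (hq : 0 < q) {a b e c d f h k g : ℝ} {A B E C D F H K : ℤ}
    (S : Spins a b e c d f h k g A B E C D F H K)
    (habe : IsTriad a b e) (hcdf : IsTriad c d f) (hhkg : IsTriad h k g)
    (hach : IsTriad a c h) (hbdk : IsTriad b d k) {p M : ℕ} (hp : p < 2)
    (hpar : ((p : ℤ) + C + K) % 2 = 0) (hM : a + g - p / 2 < M) :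
    nineJ q a b e c d f h k g = triProd q a b e c d f h k g * sgn p * q ^ (zz d + zz e + zz h) *
      ∑ i ∈ range M, q ^ (-(((p : ℝ) / 2 + i) * ((p : ℝ) / 2 + i + 1))) *
        qNum q (2 * ((p : ℝ) / 2 + i) + 1) * nineTerm q a b e c d f h k g ((p : ℝ) / 2 + i) := by
  set T : ℝ → ℝ := fun j => triProd q a b e c d f h k g * sgn p * q ^ (zz d + zz e + zz h) *
    (q ^ (-(j * (j + 1))) * qNum q (2 * j + 1) * nineTerm q a b e c d f h k g j) with hT
  have hT0 : ∀ j : ℝ, a + g < j → T j = 0 := by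
    intro j hj
    simp only [hT]
    rw [nineTerm, triSq_eq_zero q (Or.inl (by linarith))]
    simp only [mul_zero, zero_mul]
  have hn : nineJ q a b e c d f h k g = ∑ n ∈ range (⌊2 * (a + g)⌋₊ + 1),
      if ((n : ℤ) + C + K) % 2 = 0 then T (n / 2) else 0 := by
    refine sum_congr rfl fun n _ => ?_
    have h1 := sixJ_mul_eq hq S habe hcdf hhkg hach hbdk n
    rw [mul_assoc, mul_assoc, ← mul_assoc (sixJ q a c h k g (n / 2)), h1]
    split_ifs with hpn
    · have h2 : sgn (2 * ((n : ℝ) / 2)) = sgn p := by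
        obtain ⟨m, hm⟩ : ∃ m : ℤ, (n : ℤ) - p = 2 * m := ⟨((n : ℤ) - p) / 2, by omega⟩
        refine sgn_eq_of_half (n := m) ⟨n, by push_cast; ring⟩ ?_
        have : (((n : ℤ) - p : ℤ) : ℝ) = ((2 * m : ℤ) : ℝ) := by rw [hm]
        push_cast at this
        linarith
      simp only [hT]
      rw [h2, sub_eq_add_neg, Real.rpow_add hq]
      ring
    · rw [mul_zero]
  have hc : ∀ M : ℕ, ∑ n ∈ range (2 * M), (if ((n : ℤ) + C + K) % 2 = 0 then T (n / 2) else 0) =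
      ∑ i ∈ range M, T ((p : ℝ) / 2 + i) := by
    intro M
    rw [sum_range_two_mul]
    refine sum_congr rfl fun i _ => ?_
    obtain rfl | rfl : p = 0 ∨ p = 1 := by omega
    · rw [if_pos (by push_cast at hpar ⊢; omega), if_neg (by push_cast at hpar ⊢; omega), add_zero]
      congr 1; push_cast; ring
    · rw [if_neg (by push_cast at hpar ⊢; omega), if_pos (by push_cast at hpar ⊢; omega), zero_add]
      congr 1; push_cast; ring
  obtain ⟨M', hM'⟩ := exists_nat_gt (a + g)
  rw [hn, sum_range_eq_of_vanish (x := 2 * (a + g)) (N := 2 * M'), hc,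
    sum_range_eq_of_vanish (x := a + g - p / 2) (N := M), mul_sum]
  · intro i hi
    exact hT0 _ (by linarith)
  · have : (0 : ℝ) ≤ p := by positivity
    linarith
  · exact hM
  · intro i hi
    rw [hT0 _ (by linarith), ite_self]
  · push_cast; exact Nat.lt_floor_add_one _
  · push_cast; linarith

/-! ### The summand over j with re-expanded 6j coefficients. -/

theorem IsNat.add_one {x : ℝ} (h : IsNat x) : IsNat (x + 1) := by
  obtain ⟨n, rfl⟩ := h; exact ⟨n + 1, by push_cast; rfl⟩

/-- The defining sum of the 6j coefficient. -/
def sixSum (q a b e d c f : ℝ) (M : ℕ) : ℝ :=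
  ∑ z ∈ range M, (-1) ^ z * (qFact q (c + f - a + z) * qFact q (b + f - d + z) *
      qFact q (a + d + e - f - z) * (qFact q z)⁻¹ * (qFact q (a + c - f - z))⁻¹ *
      (qFact q (b + d - f - z))⁻¹ * (qFact q (e + f - a - d + z))⁻¹ * (qFact q (2 * f + z + 1))⁻¹)

/-- Of the triangle inequalities, f ≤ a + c, f ≤ b + d, d ≤ c + e and a ≤ b + e are not assumed.
Hence the formula is available before the spin j is known to be admissible. -/
theorem mul_racah_eq_sixSum (hq : 0 < q) {a b e d c f : ℝ} {M : ℕ}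
    (h1 : IsNat (c + d - e)) (h2 : IsNat (a + b - e)) (h3 : IsNat (c + f - a))
    (h4 : IsNat (b + f - d)) (h5 : IsNat (d + e - c)) (h6 : IsNat (a + e - b))
    (h7 : IsInt (a + c - f)) (h8 : IsInt (b + d - f)) (h9 : IsNat (a + c + f))
    (h10 : IsNat (b + d + f)) (h0 : 0 ≤ a + b + c + d) (hM : a + c - f < M) :
    sgn (a + b + c + d) * (qFact q (c + d - e) * qFact q (a + b - e) * qFact q (c + f - a) *
      qFact q (b + f - d) * qFact q (d + e - c) * qFact q (a + e - b) *
      (qFact q (a + c + f + 1))⁻¹ * (qFact q (b + d + f + 1))⁻¹) *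
      racah q (a + b + e) (d + c + e) (a + c + f) (d + b + f) (a + b + c + d) (a + d + e + f)
        (b + c + e + f) = sixSum q a b e d c f M := by
  have hN : IsNat (a + b + c + d) := by
    refine IsInt.isNat ?_ h0
    have := h7.add h10.isInt
    rwa [show a + c - f + (b + d + f) = a + b + c + d by ring] at this
  obtain ⟨N, hN⟩ := hN
  rw [sixSum, sixJ_sum_eq_racah hq h1 h2 h3 h4 h5 h6 h7 h8 h9 h10 hN hM, hN, sgn_natCast]

/-- In the last two cases the bounds on z conflict: z ≥ a + d - e - f is incompatible with z ≤ a + c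
- f, respectively with z ≤ b + d - f. -/
theorem sixSum_eq_zero (q : ℝ) {a b e d c f : ℝ} (M : ℕ)
    (h : a + c - f < 0 ∨ b + d - f < 0 ∨ c + e - d < 0 ∨ b + e - a < 0) :
    sixSum q a b e d c f M = 0 := by
  refine sum_eq_zero fun z _ => ?_
  have hz : (0 : ℝ) ≤ z := by positivity
  rcases h with h | h | h | h
  · rw [qFact_inv_of_neg q (show a + c - f - z < 0 by linarith)]; simp only [mul_zero, zero_mul]
  · rw [qFact_inv_of_neg q (show b + d - f - z < 0 by linarith)]; simp only [mul_zero, zero_mul]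
  · rcases lt_or_ge (a + c - f - z) 0 with h' | h'
    · rw [qFact_inv_of_neg q h']; simp only [mul_zero, zero_mul]
    · rw [qFact_inv_of_neg q (show e + f - a - d + z < 0 by linarith)]; simp only [mul_zero, zero_mul]
  · rcases lt_or_ge (b + d - f - z) 0 with h' | h'
    · rw [qFact_inv_of_neg q h']; simp only [mul_zero, zero_mul]
    · rw [qFact_inv_of_neg q (show e + f - a - d + z < 0 by linarith)]; simp only [mul_zero, zero_mul]

/-- For g = e + f the lower bound a + g + j and the upper bound a + f + j + e of the summation are
equal, so one term survives. -/
theorem racah_stretched (q : ℝ) {a b e f g j : ℝ} (hg : g = e + f) (hN : IsNat (a + g + j)) :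
    racah q (a + g + j) (f + b + j) (a + b + e) (f + g + e) (a + g + b + f) (a + f + j + e)
      (g + b + j + e) = sgn (a + g + j) * (qFact q (a + g + j + 1) * (qFact q (a + e - b))⁻¹ *
        (qFact q (g + j - (b + e)))⁻¹ * (qFact q (a + j - g))⁻¹ * (qFact q (b + f - j))⁻¹ *
        (qFact q (b + e - a))⁻¹) := by
  obtain ⟨N, hN⟩ := hN
  rw [racah, tsum_eq_single N, hN, sgn_natCast, ← hN]
  · subst hg
    rw [sub_self, show a + f + j + e - (a + (e + f) + j) = 0 by ring, qFact_zero,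
      show a + (e + f) + j - (f + b + j) = a + e - b by ring,
      show a + (e + f) + j - (a + b + e) = e + f + j - (b + e) by ring,
      show a + (e + f) + j - (f + (e + f) + e) = a + j - (e + f) by ring,
      show a + (e + f) + b + f - (a + (e + f) + j) = b + f - j by ring,
      show e + f + b + j + e - (a + (e + f) + j) = b + e - a by ring]
    ring
  · intro t ht
    rcases lt_or_gt_of_ne ht with h | h
    · have : (t : ℝ) < N := by exact_mod_cast h
      rw [qFact_inv_of_neg q (show t - (a + g + j) < 0 by linarith)]; simp only [mul_zero, zero_mul]
    · have : (N : ℝ) < t := by exact_mod_cast h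
      rw [qFact_inv_of_neg q (show a + f + j + e - t < 0 by linarith)]; simp only [mul_zero, zero_mul]

theorem racah_perm₁₃ (q T₁ T₂ T₃ T₄ Q₁ Q₂ Q₃ : ℝ) :
    racah q T₁ T₂ T₃ T₄ Q₁ Q₂ Q₃ = racah q T₃ T₂ T₁ T₄ Q₁ Q₂ Q₃ :=
  tsum_congr fun t => by ring

theorem racah_perm (q T₁ T₂ T₃ T₄ Q₁ Q₂ Q₃ : ℝ) :
    racah q T₁ T₂ T₃ T₄ Q₁ Q₂ Q₃ = racah q T₃ T₄ T₁ T₂ Q₁ Q₂ Q₃ :=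
  tsum_congr fun t => by ring

theorem racah_swap_right (q T₁ T₂ T₃ T₄ Q₁ Q₂ Q₃ : ℝ) :
    racah q T₁ T₂ T₃ T₄ Q₁ Q₂ Q₃ = racah q T₁ T₂ T₃ T₄ Q₂ Q₁ Q₃ :=
  tsum_congr fun t => by ring

/-- The summand of the 9j coefficient, when the first two 6j coefficients are expanded over sums
with `h` and the summation spin in the distinguished places. -/
theorem nineTerm_eq_of_spin (hq : 0 < q) {a b e c d f h k g : ℝ} {A B E C D F H K J : ℤ}
    (S : Spins a b e c d f h k g A B E C D F H K) {j : ℝ} (j2 : 2 * j = J) (hJ : 0 ≤ J)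
    (hpar : (J + C + K) % 2 = 0) {M N : ℕ} (hM : a + c - h < M) (hN : k + c - j < N) :
    nineTerm q a b e c d f h k g j =
      sgn (a + c + g + k) * sgn (k + b + f + c) * sgn (a + g + j) *
      (qFact q (a + c + h + 1) * qFact q (k + g + h + 1) * (qFact q (c + h - a))⁻¹ *
        (qFact q (g + h - k))⁻¹ * (qFact q (c + f - d))⁻¹ * (qFact q (k + b - d))⁻¹ *
        (qFact q (f + d - c))⁻¹ * (qFact q (k + d - b))⁻¹ * (qFact q (a + e - b))⁻¹ *
        (qFact q (b + e - a))⁻¹) *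
      (sixSum q a g j k c h M * sixSum q k b d f c j N *
        (qFact q (j + (g - a)) * (qFact q (j - (g - a)))⁻¹)) := by
  obtain ⟨a2, b2, e2, c2, d2, f2, h2, k2, g_eq, abe, cdf, ach, bdk, hkg⟩ := S
  have g2 : 2 * g = ((E + F : ℤ) : ℝ) := by push_cast; linarith
  have hj0 : 0 ≤ j := by
    have : (0 : ℝ) ≤ J := by exact_mod_cast hJ
    linarith
  have i1 : IsInt (k + c - j) := isInt_of_half (m := K + C - J) (by push_cast; linarith) (by omega)
  have i2 : IsInt (b + f - j) := isInt_of_half (m := B + F - J) (by push_cast; linarith) (by omega)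
  have i3 : IsInt (c + j - k) := isInt_of_half (m := C + J - K) (by push_cast; linarith) (by omega)
  have i4 : IsInt (a + j - g) := isInt_of_half (m := A + J - (E + F)) (by push_cast; linarith) (by omega)
  have i5 : IsInt (k + j - c) := isInt_of_half (m := K + J - C) (by push_cast; linarith) (by omega)
  have i6 : IsInt (f + j - b) := isInt_of_half (m := F + J - B) (by push_cast; linarith) (by omega)
  have n1 : IsNat (c + h - a) := isNat_of_half (m := C + H - A) (by push_cast; linarith) (by omega) (by omega)
  have n2 : IsNat (g + h - k) := isNat_of_half (m := E + F + H - K) (by push_cast; linarith) (by omega) (by omega)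
  have n3 : IsNat (c + f - d) := isNat_of_half (m := C + F - D) (by push_cast; linarith) (by omega) (by omega)
  have n4 : IsNat (k + b - d) := isNat_of_half (m := K + B - D) (by push_cast; linarith) (by omega) (by omega)
  have n5 : IsNat (f + d - c) := isNat_of_half (m := F + D - C) (by push_cast; linarith) (by omega) (by omega)
  have n6 : IsNat (k + d - b) := isNat_of_half (m := K + D - B) (by push_cast; linarith) (by omega) (by omega)
  have n7 : IsNat (a + e - b) := isNat_of_half (m := A + E - B) (by push_cast; linarith) (by omega) (by omega)
  have n8 : IsNat (b + e - a) := isNat_of_half (m := B + E - A) (by push_cast; linarith) (by omega) (by omega)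
  have n9 : IsNat (a + c + h) := isNat_of_half (m := A + C + H) (by push_cast; linarith) (by omega) (by omega)
  have n10 : IsNat (g + k + h) := isNat_of_half (m := E + F + K + H) (by push_cast; linarith) (by omega) (by omega)
  have i7 : IsInt (a + c - h) := isInt_of_half (m := A + C - H) (by push_cast; linarith) (by omega)
  have i8 : IsInt (g + k - h) := isInt_of_half (m := E + F + K - H) (by push_cast; linarith) (by omega)
  have n11 : IsNat (k + c + j) := isNat_of_half (m := K + C + J) (by push_cast; linarith) (by omega) (by omega)
  have n12 : IsNat (b + f + j) := isNat_of_half (m := B + F + J) (by push_cast; linarith) (by omega) (by omega)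
  have n13 : IsNat (a + g + j) := isNat_of_half (m := A + (E + F) + J) (by push_cast; linarith) (by omega) (by omega)
  have n14 : IsNat (k + b + c + f) := isNat_of_half (m := K + B + C + F) (by push_cast; linarith) (by omega) (by omega)
  have n15 : IsNat (a + g + c + k) := isNat_of_half (m := A + (E + F) + C + K) (by push_cast; linarith) (by omega) (by omega)
  -- Whenever a triangle inequality for j fails both sides vanish: the left through `triSq`, the
  -- right through one of the sums or an inverse factorial.
  rcases i1.neg_or_isNat with h | m1
  · rw [sixSum_eq_zero q (a := k) N (Or.inl (by linarith)), nineTerm, triSq_eq_zero q (a := k) (Or.inl (by linarith))]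
    simp only [mul_zero, zero_mul]
  rcases i2.neg_or_isNat with h | m2
  · rw [sixSum_eq_zero q (a := k) N (Or.inr (Or.inl (by linarith))), nineTerm,
      triSq_eq_zero q (a := f) (Or.inl (by linarith))]
    simp only [mul_zero, zero_mul]
  rcases i3.neg_or_isNat with h | m3
  · rw [sixSum_eq_zero q (a := a) M (Or.inr (Or.inr (Or.inl (by linarith)))), nineTerm,
      triSq_eq_zero q (a := k) (Or.inr (Or.inr (by linarith)))]
    simp only [mul_zero, zero_mul]
  rcases i4.neg_or_isNat with h | m4
  · rw [qFact_inv_of_neg q (show j - (g - a) < 0 by linarith), nineTerm,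
      triSq_eq_zero q (a := a) (Or.inr (Or.inl (by linarith)))]
    simp only [mul_zero, zero_mul]
  have n4' := n4.nonneg; have n7' := n7.nonneg; have n8' := n8.nonneg
  have m2' := m2.nonneg; have m4' := m4.nonneg
  have m7 : IsNat (a + g - j) := isNat_of_half (m := A + (E + F) - J) (by push_cast; linarith) (by omega) (by
    have : (0 : ℝ) ≤ ((A + (E + F) - J : ℤ) : ℝ) := by push_cast; linarith
    exact_mod_cast this)
  have m8 : IsNat (b + j - f) := isNat_of_half (m := B + J - F) (by push_cast; linarith) (by omega) (by
    have : (0 : ℝ) ≤ ((B + J - F : ℤ) : ℝ) := by push_cast; linarith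
    exact_mod_cast this)
  have hS := mul_racah_eq_sixSum hq (a := k) (b := b) (e := d) (d := f) (c := c) (f := j) (M := N)
    n3 n4 m3 m8 n5 n6 i1 i2 n11 n12 n14.nonneg hN
  rcases i5.neg_or_isNat with h | m5
  -- For k + j < c no factor of the explicit sum is visibly 0; its Racah form has an empty range.
  · rw [← hS, racah_eq_zero q _ _ _ _ _ (by linarith), nineTerm,
      triSq_eq_zero q (a := k) (Or.inr (Or.inl (by linarith)))]
    simp only [mul_zero, zero_mul]
  rcases i6.neg_or_isNat with h | m6
  · rw [← hS, racah_swap, racah_eq_zero q _ _ _ _ _ (by linarith), nineTerm,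
      triSq_eq_zero q (a := f) (Or.inr (Or.inl (by linarith)))]
    simp only [mul_zero, zero_mul]
  have m6' := m6.nonneg
  have m5' := m5.nonneg
  have m3' := m3.nonneg
  have m1' := m1.nonneg
  have m9 : IsNat (g + j - a) := isNat_of_half (m := E + F + J - A) (by push_cast; linarith) (by omega) (by
    have : (0 : ℝ) ≤ ((E + F + J - A : ℤ) : ℝ) := by push_cast; linarith
    exact_mod_cast this)
  have hS1 := mul_racah_eq_sixSum hq (a := a) (b := g) (e := j) (d := k) (c := c) (f := h) (M := M)
    (by rwa [add_comm c]) m7 n1 n2 m5 m4 i7 i8 n9 n10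
    n15.nonneg hM
  -- Both sides now contain the same two Racah sums up to permuted arguments; what remains is an
  -- identity of products of factorials and signs.
  rw [← hS, ← hS1, nineTerm, racah_stretched q g_eq n13, racah_perm q (a + c + h),
    racah_perm₁₃ q (k + j + c), racah_swap_right q _ _ _ _ (k + j + d + f)]
  have s1 := sgn_mul_self (a + c + g + k)
  have s2 := sgn_mul_self (k + b + f + c)
  rw [show a + g + c + k = a + c + g + k by ring, show k + b + c + f = k + b + f + c by ring,
    show k + f + c + b = k + b + f + c by ring]
  simp only [triSq]
  have n10' : IsNat (k + g + h + 1) := by rw [add_comm k]; exact n10.add_one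
  rw [show a - g + j = a + j - g by ring, show k - c + j = k + j - c by ring,
    show f + b - j = b + f - j by ring, show f - b + j = f + j - b by ring,
    show f + b + j + 1 = b + f + j + 1 by ring, show g + j - (b + e) = f + j - b by rw [g_eq]; ring,
    show c + k - j = k + c - j by ring, show g + k + h + 1 = k + g + h + 1 by ring,
    show j + (g - a) = g + j - a by ring, show j - (g - a) = a + j - g by ring,
    show a + k + j + h = a + k + h + j by ring, show g + c + j + h = c + g + h + j by ring,
    show k + d + b = k + b + d by ring, show f + d + c = f + c + d by ring,
    show k + j + c = k + c + j by ring, show f + j + b = f + b + j by ring,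
    show k + j + d + f = k + f + d + j by ring, show j + d + c + b = b + c + d + j by ring]
  generalize racah q (a + g + j) (k + c + j) (a + c + h) (k + g + h) (a + c + g + k) (a + k + h + j)
    (c + g + h + j) = R₁
  generalize racah q (k + b + d) (f + c + d) (k + c + j) (f + b + j) (k + b + f + c) (k + f + d + j)
    (b + c + d + j) = R₂
  have p0 := qFact_ne_zero hq m7
  have p1 := qFact_ne_zero hq m4
  have p2 := qFact_ne_zero hq m9
  have p3 := qFact_ne_zero hq n13.add_one
  have p4 := qFact_ne_zero hq m1
  have p5 := qFact_ne_zero hq m5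
  have p6 := qFact_ne_zero hq m3
  have p7 := qFact_ne_zero hq n11.add_one
  have p8 := qFact_ne_zero hq m2
  have p9 := qFact_ne_zero hq m6
  have p10 := qFact_ne_zero hq m8
  have p11 := qFact_ne_zero hq n12.add_one
  have p12 := qFact_ne_zero hq n1
  have p13 := qFact_ne_zero hq n2
  have p14 := qFact_ne_zero hq n3
  have p15 := qFact_ne_zero hq n4
  have p16 := qFact_ne_zero hq n5
  have p17 := qFact_ne_zero hq n6
  have p18 := qFact_ne_zero hq n9.add_one
  have p19 := qFact_ne_zero hq n10'
  clear hS hS1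
  generalize qFact q (a + g - j) = x0 at *
  generalize qFact q (a + j - g) = x1 at *
  generalize qFact q (g + j - a) = x2 at *
  generalize qFact q (a + g + j + 1) = x3 at *
  generalize qFact q (k + c - j) = x4 at *
  generalize qFact q (k + j - c) = x5 at *
  generalize qFact q (c + j - k) = x6 at *
  generalize qFact q (k + c + j + 1) = x7 at *
  generalize qFact q (b + f - j) = x8 at *
  generalize qFact q (f + j - b) = x9 at *
  generalize qFact q (b + j - f) = x10 at *
  generalize qFact q (b + f + j + 1) = x11 at *
  generalize qFact q (c + h - a) = x12 at *
  generalize qFact q (g + h - k) = x13 at *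
  generalize qFact q (c + f - d) = x14 at *
  generalize qFact q (k + b - d) = x15 at *
  generalize qFact q (f + d - c) = x16 at *
  generalize qFact q (k + d - b) = x17 at *
  generalize qFact q (a + c + h + 1) = x18 at *
  generalize qFact q (k + g + h + 1) = x19 at *
  generalize (qFact q (a + e - b))⁻¹ = y₁
  generalize (qFact q (b + e - a))⁻¹ = y₂
  generalize sgn (a + c + g + k) = σ₁ at *
  generalize sgn (k + b + f + c) = σ₂ at *
  generalize sgn (a + g + j) = σ₃ at *

  field_simp
  linear_combination (-(R₁ * R₂ * σ₃ * y₁ * y₂)) * (s1 * (σ₂ * σ₂) + s2)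

theorem racah_perm₁₄ (q T₁ T₂ T₃ T₄ Q₁ Q₂ Q₃ : ℝ) :
    racah q T₁ T₂ T₃ T₄ Q₁ Q₂ Q₃ = racah q T₄ T₂ T₃ T₁ Q₃ Q₂ Q₁ :=
  tsum_congr fun t => by ring

theorem racah_perm₁₂₃₄ (q T₁ T₂ T₃ T₄ Q₁ Q₂ Q₃ : ℝ) :
    racah q T₁ T₂ T₃ T₄ Q₁ Q₂ Q₃ = racah q T₄ T₃ T₁ T₂ Q₁ Q₃ Q₂ :=
  tsum_congr fun t => by ring

/-- The summand of the 9j coefficient, when the first two 6j coefficients are expanded over sums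
with `h` and `k` in the distinguished places. -/
theorem nineTerm_eq_of_row (hq : 0 < q) {a b e c d f h k g : ℝ} {A B E C D F H K J : ℤ}
    (S : Spins a b e c d f h k g A B E C D F H K) {j : ℝ} (j2 : 2 * j = J) (hJ : 0 ≤ J)
    (hpar : (J + C + K) % 2 = 0) {M N : ℕ} (hM : a + c - h < M) (hN : b + d - k < N) :
    nineTerm q a b e c d f h k g j =
      sgn (c + k + a + g) * sgn (b + j + d + c) * sgn (a + g + j) *
      (qFact q (a + c + h + 1) * qFact q (k + g + h + 1) * qFact q (b + d + k + 1) *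
        (qFact q (a + h - c))⁻¹ * (qFact q (k + h - g))⁻¹ * (qFact q (c + d - f))⁻¹ *
        (qFact q (d + k - b))⁻¹ * (qFact q (c + f - d))⁻¹ * (qFact q (a + e - b))⁻¹ *
        (qFact q (b + e - a))⁻¹) *
      (sixSum q c k j g a h M * sixSum q b j f c d k N *
        ((qFact q (b + f - j))⁻¹ * (qFact q (b + f + j + 1))⁻¹)) := by
  obtain ⟨a2, b2, e2, c2, d2, f2, h2, k2, g_eq, abe, cdf, ach, bdk, hkg⟩ := S
  have g2 : 2 * g = ((E + F : ℤ) : ℝ) := by push_cast; linarith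
  have hj0 : 0 ≤ j := by
    have : (0 : ℝ) ≤ J := by exact_mod_cast hJ
    linarith
  have i1 : IsInt (k + c - j) := isInt_of_half (m := K + C - J) (by push_cast; linarith) (by omega)
  have i2 : IsInt (b + f - j) := isInt_of_half (m := B + F - J) (by push_cast; linarith) (by omega)
  have i3 : IsInt (c + j - k) := isInt_of_half (m := C + J - K) (by push_cast; linarith) (by omega)
  have i4 : IsInt (a + j - g) := isInt_of_half (m := A + J - (E + F)) (by push_cast; linarith) (by omega)
  have i5 : IsInt (k + j - c) := isInt_of_half (m := K + J - C) (by push_cast; linarith) (by omega)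
  have i6 : IsInt (f + j - b) := isInt_of_half (m := F + J - B) (by push_cast; linarith) (by omega)
  have i7 : IsInt (c + a - h) := isInt_of_half (m := C + A - H) (by push_cast; linarith) (by omega)
  have i8 : IsInt (k + g - h) := isInt_of_half (m := K + (E + F) - H) (by push_cast; linarith) (by omega)
  have i9 : IsInt (b + d - k) := isInt_of_half (m := B + D - K) (by push_cast; linarith) (by omega)
  have i10 : IsInt (j + c - k) := isInt_of_half (m := J + C - K) (by push_cast; linarith) (by omega)
  have n1 : IsNat (a + h - c) := isNat_of_half (m := A + H - C) (by push_cast; linarith) (by omega) (by omega)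
  have n2 : IsNat (k + h - g) := isNat_of_half (m := K + H - (E + F)) (by push_cast; linarith) (by omega) (by omega)
  have n3 : IsNat (d + c - f) := isNat_of_half (m := D + C - F) (by push_cast; linarith) (by omega) (by omega)
  have n4 : IsNat (d + k - b) := isNat_of_half (m := D + K - B) (by push_cast; linarith) (by omega) (by omega)
  have n5 : IsNat (c + f - d) := isNat_of_half (m := C + F - D) (by push_cast; linarith) (by omega) (by omega)
  have n7 : IsNat (a + e - b) := isNat_of_half (m := A + E - B) (by push_cast; linarith) (by omega) (by omega)
  have n8 : IsNat (b + e - a) := isNat_of_half (m := B + E - A) (by push_cast; linarith) (by omega) (by omega)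
  have n9 : IsNat (c + a + h) := isNat_of_half (m := C + A + H) (by push_cast; linarith) (by omega) (by omega)
  have n10 : IsNat (k + g + h) := isNat_of_half (m := K + (E + F) + H) (by push_cast; linarith) (by omega) (by omega)
  have n6 : IsNat (b + d + k) := isNat_of_half (m := B + D + K) (by push_cast; linarith) (by omega) (by omega)
  have n11 : IsNat (j + c + k) := isNat_of_half (m := J + C + K) (by push_cast; linarith) (by omega) (by omega)
  have n12 : IsNat (b + f + j) := isNat_of_half (m := B + F + J) (by push_cast; linarith) (by omega) (by omega)
  have n13 : IsNat (a + g + j) := isNat_of_half (m := A + (E + F) + J) (by push_cast; linarith) (by omega) (by omega)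
  have n14 : IsNat (b + j + d + c) := isNat_of_half (m := B + J + D + C) (by push_cast; linarith) (by omega) (by omega)
  have n15 : IsNat (c + k + a + g) := isNat_of_half (m := C + K + A + (E + F)) (by push_cast; linarith) (by omega) (by omega)
  rcases i2.neg_or_isNat with h | m2
  · rw [qFact_inv_of_neg q h, nineTerm, triSq_eq_zero q (a := f) (Or.inl (by linarith))]
    simp only [mul_zero, zero_mul]
  rcases i4.neg_or_isNat with h | m4
  · rw [sixSum_eq_zero q (a := c) M (Or.inr (Or.inr (Or.inl (by linarith)))), nineTerm,
      triSq_eq_zero q (a := a) (Or.inr (Or.inl (by linarith)))]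
    simp only [mul_zero, zero_mul]
  rcases i6.neg_or_isNat with h | m6
  · rw [sixSum_eq_zero q (a := b) N (Or.inr (Or.inr (Or.inr (by linarith)))), nineTerm,
      triSq_eq_zero q (a := f) (Or.inr (Or.inl (by linarith)))]
    simp only [mul_zero, zero_mul]
  rcases i3.neg_or_isNat with h | m3
  · rw [sixSum_eq_zero q (a := b) N (Or.inr (Or.inl (by linarith))), nineTerm,
      triSq_eq_zero q (a := k) (Or.inr (Or.inr (by linarith)))]
    simp only [mul_zero, zero_mul]
  rcases i5.neg_or_isNat with h | m5
  · rw [sixSum_eq_zero q (a := c) M (Or.inr (Or.inr (Or.inr (by linarith)))), nineTerm,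
      triSq_eq_zero q (a := k) (Or.inr (Or.inl (by linarith)))]
    simp only [mul_zero, zero_mul]
  have n7' := n7.nonneg
  have n8' := n8.nonneg
  have m2' := m2.nonneg
  have m4' := m4.nonneg
  have m6' := m6.nonneg
  have m7 : IsNat (a + g - j) := isNat_of_half (m := A + (E + F) - J) (by push_cast; linarith) (by omega) (by
    have : (0 : ℝ) ≤ ((A + (E + F) - J : ℤ) : ℝ) := by push_cast; linarith
    exact_mod_cast this)
  have m8 : IsNat (b + j - f) := isNat_of_half (m := B + J - F) (by push_cast; linarith) (by omega) (by
    have : (0 : ℝ) ≤ ((B + J - F : ℤ) : ℝ) := by push_cast; linarith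
    exact_mod_cast this)
  have m9 : IsNat (g + j - a) := isNat_of_half (m := E + F + J - A) (by push_cast; linarith) (by omega) (by
    have : (0 : ℝ) ≤ ((E + F + J - A : ℤ) : ℝ) := by push_cast; linarith
    exact_mod_cast this)
  have hS := mul_racah_eq_sixSum hq (a := b) (b := j) (e := f) (d := c) (c := d) (f := k) (M := N)
    n3 m8 n4 (by rwa [add_comm j]) n5 (by assumption) i9 i10 n6 n11 n14.nonneg hN
  rcases i1.neg_or_isNat with h | m1
  -- The inequality j ≤ k + c is again visible only in Racah's form.
  · rw [← hS, racah_swap, racah_eq_zero q _ _ _ _ _ (by linarith), nineTerm,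
      triSq_eq_zero q (a := k) (Or.inl (by linarith))]
    simp only [mul_zero, zero_mul]
  have hS1 := mul_racah_eq_sixSum hq (a := c) (b := k) (e := j) (d := g) (c := a) (f := h) (M := M)
    m7 (by rwa [add_comm c]) n1 n2 m9 m3 i7 i8 n9 n10 n15.nonneg (by linarith)
  rw [← hS, ← hS1, nineTerm, racah_stretched q g_eq n13, racah_perm₁₂₃₄ q (a + c + h),
    racah_perm₁₄ q (k + j + c)]
  have s1 := sgn_mul_self (c + k + a + g)
  have s2 := sgn_mul_self (b + j + d + c)
  simp only [triSq]
  rw [show a - g + j = a + j - g by ring, show k - c + j = k + j - c by ring,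
    show f + b - j = b + f - j by ring, show f - b + j = f + j - b by ring,
    show f + b + j + 1 = b + f + j + 1 by ring, show g + j - (b + e) = f + j - b by rw [g_eq]; ring,
    show c + k - j = k + c - j by ring,
    show a + c + h + 1 = c + a + h + 1 by ring, show c + d - f = d + c - f by ring,
    show j + k - c = k + j - c by ring, show k + c + j + 1 = j + c + k + 1 by ring,
    show k + c + j = c + k + j by ring, show a + g + j = g + a + j by ring,
    show a + c + h = c + a + h by ring, show k + g + h = g + k + h by ring,
    show a + c + g + k = c + k + a + g by ring, show c + g + h + j = c + g + j + h by ring,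
    show a + k + h + j = k + a + j + h by ring, show f + j + b = b + j + f by ring,
    show f + d + c = c + d + f by ring, show k + d + b = b + d + k by ring,
    show k + j + c = c + j + k by ring, show j + d + c + b = b + j + d + c by ring,
    show k + f + c + b = b + c + f + k by ring, show k + j + d + f = j + d + f + k by ring]
  generalize racah q (c + k + j) (g + a + j) (c + a + h) (g + k + h) (c + k + a + g) (c + g + j + h)
    (k + a + j + h) = R₁
  generalize racah q (b + j + f) (c + d + f) (b + d + k) (c + j + k) (b + j + d + c) (b + c + f + k)
    (j + d + f + k) = R₂
  have n13' : IsNat (g + a + j + 1) := by rw [add_comm g]; exact n13.add_one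
  have n10' : IsNat (g + k + h + 1) := by rw [add_comm g]; exact n10.add_one
  have p0 := qFact_ne_zero hq m7
  have p1 := qFact_ne_zero hq m4
  have p2 := qFact_ne_zero hq m9
  have p3 := qFact_ne_zero hq n13'
  have p4 := qFact_ne_zero hq m1
  have p5 := qFact_ne_zero hq m5
  have p6 := qFact_ne_zero hq m3
  have p7 := qFact_ne_zero hq n11.add_one
  have p8 := qFact_ne_zero hq m2
  have p9 := qFact_ne_zero hq m6
  have p10 := qFact_ne_zero hq m8
  have p11 := qFact_ne_zero hq n12.add_one
  have p12 := qFact_ne_zero hq n1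
  have p13 := qFact_ne_zero hq n2
  have p14 := qFact_ne_zero hq n3
  have p15 := qFact_ne_zero hq n4
  have p16 := qFact_ne_zero hq n5
  have p17 := qFact_ne_zero hq n9.add_one
  have p18 := qFact_ne_zero hq n10'
  have p19 := qFact_ne_zero hq n6.add_one
  clear hS hS1
  generalize qFact q (a + g - j) = x0 at *
  generalize qFact q (a + j - g) = x1 at *
  generalize qFact q (g + j - a) = x2 at *
  generalize qFact q (g + a + j + 1) = x3 at *
  generalize qFact q (k + c - j) = x4 at *
  generalize qFact q (k + j - c) = x5 at *
  generalize qFact q (c + j - k) = x6 at *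
  generalize qFact q (j + c + k + 1) = x7 at *
  generalize qFact q (b + f - j) = x8 at *
  generalize qFact q (f + j - b) = x9 at *
  generalize qFact q (b + j - f) = x10 at *
  generalize qFact q (b + f + j + 1) = x11 at *
  generalize qFact q (a + h - c) = x12 at *
  generalize qFact q (k + h - g) = x13 at *
  generalize qFact q (d + c - f) = x14 at *
  generalize qFact q (d + k - b) = x15 at *
  generalize qFact q (c + f - d) = x16 at *
  generalize qFact q (c + a + h + 1) = x17 at *
  generalize qFact q (g + k + h + 1) = x18 at *
  generalize qFact q (b + d + k + 1) = x19 at *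
  generalize (qFact q (a + e - b))⁻¹ = y₁
  generalize (qFact q (b + e - a))⁻¹ = y₂
  generalize sgn (c + k + a + g) = σ₁ at *
  generalize sgn (b + j + d + c) = σ₂ at *
  generalize sgn (g + a + j) = σ₃ at *
  field_simp
  linear_combination (-(R₁ * R₂ * σ₃ * y₁ * y₂)) * (s1 * (σ₂ * σ₂) + s2)

/-! ### Summation over j with h and k distinguished. -/

/-- Reindexing by an integer of either sign; the last two hypotheses say that no term of the support
is lost at the ends of the ranges. -/
theorem sum_shift {f g : ℕ → ℝ} {δ : ℤ} {M N : ℕ} (h : ∀ m n : ℕ, (m : ℤ) = n + δ → f m = g n)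
    (hf : ∀ m : ℕ, f m ≠ 0 → 0 ≤ m - δ ∧ m - δ < N) (hg : ∀ n : ℕ, g n ≠ 0 → 0 ≤ n + δ ∧ n + δ < M) :
    ∑ m ∈ range M, f m = ∑ n ∈ range N, g n := by
  refine sum_bij_ne_zero (fun m _ _ => (m - δ).toNat) ?_ ?_ ?_ ?_
  · intro m _ h0
    have := hf m h0
    rw [mem_range]; omega
  · intro m _ h0 m' _ h0' he
    have := hf m h0
    have := hf m' h0'
    omega
  · intro n hn h0
    have h1 := hg n h0
    have h2 : (((n + δ).toNat : ℕ) : ℤ) = n + δ := Int.toNat_of_nonneg h1.1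
    refine ⟨(n + δ).toNat, mem_range.2 (by omega), by rwa [h _ n h2], by omega⟩
  · intro m _ h0
    have h1 := hf m h0
    exact h _ _ (by rw [Int.toNat_of_nonneg h1.1]; ring)

/-- Exchange of summations behind the double sums. -/
theorem sum_mul_sum_spin {M N L : ℕ} {u v : ℕ → ℝ} {φ ψ : ℕ → ℕ → ℝ} {w : ℕ → ℝ} {S T R : ℕ → ℝ}
    (hS : ∀ i < L, S i = ∑ x ∈ range M, u x * φ i x)
    (hT : ∀ i < L, T i = ∑ z ∈ range N, v z * ψ i z)  {r : ℕ → ℕ → ℝ}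
    (hr : ∀ x < M, ∀ z < N, u x * v z * ∑ i ∈ range L, w i * (φ i x * ψ i z * R i) = r x z) :
    ∑ i ∈ range L, w i * (S i * T i * R i) = ∑ x ∈ range M, ∑ z ∈ range N, r x z := by
  calc _ = ∑ i ∈ range L, ∑ x ∈ range M, ∑ z ∈ range N, u x * v z * (w i * (φ i x * ψ i z * R i)) := by
        refine sum_congr rfl fun i hi => ?_
        rw [hS i (mem_range.1 hi), hT i (mem_range.1 hi), sum_mul_sum]
        simp only [sum_mul, mul_sum]
        exact sum_congr rfl fun x _ => sum_congr rfl fun z _ => by ring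
    _ = _ := by
        rw [sum_comm]
        refine sum_congr rfl fun x hx => ?_
        rw [sum_comm]
        refine sum_congr rfl fun z hz => ?_
        rw [← hr x (mem_range.1 hx) z (mem_range.1 hz), mul_sum]

/-- The spin j enters only through [j+X]!/[j-X]!, [j+Y]!/[j-Y]! and 1/([A-j]! [A+j+1]!), where X = c
+ g - h - x, Y = k + z - c and A = b + f. This is the summand of `sum_spin`. -/
theorem nineJ_eq_of_row (hq : 0 < q) {a b e c d f h k g : ℝ} {A B E C D F H K : ℤ}
    (S : Spins a b e c d f h k g A B E C D F H K)
    (habe : IsTriad a b e) (hcdf : IsTriad c d f) (hhkg : IsTriad h k g)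
    (hach : IsTriad a c h) (hbdk : IsTriad b d k) {M N : ℕ} (hM : a + c - h < M) (hN : b + d - k < N) :
    nineJ q a b e c d f h k g = triProd q a b e c d f h k g * sgn (b + d - k) *
      q ^ (zz d + zz e + zz h) *
      (qFact q (a + c + h + 1) * qFact q (k + g + h + 1) * qFact q (b + d + k + 1) *
        (qFact q (a + h - c))⁻¹ * (qFact q (k + h - g))⁻¹ * (qFact q (c + d - f))⁻¹ *
        (qFact q (d + k - b))⁻¹ * (qFact q (c + f - d))⁻¹ * (qFact q (a + e - b))⁻¹ *
        (qFact q (b + e - a))⁻¹) *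
      ∑ x ∈ range M, ∑ z ∈ range N, (-1) ^ x * (-1) ^ z *
        (qFact q (a + h - c + x) * qFact q (k + h - g + x) * (qFact q x)⁻¹ *
          (qFact q (a + c - h - x))⁻¹ * (qFact q (g + k - h - x))⁻¹ * (qFact q (2 * h + x + 1))⁻¹ *
          (qFact q (b - e - c + h + x))⁻¹ *
        (qFact q (d + k - b + z) * (qFact q z)⁻¹ * (qFact q (b + d - k - z))⁻¹ *
          (qFact q (f + k - b - c + z))⁻¹ * (qFact q (2 * k + z + 1))⁻¹ *
          qFact q (g + k - h - x + z))) *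
        q ^ (-((b + f) * (g + k - h - x + z + 1) - (c + g - h - x) * (k + z - c))) := by
  have S' := S
  obtain ⟨a2, b2, e2, c2, d2, f2, h2, k2, g_eq, abe, cdf, ach, bdk, hkg⟩ := S
  have g2 : 2 * g = ((E + F : ℤ) : ℝ) := by push_cast; linarith
  obtain ⟨p, hp, hpar⟩ : ∃ p : ℕ, p < 2 ∧ ((p : ℤ) + C + K) % 2 = 0 :=
    ⟨((C + K) % 2).toNat, by omega, by omega⟩
  obtain ⟨L, hL⟩ := exists_nat_gt (a + g - p / 2)
  have hp1 : (p : ℝ) / 2 < 1 := by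
    have : (p : ℝ) < 2 := by exact_mod_cast hp
    linarith
  rw [nineJ_eq_sum hq S' habe hcdf hhkg hach hbdk hp hpar hL]
  have n7 : IsNat (a + e - b) := isNat_of_half (m := A + E - B) (by push_cast; linarith) (by omega) (by omega)
  have hterm : ∀ i < L, q ^ (-(((p : ℝ) / 2 + i) * ((p : ℝ) / 2 + i + 1))) *
        qNum q (2 * ((p : ℝ) / 2 + i) + 1) * nineTerm q a b e c d f h k g ((p : ℝ) / 2 + i) =
      (sgn p * sgn (b + d - k) * (qFact q (a + c + h + 1) * qFact q (k + g + h + 1) * qFact q (b + d + k + 1) *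
        (qFact q (a + h - c))⁻¹ * (qFact q (k + h - g))⁻¹ * (qFact q (c + d - f))⁻¹ *
        (qFact q (d + k - b))⁻¹ * (qFact q (c + f - d))⁻¹ * (qFact q (a + e - b))⁻¹ *
        (qFact q (b + e - a))⁻¹)) * ((q ^ (-(((p : ℝ) / 2 + i) * ((p : ℝ) / 2 + i + 1))) *
        qNum q (2 * ((p : ℝ) / 2 + i) + 1)) * (sixSum q c k (p / 2 + i) g a h M *
          sixSum q b (p / 2 + i) f c d k N *
        ((qFact q (b + f - (p / 2 + i)))⁻¹ * (qFact q (b + f + (p / 2 + i) + 1))⁻¹))) := by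
    intro i _
    rw [nineTerm_eq_of_row hq S' (j := p / 2 + i) (J := p + 2 * i) (by push_cast; ring) (by omega)
      (by omega) hM hN]
    -- The spin j occurs twice in the exponents, so the sign depends on p alone.
    have hs : sgn (c + k + a + g) * sgn (b + ((p : ℝ) / 2 + i) + d + c) * sgn (a + g + ((p : ℝ) / 2 + i)) =
        sgn p * sgn (b + d - k) := by
      have i1 : IsInt (c + k + a + g) := isInt_of_half (m := C + K + A + (E + F)) (by push_cast; linarith) (by omega)
      have i2 : IsInt (b + ((p : ℝ) / 2 + i) + d + c) := isInt_of_half (m := B + (p + 2 * i) + D + C) (by push_cast; linarith) (by omega)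
      have i3 : IsInt (a + g + ((p : ℝ) / 2 + i)) := isInt_of_half (m := A + (E + F) + (p + 2 * i)) (by push_cast; linarith) (by omega)
      have i4 : IsInt (b + d - k) := isInt_of_half (m := B + D - K) (by push_cast; linarith) (by omega)
      rw [← sgn_add i1 i2, ← sgn_add (i1.add i2) i3, ← sgn_add (isNat_natCast p).isInt i4]
      obtain ⟨n, hn⟩ : ∃ n : ℤ, 2 * i + A + E + F + C + K = 2 * n := ⟨(2 * i + A + E + F + C + K) / 2, by omega⟩
      refine sgn_eq_of_half (n := n) ((i1.add i2).add i3) ?_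
      have : ((2 * i + A + E + F + C + K : ℤ) : ℝ) = ((2 * n : ℤ) : ℝ) := by rw [hn]
      push_cast at this
      linarith
    rw [hs]; ring
  rw [sum_congr rfl fun i hi => hterm i (mem_range.1 hi), ← mul_sum]
  rw [sum_mul_sum_spin (M := M) (N := N)
    (u := fun x => (-1) ^ x * (qFact q (a + h - c + x) * qFact q (k + h - g + x) * (qFact q x)⁻¹ *
          (qFact q (a + c - h - x))⁻¹ * (qFact q (g + k - h - x))⁻¹ * (qFact q (2 * h + x + 1))⁻¹))
    (v := fun z => (-1) ^ z * (qFact q (d + k - b + z) * qFact q (b + f - (k + z - c)) * (qFact q z)⁻¹ *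
      (qFact q (b + d - k - z))⁻¹ * (qFact q (f + k - b - c + z))⁻¹ * (qFact q (2 * k + z + 1))⁻¹))
    (φ := fun i x => qFact q (p / 2 + i + (c + g - h - x)) * (qFact q (p / 2 + i - (c + g - h - x)))⁻¹)
    (ψ := fun i z => qFact q (p / 2 + i + (k + z - c)) * (qFact q (p / 2 + i - (k + z - c)))⁻¹)
    (r := fun x z => (-1) ^ x * (-1) ^ z *
        (qFact q (a + h - c + x) * qFact q (k + h - g + x) * (qFact q x)⁻¹ *
          (qFact q (a + c - h - x))⁻¹ * (qFact q (g + k - h - x))⁻¹ * (qFact q (2 * h + x + 1))⁻¹ *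
          (qFact q (b - e - c + h + x))⁻¹ *
        (qFact q (d + k - b + z) * (qFact q z)⁻¹ * (qFact q (b + d - k - z))⁻¹ *
          (qFact q (f + k - b - c + z))⁻¹ * (qFact q (2 * k + z + 1))⁻¹ *
          qFact q (g + k - h - x + z))) *
        q ^ (-((b + f) * (g + k - h - x + z + 1) - (c + g - h - x) * (k + z - c))))]
  · linear_combination (triProd q a b e c d f h k g * q ^ (zz d + zz e + zz h) *
      (sgn (b + d - k) * (qFact q (a + c + h + 1) * qFact q (k + g + h + 1) * qFact q (b + d + k + 1) *
        (qFact q (a + h - c))⁻¹ * (qFact q (k + h - g))⁻¹ * (qFact q (c + d - f))⁻¹ *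
        (qFact q (d + k - b))⁻¹ * (qFact q (c + f - d))⁻¹ * (qFact q (a + e - b))⁻¹ *
        (qFact q (b + e - a))⁻¹)) * ∑ x ∈ range M, ∑ z ∈ range N, (-1) ^ x * (-1) ^ z *
        (qFact q (a + h - c + x) * qFact q (k + h - g + x) * (qFact q x)⁻¹ *
          (qFact q (a + c - h - x))⁻¹ * (qFact q (g + k - h - x))⁻¹ * (qFact q (2 * h + x + 1))⁻¹ *
          (qFact q (b - e - c + h + x))⁻¹ *
        (qFact q (d + k - b + z) * (qFact q z)⁻¹ * (qFact q (b + d - k - z))⁻¹ *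
          (qFact q (f + k - b - c + z))⁻¹ * (qFact q (2 * k + z + 1))⁻¹ *
          qFact q (g + k - h - x + z))) *
        q ^ (-((b + f) * (g + k - h - x + z + 1) - (c + g - h - x) * (k + z - c)))) * sgn_mul_self (p : ℝ)
  · intro i _
    refine sum_congr rfl fun x _ => ?_
    rw [show c + g + ((p : ℝ) / 2 + i) - h - x = p / 2 + i + (c + g - h - x) by ring,
      show (p : ℝ) / 2 + i + h - c - g + x = p / 2 + i - (c + g - h - x) by ring,
      add_comm c a, add_comm k g]
    ring
  · intro i _
    refine sum_congr rfl fun z _ => ?_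
    rw [show (p : ℝ) / 2 + i + k - c + z = p / 2 + i + (k + z - c) by ring,
      show (p : ℝ) / 2 + i + c - k - z = p / 2 + i - (k + z - c) by ring,
      show b + c + f - k - (z : ℝ) = b + f - (k + z - c) by ring]
    ring
  · intro x _ z _
    have i8 : IsInt (g + k - h - x) := isInt_of_half (m := E + F + K - H - 2 * x) (by push_cast; linarith) (by omega)
    rcases i8.neg_or_isNat with h8 | h8
    · rw [qFact_inv_of_neg q h8]; simp only [mul_zero, zero_mul]
    have i9 : IsInt (b + d - k - z) := isInt_of_half (m := B + D - K - 2 * z) (by push_cast; linarith) (by omega)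
    rcases i9.neg_or_isNat with h9 | h9
    · rw [qFact_inv_of_neg q h9]; simp only [mul_zero, zero_mul]
    -- This makes the numerator [A-Y]! of the z-sum cancel the 1/[A-Y]! produced by `sum_spin`.
    have h10 : IsNat (b + f - (k + z - c)) := by
      have n5 : IsNat (c + f - d) := isNat_of_half (m := C + F - D) (by push_cast; linarith) (by omega) (by omega)
      have := h9.add n5
      rwa [show b + d - k - z + (c + f - d) = b + f - (k + z - c) by ring] at this
    have hsum := sum_spin hq (J₀ := p / 2) (X := c + g - h - x) (Y := k + z - c) (A := b + f) (M := L) hp1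
      (isInt_of_half (m := C + (E + F) - H - 2 * x - p) (by push_cast; linarith) (by omega))
      (isInt_of_half (m := K + 2 * z - C - p) (by push_cast; linarith) (by omega))
      (isInt_of_half (m := B + F - p) (by push_cast; linarith) (by omega))
      (by have := h8.add (isNat_natCast z)
          rwa [show g + k - h - x + z = c + g - h - x + (k + z - c) by ring] at this)
      (by linarith [n7.nonneg])
    have h11 := mul_inv_cancel₀ (qFact_ne_zero hq h10)
    rw [show c + g - h - x + (k + z - c) = g + k - h - x + z by ring,
      show b + f - (c + g - h - x) = b - e - c + h + x by rw [g_eq]; ring] at hsum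
    have hsum' : ∑ i ∈ range L, q ^ (-(((p : ℝ) / 2 + i) * ((p : ℝ) / 2 + i + 1))) *
        qNum q (2 * ((p : ℝ) / 2 + i) + 1) * (qFact q (p / 2 + i + (c + g - h - x)) *
        (qFact q (p / 2 + i - (c + g - h - x)))⁻¹ * (qFact q (p / 2 + i + (k + z - c)) *
        (qFact q (p / 2 + i - (k + z - c)))⁻¹) * ((qFact q (b + f - (p / 2 + i)))⁻¹ *
        (qFact q (b + f + (p / 2 + i) + 1))⁻¹)) = _ := (sum_congr rfl fun i _ => by ring).trans hsum
    rw [hsum']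
    generalize (qFact q (b + f - (k + z - c)))⁻¹ = y at *
    generalize qFact q (b + f - (k + z - c)) = y' at *
    generalize q ^ (-((b + f) * (g + k - h - x + z + 1) - (c + g - h - x) * (k + z - c))) = y''
    linear_combination ((-1) ^ x * (-1) ^ z *
        (qFact q (a + h - c + x) * qFact q (k + h - g + x) * (qFact q x)⁻¹ *
          (qFact q (a + c - h - x))⁻¹ * (qFact q (g + k - h - x))⁻¹ * (qFact q (2 * h + x + 1))⁻¹ *
          (qFact q (b - e - c + h + x))⁻¹ *
        (qFact q (d + k - b + z) * (qFact q z)⁻¹ * (qFact q (b + d - k - z))⁻¹ *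
          (qFact q (f + k - b - c + z))⁻¹ * (qFact q (2 * k + z + 1))⁻¹ *
          qFact q (g + k - h - x + z))) * y'') * h11

/-! ### q-differences of products of q-numbers. -/

/-- By Pascal's rule the sum of order n + 1 is 1 - q^(2(n-m)) times the one of order n. The first
factor vanishes for m = n, the second inductively for m < n. -/
theorem sum_qBin_eq_zero (hq : 0 < q) (n m : ℕ) (hm : m < n) :
    ∑ k ∈ range (n + 1), qBin q n k * ((-1) ^ k * q ^ ((k : ℝ) * (n - 1 - 2 * m))) = 0 := by
  induction n with
  | zero => omega
  | succ n ih =>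
    rw [sum_qBin_succ hq n]
    have h : ∀ k ∈ range (n + 1), qBin q n k * (q ^ (-(k : ℝ)) * ((-1) ^ k *
        q ^ ((k : ℝ) * ((n + 1 : ℕ) - 1 - 2 * m))) + q ^ ((n : ℝ) - k) * ((-1) ^ (k + 1) *
        q ^ (((k + 1 : ℕ) : ℝ) * ((n + 1 : ℕ) - 1 - 2 * m)))) =
        (1 - q ^ (2 * ((n : ℝ) - m))) * (qBin q n k * ((-1) ^ k * q ^ ((k : ℝ) * (n - 1 - 2 * m)))) := by
      intro k _
      have e1 : q ^ (-(k : ℝ)) * q ^ ((k : ℝ) * ((n + 1 : ℕ) - 1 - 2 * m)) =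
          q ^ ((k : ℝ) * (n - 1 - 2 * m)) := by
        rw [← Real.rpow_add hq]; congr 1; push_cast; ring
      have e2 : q ^ ((n : ℝ) - k) * q ^ (((k + 1 : ℕ) : ℝ) * ((n + 1 : ℕ) - 1 - 2 * m)) =
          q ^ (2 * ((n : ℝ) - m)) * q ^ ((k : ℝ) * (n - 1 - 2 * m)) := by
        rw [← Real.rpow_add hq, ← Real.rpow_add hq]; congr 1; push_cast; ring
      linear_combination (qBin q n k * (-1) ^ k) * (e1 - e2)
    rw [sum_congr rfl h, ← mul_sum]
    rcases Nat.lt_or_eq_of_le (Nat.lt_succ_iff.1 hm) with hm | rfl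
    · rw [ih hm, mul_zero]
    · simp

/-- A `q`-difference of order `n` annihilates products of fewer than `n` `q`-numbers. -/
theorem sum_qBin_prod_eq_zero (hq : 0 < q) (l : List ℝ) (c : ℝ) (n m : ℕ) (hm : l.length + m < n) :
    ∑ k ∈ range (n + 1), qBin q n k * ((-1) ^ k * q ^ ((k : ℝ) * (n - 1 - l.length - 2 * m)) *
      (l.map fun α => qNum q (α + c + k)).prod) = 0 := by
  induction l generalizing c n m with
  | nil =>
    simp only [List.length_nil, Nat.cast_zero, sub_zero, List.map_nil, List.prod_nil, mul_one]
    exact sum_qBin_eq_zero hq n m (by simpa using hm)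
  | cons α l ih =>
    obtain ⟨n, rfl⟩ : ∃ n', n = n' + 1 := ⟨n - 1, by omega⟩
    simp only [List.length_cons] at hm ⊢
    have h1 := ih c (n + 1) (m + 1) (by omega)
    have h2 := ih (c + 1) n m (by omega)
    -- Split [α+c+k] = q^(α+c) [k] + q^(-k) [α+c]. The second part keeps the order and raises m by
    -- one.
    have e1 : ∀ k ∈ range (n + 1 + 1), qBin q (n + 1) k * ((-1) ^ k *
        q ^ ((k : ℝ) * ((n + 1 : ℕ) - 1 - ((l.length + 1 : ℕ) : ℝ) - 2 * m)) *
        ((α :: l).map fun α => qNum q (α + c + k)).prod) =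
        q ^ (α + c) * (qNum q k * qBin q (n + 1) k * ((-1) ^ k *
          q ^ ((k : ℝ) * (n - 1 - l.length - 2 * m)) * (l.map fun α => qNum q (α + c + k)).prod)) +
        qNum q (α + c) * (qBin q (n + 1) k * ((-1) ^ k *
          q ^ ((k : ℝ) * ((n + 1 : ℕ) - 1 - l.length - 2 * (m + 1 : ℕ))) *
            (l.map fun α => qNum q (α + c + k)).prod)) := by
      intro k _
      have e2 : q ^ ((k : ℝ) * (n - 1 - l.length - 2 * m)) * q ^ (-(k : ℝ)) =
          q ^ ((k : ℝ) * ((n + 1 : ℕ) - 1 - l.length - 2 * (m + 1 : ℕ))) := by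
        rw [← Real.rpow_add hq]; congr 1; push_cast; ring
      rw [← e2, List.map_cons, List.prod_cons, qNum_add hq (α + c) k,
        show ((n + 1 : ℕ) : ℝ) - 1 - ((l.length + 1 : ℕ) : ℝ) - 2 * m = n - 1 - l.length - 2 * m by
          push_cast; ring]
      ring
    rw [sum_congr rfl e1, sum_add_distrib, ← mul_sum, ← mul_sum, h1, mul_zero, add_zero,
      sum_range_succ', Nat.cast_zero, qNum_zero, zero_mul, zero_mul, add_zero]
    -- In the first part [k] is absorbed into the q-binomial coefficient: the order drops by one and
    -- c moves to c + 1.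
    have e3 : ∀ k ∈ range (n + 1), qNum q ((k + 1 : ℕ) : ℝ) * qBin q (n + 1) (k + 1) * ((-1) ^ (k + 1) *
          q ^ (((k + 1 : ℕ) : ℝ) * (n - 1 - l.length - 2 * m)) *
          (l.map fun α => qNum q (α + c + ((k + 1 : ℕ) : ℝ))).prod) =
        -(qNum q ((n : ℝ) + 1) * q ^ ((n : ℝ) - 1 - l.length - 2 * m)) * (qBin q n k * ((-1) ^ k *
          q ^ ((k : ℝ) * (n - 1 - l.length - 2 * m)) *
          (l.map fun α => qNum q (α + (c + 1) + k)).prod)) := by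
      intro k hk
      have hk := Nat.lt_succ_iff.1 (mem_range.1 hk)
      have h3 := qBin_succ_mul hq (n + 1) k (by omega)
      have h4 := qBin_eq_succ hq n k (by omega)
      have h5 := (qNum_pos hq (show (0 : ℝ) < n + 1 by positivity)).ne'
      have h6 : q ^ (((k + 1 : ℕ) : ℝ) * (n - 1 - l.length - 2 * m)) =
          q ^ ((k : ℝ) * (n - 1 - l.length - 2 * m)) * q ^ ((n : ℝ) - 1 - l.length - 2 * m) := by
        rw [← Real.rpow_add hq]; congr 1; push_cast; ring
      have h7 : ∀ α : ℝ, α + c + ((k + 1 : ℕ) : ℝ) = α + (c + 1) + k := by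
        intro α; push_cast; ring
      simp only [h7]
      rw [h6, h4, Nat.cast_succ, h3, Nat.cast_succ, pow_succ]
      field_simp
    rw [sum_congr rfl e3, ← mul_sum, h2, mul_zero, mul_zero]

theorem qFact_mul_inv_eq_qPoch (hq : 0 < q) {C : ℝ} {n : ℕ} (hC : IsNat (C + n)) :
    qFact q (C + n) * (qFact q C)⁻¹ = qPoch q (C + 1) n := by
  have h := qFact_add_lower hq hC 0 (Nat.zero_le n)
  have h1 := qFact_ne_zero hq hC
  rw [Nat.cast_zero, add_zero, add_zero, Nat.sub_zero, pow_zero, mul_one] at h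
  rw [h, mul_inv_cancel_left₀ h1]

/-- The three Pochhammer symbols together are a product of r + s + t q-numbers linear in k. -/
theorem sum_qPoch_eq_zero (hq : 0 < q) (α β γ : ℝ) {r s t n : ℕ} (h : r + s + t < n) :
    ∑ k ∈ range (n + 1), qBin q n k * ((-1) ^ k * q ^ ((k : ℝ) * (n - 1 - (r + s + t))) *
      (qPoch q (α + k) r * qPoch q (β + k) s * qPoch q (γ + k) t)) = 0 := by
  have hl : ∀ (α : ℝ) (r k : ℕ), ((List.range r).map fun i : ℕ => qNum q (α + i + k)).prod =
      qPoch q (α + k) r := by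
    intro α r k
    induction r with
    | zero => simp [qPoch_zero]
    | succ r ih =>
      rw [List.range_succ, List.map_append, List.prod_append, ih, qPoch_succ]
      simp [add_right_comm]
  have := sum_qBin_prod_eq_zero hq (((List.range r).map fun i : ℕ => α + i) ++
    ((List.range s).map fun i : ℕ => β + i) ++ ((List.range t).map fun i : ℕ => γ + i)) 0 n 0
      (by simpa [add_assoc] using h)
  rw [← this]
  refine sum_congr rfl fun k _ => ?_
  simp only [List.map_append, List.prod_append, List.map_map, Function.comp_def, hl, List.length_append,
    List.length_map, List.length_range, Nat.cast_zero, mul_zero, sub_zero, Nat.cast_add,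
    add_zero, mul_assoc]

/-! ### Summation over j with h and j distinguished. -/

/-- The defining sum of the 6j coefficient with the summation shifted by an integer. -/
theorem sixSum_eq_shift {k b d f c j : ℝ} {N L : ℕ} (hj : IsInt (k - d + f - j))
    (hN : b + d - k < N) (hL : k - d + f - j + N < L) :
    sixSum q k b d f c j L = sgn (k - d + f - j) * ∑ z ∈ range N, (-1) ^ z *
      (qFact q (c - d + f + z) * qFact q (b - d + k + z) * qFact q (2 * d - z) * (qFact q z)⁻¹ *
        (qFact q (c + d - f - z))⁻¹ * (qFact q (b + d - k - z))⁻¹ *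
        ((qFact q (k - d + f + z - j))⁻¹ * (qFact q (k - d + f + z + j + 1))⁻¹)) := by
  obtain ⟨δ, hδ⟩ := hj
  rw [mul_sum]
  refine sum_shift (δ := δ) ?_ ?_ ?_
  · intro m n hmn
    have hm : (m : ℝ) = n + (k - d + f - j) := by rw [hδ]; exact_mod_cast hmn
    have hs : (-1 : ℝ) ^ m = sgn (k - d + f - j) * (-1) ^ n := by
      rw [← sgn_natCast, ← sgn_natCast, hm, add_comm, sgn_add ⟨δ, hδ⟩ (isNat_natCast n).isInt]
    rw [hs, hm, show c + j - k + (n + (k - d + f - j)) = c - d + f + n by ring,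
      show b + j - f + (n + (k - d + f - j)) = b - d + k + n by ring,
      show k + f + d - j - (n + (k - d + f - j)) = 2 * d - n by ring,
      show n + (k - d + f - j) = k - d + f + n - j by ring,
      show k + c - j - (k - d + f + n - j) = c + d - f - n by ring,
      show b + f - j - (k - d + f + n - j) = b + d - k - n by ring,
      show d + j - k - f + (k - d + f + n - j) = n by ring,
      show 2 * j + (k - d + f + n - j) + 1 = k - d + f + n + j + 1 by ring]
    ring
  · intro m hm
    have h1 : 0 ≤ (m : ℝ) - (k - d + f - j) := by
      by_contra h
      refine hm ?_
      rw [qFact_inv_of_neg q (show d + j - k - f + (m : ℝ) < 0 by linarith)]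
      simp only [mul_zero, zero_mul]
    have h2 : (m : ℝ) - (k - d + f - j) < N := by
      by_contra h
      refine hm ?_
      rw [qFact_inv_of_neg q (show b + f - j - (m : ℝ) < 0 by linarith)]
      simp only [mul_zero, zero_mul]
    rw [hδ] at h1 h2
    exact ⟨by exact_mod_cast h1, by exact_mod_cast h2⟩
  · intro n hn
    have h1 : 0 ≤ (n : ℝ) + (k - d + f - j) := by
      by_contra h
      refine hn ?_
      rw [qFact_inv_of_neg q (show k - d + f + n - j < 0 by linarith)]
      simp only [mul_zero, zero_mul]
    have h2 : (n : ℝ) + (k - d + f - j) < L := by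
      by_contra h
      refine hn ?_
      rw [qFact_inv_of_neg q (show b + d - k - n < 0 by linarith)]
      simp only [mul_zero, zero_mul]
    rw [hδ] at h1 h2
    exact ⟨by exact_mod_cast h1, by exact_mod_cast h2⟩

/-- The inner sum over `z` vanishes beyond the range of the triangle conditions. -/
theorem sum_eq_zero_of_beyond (hq : 0 < q) {a b e c d f h k g : ℝ} {A B E C D F H K : ℤ}
    (S : Spins a b e c d f h k g A B E C D F H K) {n x : ℕ} (hn : b + d - k = n)
    (hx : g + k - h - x < 0) (hx' : 0 ≤ a + c - h - x) :
    ∑ z ∈ range (n + 1), (-1) ^ z * (qFact q (2 * d - z) * qFact q (b - d + k + z) * (qFact q z)⁻¹ *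
      (qFact q (b + d - k - z))⁻¹ * qFact q (c - d + f + z) * (qFact q (c + d - f - z))⁻¹ *
      (qFact q (a + k - d - e + z))⁻¹ * (qFact q (h + f - a - d + z + x))⁻¹) *
      q ^ (-((k - d + f + z) * (g + k - h - x + 1) - (a + k - h - x) * (g - a))) = 0 := by
  obtain ⟨a2, b2, e2, c2, d2, f2, h2, k2, g_eq, abe, cdf, ach, bdk, hkg⟩ := S
  have g2 : 2 * g = ((E + F : ℤ) : ℝ) := by push_cast; linarith
  -- Three quotients of factorials are Pochhammer symbols of lengths r, s, t with r + s + t = n + (g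
  -- + k - h - x). The negative bracket makes the number of factors smaller than the order n.
  obtain ⟨r, hr⟩ : IsNat (b + e - a) := isNat_of_half (m := B + E - A) (by push_cast; linarith) (by omega) (by omega)
  obtain ⟨t, ht⟩ : IsNat (d + f - c) := isNat_of_half (m := D + F - C) (by push_cast; linarith) (by omega) (by omega)
  obtain ⟨s, hs⟩ : IsNat (a + c - h - x) := IsInt.isNat (isInt_of_half (m := A + C - H - 2 * x) (by push_cast; linarith) (by omega)) hx'
  have hlt : r + s + t < n := by
    have : ((r + s + t : ℕ) : ℝ) < n := by push_cast; linarith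
    exact_mod_cast this
  have hpow : ∀ z : ℕ, q ^ (-((k - d + f + z) * (g + k - h - x + 1) - (a + k - h - x) * (g - a))) =
      q ^ (-((k - d + f) * (g + k - h - x + 1) - (a + k - h - x) * (g - a))) *
        q ^ ((z : ℝ) * (n - 1 - (r + s + t))) := by
    intro z
    rw [← Real.rpow_add hq]; congr 1
    rw [← hn, ← hr, ← hs, ← ht, g_eq]; ring
  -- The third parameter f - c - d - t results from reversing [2d-z]!/[c+d-f-z]!, in which z enters
  -- with a minus sign.
  have hzero := sum_qPoch_eq_zero hq (a + k - d - e + 1) (h + f - a - d + x + 1) (f - c - d - t) hlt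
  have hnF := (qFact_natCast_pos hq n).ne'
  calc _ = ∑ z ∈ range (n + 1), (q ^ (-((k - d + f) * (g + k - h - x + 1) - (a + k - h - x) * (g - a))) *
        ((qFact q n)⁻¹ * (-1) ^ t)) * (qBin q n z * ((-1) ^ z * q ^ ((z : ℝ) * (n - 1 - (r + s + t))) *
        (qPoch q (a + k - d - e + 1 + z) r * qPoch q (h + f - a - d + x + 1 + z) s *
          qPoch q (f - c - d - t + z) t))) := by
        refine sum_congr rfl fun z hz => ?_
        have hz := Nat.lt_succ_iff.1 (mem_range.1 hz)
        have hz' : (z : ℝ) ≤ n := by exact_mod_cast hz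
        have e1 := qFact_mul_inv_eq_qPoch hq (C := a + k - d - e + z) (n := r) (by
          rw [← hr, show a + k - d - e + z + (b + e - a) = b + k - d + z by ring]
          exact (isNat_of_half (m := B + K - D) (by push_cast; linarith) (by omega) (by omega)).add (isNat_natCast z))
        have e2 := qFact_mul_inv_eq_qPoch hq (C := h + f - a - d + z + x) (n := s) (by
          rw [← hs, show h + f - a - d + z + x + (a + c - h - x) = c + f - d + z by ring]
          exact (isNat_of_half (m := C + F - D) (by push_cast; linarith) (by omega) (by omega)).add (isNat_natCast z))
        have e3 := qFact_mul_inv_eq_qPoch hq (C := c + d - f - z) (n := t) (by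
          rw [← ht, show c + d - f - z + (d + f - c) = (b + d - k - z) + (d + k - b) by ring, hn]
          refine IsNat.add ?_ (isNat_of_half (m := D + K - B) (by push_cast; linarith) (by omega) (by omega))
          exact ((isNat_natCast n).isInt.sub (isNat_natCast z).isInt).isNat (by linarith))
        rw [← hr, show a + k - d - e + z + (b + e - a) = b - d + k + z by ring,
          show a + k - d - e + (z : ℝ) + 1 = a + k - d - e + 1 + z by ring] at e1
        rw [← hs, show h + f - a - d + z + x + (a + c - h - x) = c - d + f + z by ring,
          show h + f - a - d + (z : ℝ) + x + 1 = h + f - a - d + x + 1 + z by ring] at e2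
        rw [qPoch_reverse, show 1 - (c + d - f - z + 1) - t = f - c - d - t + (z : ℝ) by ring,
          ← ht, show c + d - f - z + (d + f - c) = 2 * d - z by ring, ht] at e3
        have e4 : qPoch q (f - c - d - t + z) t =
            (-1) ^ t * (qFact q (2 * d - z) * (qFact q (c + d - f - z))⁻¹) := by
          rw [e3, ← mul_assoc, neg_one_pow_mul_self, one_mul]
        rw [hpow, ← e1, ← e2, e4, hn, qBin, div_eq_mul_inv, mul_inv]
        have e5 := neg_one_pow_mul_self t
        have e6 := inv_mul_cancel₀ hnF
        generalize (qFact q n)⁻¹ = u at *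
        generalize qFact q n = u' at *
        generalize (-1 : ℝ) ^ t = v at *
        generalize q ^ (-((k - d + f) * (g + k - h - x + 1) - (a + k - h - x) * (g - a))) = w at *
        generalize q ^ ((z : ℝ) * (n - 1 - (r + s + t))) = w' at *
        generalize (qFact q ((n : ℝ) - z))⁻¹ = w'' at *
        generalize (qFact q (z : ℝ))⁻¹ = y at *
        linear_combination (-((-1) ^ z * y * w'' * w * w' * qFact q (2 * d - z) *
          (qFact q (c + d - f - z))⁻¹ * qFact q (b - d + k + z) * (qFact q (a + k - d - e + z))⁻¹ *
          qFact q (c - d + f + z) * (qFact q (h + f - a - d + z + x))⁻¹)) * (e5 * (u * u') + e6)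
    _ = 0 := by rw [← mul_sum, hzero, mul_zero]

/-- The shift in `sixSum_eq_shift` leaves 1/([A-j]! [A+j+1]!) with A = k - d + f + z as the only
j-dependence of the second sum. The first sum contributes the pair with X = a + k - h - x and the
stretched coefficient the pair with Y = g - a, so `sum_spin` applies. -/
theorem nineJ_eq_of_spin (hq : 0 < q) {a b e c d f h k g : ℝ} {A B E C D F H K : ℤ}
    (S : Spins a b e c d f h k g A B E C D F H K)
    (habe : IsTriad a b e) (hcdf : IsTriad c d f) (hhkg : IsTriad h k g)
    (hach : IsTriad a c h) (hbdk : IsTriad b d k) {M n : ℕ} (hM : a + c - h < M) (hn : b + d - k = n) :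
    nineJ q a b e c d f h k g = triProd q a b e c d f h k g * sgn (b + d - k) *
      q ^ (zz d + zz e + zz h) *
      (qFact q (a + c + h + 1) * qFact q (k + g + h + 1) * (qFact q (c + h - a))⁻¹ *
        (qFact q (g + h - k))⁻¹ * (qFact q (c + f - d))⁻¹ * (qFact q (k + b - d))⁻¹ *
        (qFact q (f + d - c))⁻¹ * (qFact q (k + d - b))⁻¹ * (qFact q (a + e - b))⁻¹ *
        (qFact q (b + e - a))⁻¹) *
      ∑ x ∈ range M, (-1) ^ x * (qFact q (c + h - a + x) * qFact q (g + h - k + x) * (qFact q x)⁻¹ *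
          (qFact q (a + c - h - x))⁻¹ * (qFact q (2 * h + x + 1))⁻¹) *
        ∑ z ∈ range (n + 1), (-1) ^ z * (qFact q (2 * d - z) * qFact q (b - d + k + z) *
          (qFact q z)⁻¹ * (qFact q (b + d - k - z))⁻¹ * qFact q (c - d + f + z) *
          (qFact q (c + d - f - z))⁻¹ * (qFact q (a + k - d - e + z))⁻¹ *
          (qFact q (h + f - a - d + z + x))⁻¹) *
        q ^ (-((k - d + f + z) * (g + k - h - x + 1) - (a + k - h - x) * (g - a))) := by
  have S' := S
  obtain ⟨a2, b2, e2, c2, d2, f2, h2, k2, g_eq, abe, cdf, ach, bdk, hkg⟩ := S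
  have g2 : 2 * g = ((E + F : ℤ) : ℝ) := by push_cast; linarith
  obtain ⟨p, hp, hpar⟩ : ∃ p : ℕ, p < 2 ∧ ((p : ℤ) + C + K) % 2 = 0 :=
    ⟨((C + K) % 2).toNat, by omega, by omega⟩
  obtain ⟨L, hL⟩ := exists_nat_gt (max (a + g - p / 2) (k - d + f + n))
  obtain ⟨hL, hL'⟩ := max_lt_iff.1 hL
  have hp0 : (0 : ℝ) ≤ p := by positivity
  have hp1 : (p : ℝ) / 2 < 1 := by
    have : (p : ℝ) < 2 := by exact_mod_cast hp
    linarith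
  have hN : b + d - k < (n + 1 : ℕ) := by push_cast; linarith
  rw [nineJ_eq_sum hq S' habe hcdf hhkg hach hbdk hp hpar hL]
  -- Because j ≥ 0, this one length covers both the original and the shifted range for all j.
  obtain ⟨L', hL''⟩ := exists_nat_gt (max (k + c) (k - d + f + (n + 1 : ℕ)))
  obtain ⟨hL1, hL2⟩ := max_lt_iff.1 hL''
  have hterm : ∀ i < L, q ^ (-(((p : ℝ) / 2 + i) * ((p : ℝ) / 2 + i + 1))) *
        qNum q (2 * ((p : ℝ) / 2 + i) + 1) * nineTerm q a b e c d f h k g ((p : ℝ) / 2 + i) =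
      (sgn p * sgn (b + d - k) * (qFact q (a + c + h + 1) * qFact q (k + g + h + 1) * (qFact q (c + h - a))⁻¹ *
        (qFact q (g + h - k))⁻¹ * (qFact q (c + f - d))⁻¹ * (qFact q (k + b - d))⁻¹ *
        (qFact q (f + d - c))⁻¹ * (qFact q (k + d - b))⁻¹ * (qFact q (a + e - b))⁻¹ *
        (qFact q (b + e - a))⁻¹)) * ((q ^ (-(((p : ℝ) / 2 + i) * ((p : ℝ) / 2 + i + 1))) *
        qNum q (2 * ((p : ℝ) / 2 + i) + 1)) * (sixSum q a g (p / 2 + i) k c h M *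
          (sgn (k - d + f - (p / 2 + i)) * sixSum q k b d f c (p / 2 + i) L') *
        (qFact q (p / 2 + i + (g - a)) * (qFact q (p / 2 + i - (g - a)))⁻¹))) := by
    intro i _
    have hi0 : (0 : ℝ) ≤ i := by positivity
    rw [nineTerm_eq_of_spin hq S' (j := p / 2 + i) (J := p + 2 * i) (N := L') (by push_cast; ring) (by omega)
      (by omega) hM (by linarith)]
    have i5 : IsInt (k - d + f - ((p : ℝ) / 2 + i)) := isInt_of_half (m := K - D + F - (p + 2 * i)) (by push_cast; linarith) (by omega)
    have hs : sgn (a + c + g + k) * sgn (k + b + f + c) * sgn (a + g + ((p : ℝ) / 2 + i)) *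
        sgn (k - d + f - ((p : ℝ) / 2 + i)) = sgn p * sgn (b + d - k) := by
      have i1 : IsInt (a + c + g + k) := isInt_of_half (m := C + K + A + (E + F)) (by push_cast; linarith) (by omega)
      have i2 : IsInt (k + b + f + c) := isInt_of_half (m := K + B + F + C) (by push_cast; linarith) (by omega)
      have i3 : IsInt (a + g + ((p : ℝ) / 2 + i)) := isInt_of_half (m := A + (E + F) + (p + 2 * i)) (by push_cast; linarith) (by omega)
      have i4 : IsInt (b + d - k) := isInt_of_half (m := B + D - K) (by push_cast; linarith) (by omega)
      rw [← sgn_add i1 i2, ← sgn_add (i1.add i2) i3, ← sgn_add ((i1.add i2).add i3) i5,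
        ← sgn_add (isNat_natCast p).isInt i4]
      obtain ⟨m, hm⟩ : ∃ m : ℤ, -p + A + C + E + 2 * F + 2 * K - D = 2 * m := ⟨(-p + A + C + E + 2 * F + 2 * K - D) / 2, by omega⟩
      refine sgn_eq_of_half (n := m) (((i1.add i2).add i3).add i5) ?_
      have : ((-p + A + C + E + 2 * F + 2 * K - D : ℤ) : ℝ) = ((2 * m : ℤ) : ℝ) := by rw [hm]
      push_cast at this
      linarith
    have hs' : sgn (a + c + g + k) * sgn (k + b + f + c) * sgn (a + g + ((p : ℝ) / 2 + i)) =
        sgn p * sgn (b + d - k) * sgn (k - d + f - ((p : ℝ) / 2 + i)) := by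
      rw [← hs, mul_assoc _ (sgn (k - d + f - _)), sgn_mul_self, mul_one]
    rw [hs']; ring
  rw [sum_congr rfl fun i hi => hterm i (mem_range.1 hi), ← mul_sum]
  rw [sum_mul_sum_spin (M := M) (N := n + 1)
    (u := fun x => (-1) ^ x * (qFact q (c + h - a + x) * qFact q (g + h - k + x) * (qFact q x)⁻¹ *
          (qFact q (a + c - h - x))⁻¹ * (qFact q (g + k - h - x))⁻¹ * (qFact q (2 * h + x + 1))⁻¹))
    (v := fun z => (-1) ^ z * (qFact q (c - d + f + z) * qFact q (b - d + k + z) *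
      qFact q (2 * d - z) * (qFact q z)⁻¹ * (qFact q (c + d - f - z))⁻¹ * (qFact q (b + d - k - z))⁻¹))
    (φ := fun i x => qFact q (p / 2 + i + (a + k - h - x)) * (qFact q (p / 2 + i - (a + k - h - x)))⁻¹)
    (ψ := fun i z => (qFact q (k - d + f + z - (p / 2 + i)))⁻¹ * (qFact q (k - d + f + z + (p / 2 + i) + 1))⁻¹)
    -- The factor [g+k-h-x]! from `sum_spin` meets its inverse from the first sum. Their product is
    -- 1, or 0 when g + k - h - x is negative.
    (r := fun x z => (-1) ^ x * (qFact q (c + h - a + x) * qFact q (g + h - k + x) * (qFact q x)⁻¹ *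
          (qFact q (a + c - h - x))⁻¹ * (qFact q (2 * h + x + 1))⁻¹) *
          (qFact q (g + k - h - x) * (qFact q (g + k - h - x))⁻¹) *
        ((-1) ^ z * (qFact q (2 * d - z) * qFact q (b - d + k + z) *
          (qFact q z)⁻¹ * (qFact q (b + d - k - z))⁻¹ * qFact q (c - d + f + z) *
          (qFact q (c + d - f - z))⁻¹ * (qFact q (a + k - d - e + z))⁻¹ *
          (qFact q (h + f - a - d + z + x))⁻¹) *
        q ^ (-((k - d + f + z) * (g + k - h - x + 1) - (a + k - h - x) * (g - a)))))]
  · have hx : ∀ x ∈ range M, ∑ z ∈ range (n + 1), (-1) ^ x * (qFact q (c + h - a + x) * qFact q (g + h - k + x) * (qFact q x)⁻¹ *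
          (qFact q (a + c - h - x))⁻¹ * (qFact q (2 * h + x + 1))⁻¹) *
          (qFact q (g + k - h - x) * (qFact q (g + k - h - x))⁻¹) *
        ((-1) ^ z * (qFact q (2 * d - z) * qFact q (b - d + k + z) *
          (qFact q z)⁻¹ * (qFact q (b + d - k - z))⁻¹ * qFact q (c - d + f + z) *
          (qFact q (c + d - f - z))⁻¹ * (qFact q (a + k - d - e + z))⁻¹ *
          (qFact q (h + f - a - d + z + x))⁻¹) *
        q ^ (-((k - d + f + z) * (g + k - h - x + 1) - (a + k - h - x) * (g - a)))) =
        (-1) ^ x * (qFact q (c + h - a + x) * qFact q (g + h - k + x) * (qFact q x)⁻¹ *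
          (qFact q (a + c - h - x))⁻¹ * (qFact q (2 * h + x + 1))⁻¹) *
        ∑ z ∈ range (n + 1), (-1) ^ z * (qFact q (2 * d - z) * qFact q (b - d + k + z) *
          (qFact q z)⁻¹ * (qFact q (b + d - k - z))⁻¹ * qFact q (c - d + f + z) *
          (qFact q (c + d - f - z))⁻¹ * (qFact q (a + k - d - e + z))⁻¹ *
          (qFact q (h + f - a - d + z + x))⁻¹) *
        q ^ (-((k - d + f + z) * (g + k - h - x + 1) - (a + k - h - x) * (g - a))) := by
      intro x _
      rw [← mul_sum]
      have i8 : IsInt (g + k - h - x) := isInt_of_half (m := E + F + K - H - 2 * x) (by push_cast; linarith) (by omega)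
      rcases i8.neg_or_isNat with h8 | h8
      -- Where that product is 0 it may still be dropped: either 1/[a+c-h-x]! is 0, or the z-sum
      -- vanishes as a q-difference of too high an order. The range of x thus becomes the full one
      -- required by `sum_flip`.
      · rcases lt_or_ge (a + c - h - x) 0 with h9 | h9
        · rw [qFact_inv_of_neg q h9]; simp only [mul_zero, zero_mul]
        · rw [sum_eq_zero_of_beyond hq S' hn h8 h9, mul_zero, mul_zero]
      · rw [mul_inv_cancel₀ (qFact_ne_zero hq h8), mul_one]
    rw [sum_congr rfl hx]
    rw [show ∀ t u r w κ X : ℝ, t * u * r * (u * w * κ * X) = (u * u) * (t * w * r * κ * X) by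
      intros; ring, sgn_mul_self, one_mul]
  · intro i _
    refine sum_congr rfl fun x _ => ?_
    rw [show a + k + ((p : ℝ) / 2 + i) - h - x = p / 2 + i + (a + k - h - x) by ring,
      show (p : ℝ) / 2 + i + h - a - k + x = p / 2 + i - (a + k - h - x) by ring]
    ring
  · intro i _
    have hi0 : (0 : ℝ) ≤ i := by positivity
    have i5 : IsInt (k - d + f - ((p : ℝ) / 2 + i)) := isInt_of_half (m := K - D + F - (p + 2 * i)) (by push_cast; linarith) (by omega)
    rw [sixSum_eq_shift i5 hN (by linarith), ← mul_assoc, sgn_mul_self, one_mul]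
    exact sum_congr rfl fun z _ => by ring
  · intro x _ z hz
    have hz' : (z : ℝ) ≤ n := by exact_mod_cast Nat.lt_succ_iff.1 hz
    have i8 : IsInt (g + k - h - x) := isInt_of_half (m := E + F + K - H - 2 * x) (by push_cast; linarith) (by omega)
    rcases i8.neg_or_isNat with h8 | h8
    · rw [qFact_inv_of_neg q h8]; simp only [mul_zero, zero_mul]
    have hsum := sum_spin hq (J₀ := p / 2) (X := a + k - h - x) (Y := g - a) (A := k - d + f + z) (M := L) hp1
      (isInt_of_half (m := A + K - H - 2 * x - p) (by push_cast; linarith) (by omega))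
      (isInt_of_half (m := E + F - A - p) (by push_cast; linarith) (by omega))
      (isInt_of_half (m := K - D + F + 2 * z - p) (by push_cast; linarith) (by omega))
      (by rwa [show a + k - h - x + (g - a) = g + k - h - x by ring])
      (by linarith)
    rw [show a + k - h - x + (g - a) = g + k - h - x by ring,
      show k - d + f + z - (a + k - h - x) = h + f - a - d + z + x by ring,
      show k - d + f + z - (g - a) = a + k - d - e + z by rw [g_eq]; ring] at hsum
    have hsum' : ∑ i ∈ range L, q ^ (-(((p : ℝ) / 2 + i) * ((p : ℝ) / 2 + i + 1))) *
        qNum q (2 * ((p : ℝ) / 2 + i) + 1) * (qFact q (p / 2 + i + (a + k - h - x)) *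
        (qFact q (p / 2 + i - (a + k - h - x)))⁻¹ * ((qFact q (k - d + f + z - (p / 2 + i)))⁻¹ *
        (qFact q (k - d + f + z + (p / 2 + i) + 1))⁻¹) * (qFact q (p / 2 + i + (g - a)) *
        (qFact q (p / 2 + i - (g - a)))⁻¹)) = _ := (sum_congr rfl fun i _ => by ring).trans hsum
    rw [hsum']
    ring

/-! ### Transformations of single sums, in factorial form. -/

/-- Four-term flip of a sum with two increasing numerator factorials. -/
theorem sum_flip (hq : 0 < q) {U₁ U₂ C₁ C₂ W C' V σ τ : ℝ} {n : ℕ} (hU₁ : IsNat U₁) (hU₂ : IsNat U₂)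
    (hC₁ : IsNat (C₁ + n)) (hC₂ : IsNat (C₂ + n)) (hW : IsInt W) (hC' : IsInt (C' + n))
    (hV : IsNat (V - n)) (eW : W = C₁ + C₂ + n - U₁ - U₂ - 1) (eC' : C' = U₁ - C₁ - n)
    (eV : V = C₂ + n - U₁ - 1) (hσ : σ = W) (hτ : τ = -(U₂ + 1)) :
    (qFact q W)⁻¹ * (qFact q (C' + n))⁻¹ * ∑ x ∈ range (n + 1), (-1) ^ x * (qFact q (U₁ + x) *
      qFact q (U₂ + x) * (qFact q (C₁ + x))⁻¹ * (qFact q (C₂ + x))⁻¹ * (qFact q x)⁻¹ *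
        (qFact q ((n : ℝ) - x))⁻¹) * q ^ ((x : ℝ) * σ) =
    (-1) ^ n * (qFact q U₂ * (qFact q (C₁ + n))⁻¹ * (qFact q (C₂ + n))⁻¹ * (qFact q (V - n))⁻¹) *
    ∑ x ∈ range (n + 1), (-1) ^ x * (qFact q (U₁ + x) * (qFact q (W - x))⁻¹ * (qFact q (C' + x))⁻¹ *
      qFact q (V - x) * (qFact q x)⁻¹ * (qFact q ((n : ℝ) - x))⁻¹) * q ^ ((x : ℝ) * τ) := by
  rcases hW.neg_or_isNat with h | hW
  · rw [qFact_inv_of_neg q h, zero_mul, zero_mul, sum_eq_zero, mul_zero]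
    intro x _
    rw [qFact_inv_of_neg q (show W - (x : ℝ) < 0 by linarith [(isNat_natCast x).nonneg])]
    simp only [mul_zero, zero_mul]
  rcases hC'.neg_or_isNat with h | hC'
  · rw [qFact_inv_of_neg q h, mul_zero, zero_mul, sum_eq_zero, mul_zero]
    intro x hx
    have hx : (x : ℝ) ≤ n := by exact_mod_cast Nat.lt_succ_iff.1 (mem_range.1 hx)
    rw [qFact_inv_of_neg q (show C' + (x : ℝ) < 0 by linarith)]
    simp only [mul_zero, zero_mul]
  rw [sum_eq_qHyp_inv hq (qFact_add_upper q hU₁ n) (qFact_add_upper q hU₂ n) (qFact_add_lower hq hC₁)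
    (qFact_add_lower hq hC₂) (by norm_num) (by rw [hσ, eW]; ring),
    sum_eq_qHyp_inv hq (qFact_add_upper q hU₁ n) (qFact_sub_upper hq hW n) (qFact_add_lower hq hC')
    (qFact_sub_lower q hV) (by norm_num) (by rw [hτ, eW, eC', eV]; ring), qHyp_comm_left,
    qHyp_flip (inv_pos.2 hq)]
  rw [show U₂ + 1 + (U₁ + 1) - (C₁ + 1) - (C₂ + 1) - (n : ℝ) + 1 = -W by rw [eW]; ring,
    show 1 + (U₁ + 1) - (C₁ + 1) - (n : ℝ) = C' + 1 by rw [eC']; ring,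
    show 1 + (U₁ + 1) - (C₂ + 1) - (n : ℝ) = -V by rw [eV]; ring]
  have h1 := mul_inv_cancel₀ (qFact_ne_zero hq hV)
  have h2 := neg_one_pow_mul_self n
  generalize qFact q (V - n) = v at *
  generalize (-1 : ℝ) ^ n = u at *
  generalize qHyp _ _ _ _ _ _ = X
  linear_combination (-((qFact q W)⁻¹ * (qFact q (C' + n))⁻¹ * (qFact q U₁ * qFact q U₂ *
    (qFact q (C₁ + n))⁻¹ * (qFact q (C₂ + n))⁻¹ * (qFact q n)⁻¹ * X))) * (h1 * (u * u) + h2)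

/-- `qHyp_transform` in base q⁻¹. It removes all index-dependent factorials from the numerator,
which is the shape of van der Waerden's formula for Clebsch–Gordan coefficients. -/
theorem sum_transform_van_der_waerden (hq : 0 < q) {U W C V W' C' σ τ : ℝ} {n : ℕ} (hU : IsNat U)
    (hW : IsNat W) (hC : IsNat (C + n)) (hV : IsNat (V - n)) (hW' : IsNat W') (hC' : IsNat (C' + n))
    (eW' : W' = U - C) (eC' : C' = V - W - n) (hσ : σ = W + C - U - V + n - 1) (hτ : τ = -(U + V + 1)) :
    ∑ x ∈ range (n + 1), (-1) ^ x * (qFact q (U + x) * (qFact q (W - x))⁻¹ * (qFact q (C + x))⁻¹ *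
      qFact q (V - x) * (qFact q x)⁻¹ * (qFact q ((n : ℝ) - x))⁻¹) * q ^ ((x : ℝ) * σ) =
    q ^ (W * n) * (qFact q U * qFact q (V - n) * qFact q W' * qFact q (C' + n)) *
    ∑ x ∈ range (n + 1), (-1) ^ x * ((qFact q (W - x))⁻¹ * (qFact q (W' - x))⁻¹ * (qFact q (C + x))⁻¹ *
      (qFact q (C' + x))⁻¹ * (qFact q x)⁻¹ * (qFact q ((n : ℝ) - x))⁻¹) * q ^ ((x : ℝ) * τ) := by
  rw [sum_eq_qHyp_inv hq (qFact_add_upper q hU n) (qFact_sub_upper hq hW n) (qFact_add_lower hq hC)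
    (qFact_sub_lower q hV) (by norm_num) (by rw [hσ]; ring),
    sum_eq_qHyp hq (qFact_sub_upper hq hW n) (qFact_sub_upper hq hW' n) (qFact_add_lower hq hC)
    (qFact_add_lower hq hC') (by norm_num) (by rw [hτ, eW', eC']; ring),
    qHyp_transform (inv_pos.2 hq), inv_inv, inv_rpow_eq hq]
  rw [show C + 1 - (U + 1) = -W' by rw [eW']; ring,
    show -W - -V - (n : ℝ) + 1 = C' + 1 by rw [eC']; ring, show -(-W * (n : ℝ)) = W * n by ring]
  have h1 := mul_inv_cancel₀ (qFact_ne_zero hq hW')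
  have h3 := mul_inv_cancel₀ (qFact_ne_zero hq hC')
  have h2 := neg_one_pow_mul_self n
  generalize qFact q W' = v at *
  generalize qFact q (C' + n) = w at *
  generalize (-1 : ℝ) ^ n = u at *
  generalize qHyp _ _ _ _ _ _ = X
  linear_combination (qFact q U * (qFact q W)⁻¹ * (qFact q (C + n))⁻¹ * qFact q (V - n) *
    q ^ (W * n) * (qFact q n)⁻¹ * X) * (h2 - h1 * (w * w⁻¹) - h3)

/-- `qHyp_transform` with all four parameters of increasing type on both sides. -/
theorem sum_transform_add (hq : 0 < q) {U₁ U₂ C₁ C₂ U₃ C₃ σ τ : ℝ} {n : ℕ} (hU₁ : IsNat U₁)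
    (hU₂ : IsNat U₂) (hC₁ : IsNat (C₁ + n)) (hC₂ : IsNat (C₂ + n)) (hU₃ : IsNat U₃)
    (hC₃ : IsNat (C₃ + n)) (eU₃ : U₃ = C₂ - U₁ - 1) (eC₃ : C₃ = U₂ - C₁ - n)
    (hσ : σ = U₁ + U₂ - C₁ - C₂ - n + 1) (hτ : τ = U₁ - C₁) :
    (qFact q U₁)⁻¹ * ∑ x ∈ range (n + 1), (-1) ^ x * (qFact q (U₁ + x) * qFact q (U₂ + x) *
      (qFact q (C₁ + x))⁻¹ * (qFact q (C₂ + x))⁻¹ * (qFact q x)⁻¹ * (qFact q ((n : ℝ) - x))⁻¹) *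
        q ^ ((x : ℝ) * σ) =
    (-1) ^ n * q ^ ((U₂ + 1) * n) * (qFact q (C₃ + n) * (qFact q U₃)⁻¹ * (qFact q (C₁ + n))⁻¹) *
    ∑ x ∈ range (n + 1), (-1) ^ x * (qFact q (U₂ + x) * qFact q (U₃ + x) * (qFact q (C₂ + x))⁻¹ *
      (qFact q (C₃ + x))⁻¹ * (qFact q x)⁻¹ * (qFact q ((n : ℝ) - x))⁻¹) * q ^ ((x : ℝ) * τ) := by
  rw [sum_eq_qHyp hq (qFact_add_upper q hU₁ n) (qFact_add_upper q hU₂ n) (qFact_add_lower hq hC₁)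
    (qFact_add_lower hq hC₂) (by norm_num) (by rw [hσ]; ring),
    sum_eq_qHyp_inv hq (qFact_add_upper q hU₂ n) (qFact_add_upper q hU₃ n) (qFact_add_lower hq hC₂)
    (qFact_add_lower hq hC₃) (by norm_num) (by rw [hτ, eU₃, eC₃]; ring), qHyp_comm_right,
    qHyp_transform hq]
  rw [show C₂ + 1 - (U₁ + 1) = U₃ + 1 by rw [eU₃]; ring,
    show U₂ + 1 - (C₁ + 1) - (n : ℝ) + 1 = C₃ + 1 by rw [eC₃]; ring]
  have h1 := inv_mul_cancel₀ (qFact_ne_zero hq hU₁)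
  have h3 := inv_mul_cancel₀ (qFact_ne_zero hq hU₃)
  have h2 := mul_inv_cancel₀ (qFact_ne_zero hq hC₃)
  generalize qFact q U₁ = u at *
  generalize qFact q U₃ = v at *
  generalize qFact q (C₃ + n) = w at *
  generalize qHyp _ _ _ _ _ _ = X
  linear_combination (qFact q U₂ * (qFact q (C₁ + n))⁻¹ * (qFact q (C₂ + n))⁻¹ * (-1) ^ n *
    q ^ ((U₂ + 1) * n) * (qFact q n)⁻¹ * X) * (h1 - h3 * (w * w⁻¹) - h2)

/-- `qHyp_transform` in base q⁻¹, carrying two increasing numerator factorials into one increasing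
and one decreasing. -/
theorem sum_transform_inv (hq : 0 < q) {U₁ U₂ C₁ C₂ W V σ τ : ℝ} {n : ℕ} (hU₁ : IsNat U₁)
    (hU₂ : IsNat U₂) (hC₁ : IsNat (C₁ + n)) (hC₂ : IsNat (C₂ + n)) (hW : IsNat W)
    (hV : IsNat (V - n)) (eW : W = U₁ - C₁) (eV : V = C₂ + n - U₂ - 1)
    (hσ : σ = C₁ + C₂ + n - U₁ - U₂ - 1) (hτ : τ = C₂ - U₁) :
    ∑ x ∈ range (n + 1), (-1) ^ x * (qFact q (U₁ + x) * qFact q (U₂ + x) *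
      (qFact q (C₁ + x))⁻¹ * (qFact q (C₂ + x))⁻¹ * (qFact q x)⁻¹ * (qFact q ((n : ℝ) - x))⁻¹) *
        q ^ ((x : ℝ) * σ) =
    q ^ (-((U₂ + 1) * n)) * (qFact q U₁ * qFact q W * (qFact q (C₂ + n))⁻¹ * (qFact q (V - n))⁻¹) *
    ∑ x ∈ range (n + 1), (-1) ^ x * (qFact q (U₂ + x) * (qFact q (W - x))⁻¹ * (qFact q (C₁ + x))⁻¹ *
      qFact q (V - x) * (qFact q x)⁻¹ * (qFact q ((n : ℝ) - x))⁻¹) * q ^ ((x : ℝ) * τ) := by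
  rw [sum_eq_qHyp_inv hq (qFact_add_upper q hU₁ n) (qFact_add_upper q hU₂ n) (qFact_add_lower hq hC₁)
    (qFact_add_lower hq hC₂) (by norm_num) (by rw [hσ]; ring),
    sum_eq_qHyp hq (qFact_add_upper q hU₂ n) (qFact_sub_upper hq hW n) (qFact_add_lower hq hC₁)
    (qFact_sub_lower q hV) (by norm_num) (by rw [hτ, eW, eV]; ring),
    qHyp_transform (inv_pos.2 hq), inv_inv, inv_rpow_eq hq]
  rw [show C₁ + 1 - (U₁ + 1) = -W by rw [eW]; ring,
    show U₂ + 1 - (C₂ + 1) - (n : ℝ) + 1 = -V by rw [eV]; ring]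
  have h1 := mul_inv_cancel₀ (qFact_ne_zero hq hW)
  have h3 := mul_inv_cancel₀ (qFact_ne_zero hq hV)
  generalize qFact q W = v at *
  generalize qFact q (V - n) = w at *
  generalize qHyp _ _ _ _ _ _ = X
  linear_combination (-(qFact q U₁ * qFact q U₂ * (qFact q (C₁ + n))⁻¹ * (qFact q (C₂ + n))⁻¹ *
    (-1) ^ n * q ^ (-((U₂ + 1) * n)) * (qFact q n)⁻¹ * X)) * (h1 * (w * w⁻¹) + h3)

/-- `qHyp_transform` after interchanging upper and lower parameters; one increasing and one
decreasing numerator factorial are kept. -/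
theorem sum_transform_mixed (hq : 0 < q) {U W V C W' C' σ τ : ℝ} {n : ℕ} (hU : IsNat U)
    (hW : IsNat W) (hV : IsNat (V - n)) (hC : IsNat (C + n)) (hW' : IsNat W') (hC' : IsNat (C' + n))
    (eW' : W' = V - W) (eC' : C' = U - C - n) (hσ : σ = U + V - W - C - n + 1) (hτ : τ = -(W + C + 1)) :
    ∑ x ∈ range (n + 1), (-1) ^ x * (qFact q (U + x) * (qFact q (W - x))⁻¹ * (qFact q (C + x))⁻¹ *
      qFact q (V - x) * (qFact q x)⁻¹ * (qFact q ((n : ℝ) - x))⁻¹) * q ^ ((x : ℝ) * σ) =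
    (-1) ^ n * q ^ ((U + 1) * n) * ((qFact q W)⁻¹ * qFact q W' * (qFact q (C + n))⁻¹ *
      qFact q (C' + n)) *
    ∑ x ∈ range (n + 1), (-1) ^ x * (qFact q (U + x) * (qFact q (W' - x))⁻¹ * (qFact q (C' + x))⁻¹ *
      qFact q (V - x) * (qFact q x)⁻¹ * (qFact q ((n : ℝ) - x))⁻¹) * q ^ ((x : ℝ) * τ) := by
  rw [sum_eq_qHyp hq (qFact_add_upper q hU n) (qFact_sub_upper hq hW n) (qFact_add_lower hq hC)
    (qFact_sub_lower q hV) (by norm_num) (by rw [hσ]; ring),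
    sum_eq_qHyp_inv hq (qFact_add_upper q hU n) (qFact_sub_upper hq hW' n) (qFact_add_lower hq hC')
    (qFact_sub_lower q hV) (by norm_num) (by rw [hτ, eW', eC']; ring), qHyp_comm_left,
    qHyp_comm_right, qHyp_transform hq, qHyp_comm_right q⁻¹]
  rw [show -V - -W = -W' by rw [eW']; ring,
    show U + 1 - (C + 1) - (n : ℝ) + 1 = C' + 1 by rw [eC']; ring]
  have h1 := mul_inv_cancel₀ (qFact_ne_zero hq hW')
  have h3 := mul_inv_cancel₀ (qFact_ne_zero hq hC')
  generalize qFact q W' = v at *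
  generalize qFact q (C' + n) = w at *
  generalize qHyp _ _ _ _ _ _ = X
  linear_combination (-(qFact q U * (qFact q W)⁻¹ * (qFact q (C + n))⁻¹ * qFact q (V - n) *
    (-1) ^ n * (-1) ^ n * q ^ ((U + 1) * n) * (qFact q n)⁻¹ * X)) * (h1 * (w * w⁻¹) + h3)

/-! ### The symmetric double sum (stdK). -/

theorem nabla_inv (hq : 0 < q) {a b c : ℝ} (h : IsTriad a b c) : (nabla q a b c)⁻¹ =
    triDelta q a b c * ((qFact q (a + b - c))⁻¹ * (qFact q (a - b + c))⁻¹) := by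
  obtain ⟨h1, h2, h3, h4, h5⟩ := h.isNat
  have n1 := qFact_ne_zero hq h1
  have n2 := qFact_ne_zero hq h2
  have n3 := qFact_ne_zero hq h3
  have n5 := qFact_ne_zero hq h5
  have hs := triDelta_mul_self hq a b c
  have hp := (triDelta_pos hq h).ne'
  rw [nabla_eq hq h]
  refine inv_eq_of_mul_eq_one_right ?_
  rw [triSq] at hs
  generalize triDelta q a b c = t at *
  generalize qFact q (a + b - c) = x at *
  generalize qFact q (a - b + c) = y at *
  generalize qFact q (b + c - a) = z at *
  generalize qFact q (a + b + c + 1) = w at *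
  rw [show t * (w * z⁻¹) * (t * (x⁻¹ * y⁻¹)) = (t * t) * (w * z⁻¹ * x⁻¹ * y⁻¹) by ring, hs]
  field_simp

/-- For g = e + f the square of Δ[fge] is [2e]! [2f]! / [2g+1]!, so the root consists of the two
triangle coefficients of `triProd` that contain g. -/
theorem sqrt_stretched (hq : 0 < q) {h k g e f : ℝ} (hg : g = e + f) (he : IsNat (2 * e))
    (hf : IsNat (2 * f)) (hhkg : IsTriad h k g) :
    Real.sqrt (qFact q (2 * e) * qFact q (2 * f) * qFact q (h + k - g) * qFact q (g - h + k) *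
      qFact q (g + h - k) * qFact q (g + h + k + 1)) =
    triDelta q f g e * triDelta q k g h * qFact q (g + h + k + 1) * Real.sqrt (qFact q (2 * g + 1)) := by
  obtain ⟨h1, h2, h3, h4, h5⟩ := hhkg.isNat
  have n5 := qFact_ne_zero hq h5
  have nG : 0 < qFact q (2 * g + 1) := qFact_pos hq (by linarith [he.nonneg, hf.nonneg])
  have s1 := triDelta_mul_self hq f g e
  have s2 := triDelta_mul_self hq k g h
  rw [triSq, show f + g - e = 2 * f by rw [hg]; ring, show f - g + e = 0 by rw [hg]; ring,
    show g + e - f = 2 * e by rw [hg]; ring, show f + g + e + 1 = 2 * g + 1 by rw [hg]; ring,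
    qFact_zero] at s1
  rw [triSq, show k + g - h = g - h + k by ring, show k - g + h = h + k - g by ring,
    show k + g + h + 1 = g + h + k + 1 by ring] at s2
  rw [show h + k + g + 1 = g + h + k + 1 by ring] at n5
  have s3 := Real.mul_self_sqrt nG.le
  rw [Real.sqrt_eq_iff_mul_self_eq_of_pos]
  · rw [show ∀ x y z w : ℝ, x * y * z * w * (x * y * z * w) = (x * x) * (y * y) * (z * z) * (w * w) by
      intros; ring, s1, s2, s3]
    generalize qFact q (2 * g + 1) = G at *
    generalize qFact q (g + h + k + 1) = T at *
    field_simp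
  · refine mul_pos (mul_pos (mul_pos ?_ (triDelta_pos hq hhkg.perm₁₂.perm₂₃)) ?_) (Real.sqrt_pos.2 nG)
    · refine triDelta_pos hq ⟨?_, ?_, ?_⟩
      · obtain ⟨n, hn⟩ := he; exact ⟨n, by rw [← hn, hg]; ring⟩
      · exact ⟨0, by rw [hg]; push_cast; ring⟩
      · obtain ⟨n, hn⟩ := hf; exact ⟨n, by rw [← hn, hg]; ring⟩
    · exact qFact_pos hq (by rw [← show h + k + g + 1 = g + h + k + 1 by ring]; exact h5.nonneg)

/-- The factor relating the symmetric double sum to the coefficient. -/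
theorem exprK_eq (hq : 0 < q) {a b e c d f h k g : ℝ} {A B E C D F H K : ℤ}
    (S : Spins a b e c d f h k g A B E C D F H K)
    (habe : IsTriad a b e) (hcdf : IsTriad c d f) (hhkg : IsTriad h k g)
    (hach : IsTriad a c h) (hbdk : IsTriad b d k) :
    exprK q a b e c d f h k g = triProd q a b e c d f h k g * (qFact q (g + h + k + 1) *
      (qFact q (h + a - c))⁻¹ * (qFact q (h - a + c))⁻¹ * (qFact q (f + c - d))⁻¹ *
      (qFact q (f - c + d))⁻¹ * (qFact q (e + a - b))⁻¹ * (qFact q (e - a + b))⁻¹ *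
      (qFact q (k + b - d))⁻¹ * (qFact q (k - b + d))⁻¹) *
      q ^ ((b + d - k) * (a + b + f - h + k + 1) - (a + b - e) * (a + d + f - h) + 2 * a * f
        + (zz b + zz d + zz g + zz h)) * sumK q a b e c d f h k g := by
  have he : IsNat (2 * e) := by
    refine isNat_of_half (m := 2 * E) (by push_cast; linarith [S.e2]) (by omega) ?_
    have := S.abe; omega
  have hf : IsNat (2 * f) := by
    refine isNat_of_half (m := 2 * F) (by push_cast; linarith [S.f2]) (by omega) ?_
    have := S.cdf; omega
  have hG : 0 < Real.sqrt (qFact q (2 * g + 1)) :=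
    Real.sqrt_pos.2 (qFact_pos hq (by rw [S.g_eq]; linarith [he.nonneg, hf.nonneg]))
  have i1 := nabla_inv hq (IsTriad.perm₁₂ hach.perm₂₃)
  have i2 := nabla_inv hq (IsTriad.perm₁₂ hcdf.perm₂₃)
  have i3 := nabla_inv hq (IsTriad.perm₁₂ habe.perm₂₃)
  have i4 := nabla_inv hq (IsTriad.perm₁₂ hbdk.perm₂₃)
  rw [triDelta_perm₁₂ q a h c, triDelta_perm₂₃ q a c h] at i1
  rw [triDelta_perm₂₃ q f d c] at i2
  rw [triDelta_perm₁₂ q a e b, triDelta_perm₂₃ q a b e] at i3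
  rw [triDelta_perm₂₃ q k d b] at i4
  rw [exprK, sqrt_stretched hq S.g_eq he hf hhkg, div_eq_mul_inv, mul_inv, mul_inv, mul_inv, mul_inv,
    i1, i2, i3, i4, triProd]
  have := mul_inv_cancel₀ hG.ne'
  generalize Real.sqrt (qFact q (2 * g + 1)) = G at *
  rw [show ∀ x y z w u : ℝ, x * G * (G⁻¹ * y * z * w * u) = (G * G⁻¹) * (x * y * z * w * u) by
    intros; ring, this]
  ring

theorem sumK_eq (q : ℝ) {a b e c d f h k g : ℝ} {n₁ n₂ : ℕ} (h₁ : a + c - h = n₁) (h₂ : b + d - k = n₂) :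
    sumK q a b e c d f h k g = ∑ s ∈ range (n₁ + 1), ∑ z ∈ range (n₂ + 1),
      (-1) ^ n₁ * (-1) ^ n₂ * (-1) ^ s * (-1) ^ z * q ^ (-(s : ℝ) * (g + h - k + 1) - z * (g - h + k + 1)) *
      ((qFact q s)⁻¹ * (qFact q (a + c - h - s))⁻¹ * (qFact q z)⁻¹ * (qFact q (b + d - k - z))⁻¹ *
        qFact q (2 * a - s) * qFact q (c + h - a + s) * qFact q (2 * d - z) * qFact q (b - d + k + z) *
        (qFact q (d - a - f + h + s - z))⁻¹ * (qFact q (a - d - e + k - s + z))⁻¹) := by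
  rw [sumK, h₁, h₂, Nat.floor_natCast, Nat.floor_natCast]
  refine sum_congr rfl fun s _ => sum_congr rfl fun z _ => ?_
  rw [show a + b + c + d - h - k + (s : ℝ) + z = ((n₁ + n₂ + s + z : ℕ) : ℝ) by
    push_cast; linarith, sgn_natCast]
  simp only [div_eq_mul_inv, mul_inv, pow_add]
  ring

/-- In the double sum of `nineJ_eq_of_spin`, `sum_flip` is applied to the sum over x for each fixed
z. The rest is a comparison of prefactors and of powers of q. -/
theorem nineJ_eq_exprK (hq : 0 < q) {a b e c d f h k g : ℝ} {A B E C D F H K : ℤ}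
    (S : Spins a b e c d f h k g A B E C D F H K)
    (habe : IsTriad a b e) (hcdf : IsTriad c d f) (hhkg : IsTriad h k g)
    (hach : IsTriad a c h) (hbdk : IsTriad b d k) :
    nineJ q a b e c d f h k g = exprK q a b e c d f h k g := by
  obtain ⟨n₁, h₁⟩ := hach.isNat.1
  obtain ⟨n₂, h₂⟩ := hbdk.isNat.1
  rw [nineJ_eq_of_spin hq S habe hcdf hhkg hach hbdk (M := n₁ + 1) (by push_cast; linarith) h₂,
    exprK_eq hq S habe hcdf hhkg hach hbdk, sumK_eq q h₁ h₂,
    show sgn (b + d - k) = (-1) ^ n₂ by rw [h₂, sgn_natCast]]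
  obtain ⟨a2, b2, e2, c2, d2, f2, h2, k2, g_eq, abe, cdf, ach, bdk, hkg⟩ := S
  have g2 : 2 * g = ((E + F : ℤ) : ℝ) := by push_cast; linarith
  have j1 : IsNat (c + h - a) := isNat_of_half (m := C + H - A) (by push_cast; linarith) (by omega) (by omega)
  have j2 : IsNat (g + h - k) := by
    have := hhkg.isNat.2.1; rwa [show h - k + g = g + h - k by ring] at this
  have j3 : IsNat (c + f - d) := isNat_of_half (m := C + F - D) (by push_cast; linarith) (by omega) (by omega)
  have j4 : IsNat (a + c + h + 1) := hach.isNat.2.2.2.2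
  have j5 : IsNat (a + h - c) := isNat_of_half (m := A + H - C) (by push_cast; linarith) (by omega) (by omega)
  have j6 : IsNat (b + d - k) := ⟨n₂, h₂⟩
  -- The two inverse factorials in front are those required by `sum_flip`; they are already present
  -- among the z-dependent factors. If one of them is 0, so is every term on the right.
  have flip : ∀ z : ℕ, (qFact q (a + k - d - e + z))⁻¹ * (qFact q (c + d - f - z))⁻¹ *
      ∑ x ∈ range (n₁ + 1), (-1) ^ x * (qFact q (c + h - a + x) * qFact q (g + h - k + x) *
        (qFact q (h + f - a - d + z + x))⁻¹ * (qFact q (2 * h + 1 + x))⁻¹ * (qFact q x)⁻¹ *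
        (qFact q ((n₁ : ℝ) - x))⁻¹) * q ^ ((x : ℝ) * (a + k - d - e + z)) =
      (-1) ^ n₁ * (qFact q (g + h - k) * (qFact q (c + f - d + z))⁻¹ *
        (qFact q (a + c + h + 1))⁻¹ * (qFact q (a + h - c))⁻¹) *
      ∑ x ∈ range (n₁ + 1), (-1) ^ x * (qFact q (c + h - a + x) *
        (qFact q (a + k - d - e + z - x))⁻¹ * (qFact q (c + d - f - z - n₁ + x))⁻¹ *
        qFact q (2 * a - x) * (qFact q x)⁻¹ * (qFact q ((n₁ : ℝ) - x))⁻¹) *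
        q ^ ((x : ℝ) * (-(g + h - k + 1))) := by
    intro z
    have e1 : h + f - a - d + z + n₁ = c + f - d + (z : ℝ) := by rw [← h₁]; ring
    have e2 : 2 * h + 1 + (n₁ : ℝ) = a + c + h + 1 := by rw [← h₁]; ring
    have e3 : 2 * a - (n₁ : ℝ) = a + h - c := by rw [← h₁]; ring
    have e4 : c + d - f - z - n₁ + n₁ = c + d - f - (z : ℝ) := by ring
    have := sum_flip hq (U₁ := c + h - a) (U₂ := g + h - k) (C₁ := h + f - a - d + z) (C₂ := 2 * h + 1)
      (W := a + k - d - e + z) (C' := c + d - f - z - n₁) (V := 2 * a) (n := n₁)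
      (σ := a + k - d - e + z) (τ := -(g + h - k + 1)) j1 j2
      (by rw [e1]; exact j3.add (isNat_natCast z)) (by rwa [e2])
      (isInt_of_half (m := A + K - D - E + 2 * z) (by push_cast; linarith) (by omega))
      (by rw [e4]; exact isInt_of_half (m := C + D - F - 2 * z) (by push_cast; linarith) (by omega))
      (by rwa [e3]) (by rw [← h₁, g_eq]; ring) (by ring) (by rw [← h₁]; ring) rfl rfl
    rwa [e1, e2, e3, e4] at this
  -- The x-dependent part of the power has exponent x(a + k - d - e + z), the argument with which
  -- the series can be flipped.
  have hpow : ∀ x z : ℕ, q ^ (-((k - d + f + z) * (g + k - h - x + 1) - (a + k - h - x) * (g - a))) =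
      q ^ (-((k - d + f + z) * (g + k - h + 1) - (a + k - h) * (g - a))) *
        q ^ ((x : ℝ) * (a + k - d - e + z)) := by
    intro x z
    rw [← Real.rpow_add hq]; congr 1; rw [g_eq]; ring
  have hpow' : ∀ x z : ℕ, q ^ (zz d + zz e + zz h) *
      q ^ (-((k - d + f + z) * (g + k - h + 1) - (a + k - h) * (g - a))) *
        q ^ ((x : ℝ) * (-(g + h - k + 1))) = q ^ ((b + d - k) * (a + b + f - h + k + 1) -
        (a + b - e) * (a + d + f - h) + 2 * a * f + (zz b + zz d + zz g + zz h)) *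
        q ^ (-(x : ℝ) * (g + h - k + 1) - z * (g - h + k + 1)) := by
    intro x z
    simp only [← Real.rpow_add hq]; congr 1; simp only [zz]; rw [g_eq]; ring
  have hV : ∀ z : ℕ, ∑ x ∈ range (n₁ + 1), (-1) ^ x * (qFact q (c + h - a + x) *
        qFact q (g + h - k + x) * (qFact q x)⁻¹ * (qFact q (a + c - h - x))⁻¹ *
          (qFact q (2 * h + x + 1))⁻¹) * ((-1) ^ z * (qFact q (2 * d - z) * qFact q (b - d + k + z) *
          (qFact q z)⁻¹ * (qFact q (b + d - k - z))⁻¹ * qFact q (c - d + f + z) *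
          (qFact q (c + d - f - z))⁻¹ * (qFact q (a + k - d - e + z))⁻¹ *
          (qFact q (h + f - a - d + z + x))⁻¹) *
        q ^ (-((k - d + f + z) * (g + k - h - x + 1) - (a + k - h - x) * (g - a)))) =
      (-1) ^ z * (qFact q (2 * d - z) * qFact q (b - d + k + z) * (qFact q z)⁻¹ *
        (qFact q (b + d - k - z))⁻¹ * qFact q (c - d + f + z)) *
        q ^ (-((k - d + f + z) * (g + k - h + 1) - (a + k - h) * (g - a))) *
      ((-1) ^ n₁ * (qFact q (g + h - k) * (qFact q (c + f - d + z))⁻¹ *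
        (qFact q (a + c + h + 1))⁻¹ * (qFact q (a + h - c))⁻¹) *
      ∑ x ∈ range (n₁ + 1), (-1) ^ x * (qFact q (c + h - a + x) *
        (qFact q (a + k - d - e + z - x))⁻¹ * (qFact q (c + d - f - z - n₁ + x))⁻¹ *
        qFact q (2 * a - x) * (qFact q x)⁻¹ * (qFact q ((n₁ : ℝ) - x))⁻¹) *
        q ^ ((x : ℝ) * (-(g + h - k + 1)))) := by
    intro z
    rw [← flip, mul_sum, mul_sum]
    refine sum_congr rfl fun x _ => ?_
    rw [hpow, h₁, show 2 * h + (x : ℝ) + 1 = 2 * h + 1 + x by ring]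
    ring
  simp only [mul_sum]
  rw [sum_comm, sum_comm (s := range (n₁ + 1)) (t := range (n₂ + 1))]
  refine sum_congr rfl fun z _ => ?_
  rw [← mul_sum]
  refine (congrArg _ (hV z)).trans ?_
  rw [← mul_assoc, ← mul_assoc, mul_sum]
  refine sum_congr rfl fun x _ => ?_
  have n1 := mul_inv_cancel₀ (qFact_ne_zero hq j2)
  have n2 := mul_inv_cancel₀ (qFact_ne_zero hq j4)
  have n3 := mul_inv_cancel₀ (qFact_ne_zero hq (j3.add (isNat_natCast z)))
  have hp := hpow' x z
  rw [h₁]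
  rw [show c - d + f + (z : ℝ) = c + f - d + z by ring,
    show d - a - f + h + (x : ℝ) - z = c + d - f - z - n₁ + x by rw [← h₁]; ring,
    show a - d - e + k - (x : ℝ) + z = a + k - d - e + z - x by ring,
    show k + g + h + 1 = g + h + k + 1 by ring, show h + a - c = a + h - c by ring,
    show h - a + c = c + h - a by ring, show f + c - d = c + f - d by ring,
    show f - c + d = f + d - c by ring, show e + a - b = a + e - b by ring,
    show e - a + b = b + e - a by ring, show k - b + d = k + d - b by ring]
  generalize qFact q (g + h - k) = x₁ at *
  generalize qFact q (a + c + h + 1) = x₂ at *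
  generalize qFact q (c + f - d + z) = x₃ at *
  generalize q ^ (-(x : ℝ) * (g + h - k + 1) - z * (g - h + k + 1)) = y₁ at *
  generalize q ^ ((b + d - k) * (a + b + f - h + k + 1) -
        (a + b - e) * (a + d + f - h) + 2 * a * f + (zz b + zz d + zz g + zz h)) = y₂ at *
  generalize q ^ (zz d + zz e + zz h) = y₃ at *
  generalize q ^ (-((k - d + f + z) * (g + k - h + 1) - (a + k - h) * (g - a))) = y₄ at *
  generalize q ^ ((x : ℝ) * (-(g + h - k + 1))) = y₅ at *
  have he : y₃ * y₄ * y₅ * (x₁ * x₁⁻¹) * (x₂ * x₂⁻¹) * (x₃ * x₃⁻¹) = y₂ * y₁ := by rw [n1, n2, n3, hp]; ring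
  linear_combination (triProd q a b e c d f h k g * (-1) ^ n₂ * (-1) ^ n₁ * (-1) ^ z * (-1) ^ x *
    (qFact q (g + h + k + 1) * (qFact q (c + h - a))⁻¹ * (qFact q (c + f - d))⁻¹ *
    (qFact q (k + b - d))⁻¹ * (qFact q (f + d - c))⁻¹ * (qFact q (k + d - b))⁻¹ *
    (qFact q (a + e - b))⁻¹ * (qFact q (b + e - a))⁻¹ * qFact q (2 * d - z) *
    qFact q (b - d + k + z) * (qFact q z)⁻¹ * (qFact q (b + d - k - z))⁻¹ * (qFact q (a + h - c))⁻¹ *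
    qFact q (c + h - a + x) * (qFact q (a + k - d - e + z - x))⁻¹ *
    (qFact q (c + d - f - z - n₁ + x))⁻¹ * qFact q (2 * a - x) * (qFact q x)⁻¹ *
    (qFact q ((n₁ : ℝ) - x))⁻¹)) * he

/-! ### The Clebsch–Gordan form (stdCG). -/

theorem IsProj.isNat {j m : ℝ} (h : IsProj j m) : IsNat (j - m) ∧ IsNat (j + m) := h

/-- The Clebsch–Gordan coefficient with part of its normalization removed. -/
theorem sqrt_mul_qCG (hq : 0 < q) {j₁ m₁ j₂ m₂ j m : ℝ} {n : ℕ} (ht : IsTriad j₁ j₂ j)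
    (h₁ : IsProj j₁ m₁) (h₂ : IsProj j₂ m₂) (h : IsProj j m) (hm : m = m₁ + m₂) (hn : j₁ + j₂ - j = n) :
    Real.sqrt (qFact q (j₁ + m₁) * qFact q (j₂ + m₂) / (qFact q (j₁ - m₁) * qFact q (j₂ - m₂))) *
      qCG q j₁ m₁ j₂ m₂ j m =
    q ^ ((j₁ + j₂ - j) * (j₁ + j₂ + j + 1) / 2 + j₁ * m₂ - j₂ * m₁) * triDelta q j₁ j₂ j *
      (qFact q (j₁ + m₁) * qFact q (j₂ + m₂) * (Real.sqrt (qFact q (j + m) * qFact q (j - m)) *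
        Real.sqrt (qNum q (2 * j + 1)))) *
      ∑ z ∈ range (n + 1), (-1) ^ z * ((qFact q (j₁ - m₁ - z))⁻¹ * (qFact q (j₂ + m₂ - z))⁻¹ *
        (qFact q (j - j₁ - m₂ + z))⁻¹ * (qFact q (j - j₂ + m₁ + z))⁻¹ * (qFact q z)⁻¹ *
        (qFact q ((n : ℝ) - z))⁻¹) * q ^ ((z : ℝ) * (-(j₁ + j₂ + j + 1))) := by
  have p := qFact_nonneg hq
  have p1 := qFact_pos hq h₁.isNat.1.nonneg
  have p2 := qFact_pos hq h₁.isNat.2.nonneg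
  have p3 := qFact_pos hq h₂.isNat.1.nonneg
  have p4 := qFact_pos hq h₂.isNat.2.nonneg
  rw [qCG, if_pos ⟨ht, h₁, h₂, h, hm⟩, hn, Nat.floor_natCast]
  -- In the product of the two roots [j₁-m₁]! and [j₂-m₂]! cancel, while [j₁+m₁]! and [j₂+m₂]!
  -- become squares.
  have hs : Real.sqrt (qFact q (j₁ + m₁) * qFact q (j₂ + m₂) / (qFact q (j₁ - m₁) * qFact q (j₂ - m₂))) *
      Real.sqrt (qFact q (j₁ + m₁) * qFact q (j₁ - m₁) * qFact q (j₂ + m₂) * qFact q (j₂ - m₂) *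
        qFact q (j + m) * qFact q (j - m) * qNum q (2 * j + 1)) =
      qFact q (j₁ + m₁) * qFact q (j₂ + m₂) * (Real.sqrt (qFact q (j + m) * qFact q (j - m)) *
        Real.sqrt (qNum q (2 * j + 1))) := by
    rw [← Real.sqrt_mul (mul_nonneg (p _) (p _)), ← Real.sqrt_mul (by positivity),
      show qFact q (j₁ + m₁) * qFact q (j₂ + m₂) / (qFact q (j₁ - m₁) * qFact q (j₂ - m₂)) *
        (qFact q (j₁ + m₁) * qFact q (j₁ - m₁) * qFact q (j₂ + m₂) * qFact q (j₂ - m₂) *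
        qFact q (j + m) * qFact q (j - m) * qNum q (2 * j + 1)) =
        (qFact q (j₁ + m₁) * qFact q (j₂ + m₂)) ^ 2 * (qFact q (j + m) * qFact q (j - m) *
          qNum q (2 * j + 1)) by field_simp, Real.sqrt_mul (sq_nonneg _), Real.sqrt_sq (mul_pos p2 p4).le]
  rw [← hs]
  have hsum : ∑ z ∈ range (n + 1), sgn z * q ^ (-(z : ℝ) * (j₁ + j₂ + j + 1)) /
          (qFact q z * qFact q ((n : ℝ) - z) * qFact q (j₁ - m₁ - z) * qFact q (j₂ + m₂ - z) *
            qFact q (j - j₂ + m₁ + z) * qFact q (j - j₁ - m₂ + z)) =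
      ∑ z ∈ range (n + 1), (-1) ^ z * ((qFact q (j₁ - m₁ - z))⁻¹ * (qFact q (j₂ + m₂ - z))⁻¹ *
        (qFact q (j - j₁ - m₂ + z))⁻¹ * (qFact q (j - j₂ + m₁ + z))⁻¹ * (qFact q z)⁻¹ *
        (qFact q ((n : ℝ) - z))⁻¹) * q ^ ((z : ℝ) * (-(j₁ + j₂ + j + 1))) := by
    refine sum_congr rfl fun z _ => ?_
    rw [sgn_natCast, neg_mul, mul_neg]
    simp only [div_eq_mul_inv, mul_inv]
    ring
  rw [hsum]
  ring

/-- The prefactors of the expressions with the symmetric double sum and with the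
Clebsch–Gordan coefficients. -/
theorem prefactor_eq (hq : 0 < q) {a b e c d f h k g : ℝ} (hbdk : IsTriad b d k) :
    Real.sqrt (qFact q (2 * e) * qFact q (2 * f) * qFact q (h + k - g) * qFact q (g - h + k) *
        qFact q (g + h - k) * qFact q (g + h + k + 1)) /
      (Real.sqrt (qFact q (2 * g + 1)) *
        nabla q h a c * nabla q f c d * nabla q e a b * nabla q k b d) *
      (qFact q (b - d + k) * qFact q (d + k - b)) =
    Real.sqrt (qFact q (2 * e) * qFact q (2 * f) * qFact q (g + h - k) * qFact q (g + h + k + 1)) /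
      (Real.sqrt (qFact q (2 * g + 1) * qNum q (2 * k + 1)) *
        nabla q h a c * nabla q f c d * nabla q e a b) * (triDelta q d b k *
      (Real.sqrt (qFact q (k + (g - h)) * qFact q (k - (g - h))) * Real.sqrt (qNum q (2 * k + 1)))) := by
  obtain ⟨h1, h2, h3, -, h4⟩ := hbdk.perm₂₃.perm₁₂.isNat
  have p := qFact_nonneg hq
  have hk : 0 ≤ k := by
    have := h1.nonneg; have := h2.nonneg; linarith
  have n1 := qFact_ne_zero hq h1
  have n2 := qFact_ne_zero hq h2
  have n3 := (Real.sqrt_pos.2 (qNum_pos hq (show 0 < 2 * k + 1 by linarith))).ne'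
  have i4 := nabla_inv hq (IsTriad.perm₁₂ hbdk.perm₂₃)
  rw [triDelta_perm₂₃ q k d b, triDelta_perm₁₂ q d k b, triDelta_perm₂₃ q d b k] at i4
  rw [show qFact q (2 * e) * qFact q (2 * f) * qFact q (h + k - g) * qFact q (g - h + k) *
        qFact q (g + h - k) * qFact q (g + h + k + 1) = (qFact q (2 * e) * qFact q (2 * f) *
        qFact q (g + h - k) * qFact q (g + h + k + 1)) * (qFact q (k + (g - h)) * qFact q (k - (g - h))) by
      rw [show k + (g - h) = g - h + k by ring, show k - (g - h) = h + k - g by ring]; ring,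
    Real.sqrt_mul (mul_nonneg (mul_nonneg (mul_nonneg (p _) (p _)) (p _)) (p _)),
    Real.sqrt_mul (p (2 * g + 1)), show b - d + k = k + b - d by ring, show d + k - b = k - b + d by ring]
  simp only [div_eq_mul_inv, mul_inv]
  rw [i4]
  have m1 := inv_mul_cancel₀ n1
  have m2 := inv_mul_cancel₀ n2
  have m3 := inv_mul_cancel₀ n3
  generalize qFact q (k + b - d) = x at *
  generalize qFact q (k - b + d) = y at *
  generalize Real.sqrt (qNum q (2 * k + 1)) = w at *
  generalize Real.sqrt _ = v
  generalize Real.sqrt _ = v'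
  generalize (Real.sqrt _)⁻¹ = v''
  linear_combination (v * v' * v'' * (nabla q h a c)⁻¹ * (nabla q f c d)⁻¹ * (nabla q e a b)⁻¹ *
    triDelta q d b k) * (m1 * (y⁻¹ * y) + m2 - m3)

/-- For fixed s the z-sum in (stdK) has one increasing and one decreasing numerator factorial;
`sum_transform_van_der_waerden` makes it the sum in the Clebsch–Gordan coefficient with projection m
= s - a + e. -/
theorem exprK_eq_exprCG (hq : 0 < q) {a b e c d f h k g : ℝ} {A B E C D F H K : ℤ}
    (S : Spins a b e c d f h k g A B E C D F H K)
    (hach : IsTriad a c h) (hbdk : IsTriad b d k) :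
    exprK q a b e c d f h k g = exprCG q a b e c d f h k g := by
  obtain ⟨n₁, h₁⟩ := hach.isNat.1
  obtain ⟨n₂, h₂⟩ := hbdk.isNat.1
  have hpre := prefactor_eq hq (a := a) (e := e) (c := c) (f := f) (h := h) (g := g) hbdk
  rw [exprK, exprCG, sumK_eq q h₁ h₂]
  obtain ⟨a2, b2, e2, c2, d2, f2, h2, k2, g_eq, abe, cdf, ach, bdk, hkg⟩ := S
  have g2 : 2 * g = ((E + F : ℤ) : ℝ) := by push_cast; linarith
  -- With m = -b + m' and m = s - a + e the two summation indices differ by δ = b + e - a.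
  obtain ⟨δ, hδ⟩ : IsNat (b + e - a) := isNat_of_half (m := B + E - A) (by push_cast; linarith) (by omega) (by omega)
  obtain ⟨n₃, h₃⟩ : IsNat (2 * b) := isNat_of_half (m := 2 * B) (by push_cast; linarith) (by omega) (by omega)
  rw [h₃, Nat.floor_natCast, mul_sum, mul_sum]
  symm
  -- Indices s > a + b - e correspond to m > b: they lie outside the range of the projection, and
  -- here the terms of the double sum vanish.
  have hTK : ∀ s : ℕ, a + b - e < s → ∀ z ∈ range (n₂ + 1), (qFact q (a - d - e + k - s + z))⁻¹ = 0 := by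
    intro s hs z hz
    have hz : (z : ℝ) ≤ n₂ := by exact_mod_cast Nat.lt_succ_iff.1 (mem_range.1 hz)
    exact qFact_inv_of_neg q (by linarith)
  refine sum_shift (δ := δ) ?_ ?_ ?_
  · intro m' s hms
    have hm : -b + (m' : ℝ) = s - a + e := by
      have : (m' : ℝ) = s + δ := by exact_mod_cast hms
      rw [this, ← hδ]; ring
    have hs0 : (0 : ℝ) ≤ s := by positivity
    simp only [hm]
    rw [show a - e + (s - a + e) = (s : ℝ) by ring, show c + e - h - (s - a + e) = a + c - h - (s : ℝ) by ring,
      show c - e + h + (s - a + e) = c + h - a + (s : ℝ) by ring,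
      show a + e - (s - a + e) = 2 * a - (s : ℝ) by ring, h₁]
    rcases ((isNat_natCast n₁).isInt.sub (isNat_natCast s).isInt).neg_or_isNat with i1 | i1
    · rw [qFact_of_neg q i1]
      simp only [mul_zero, zero_mul, div_zero, inv_zero, sum_const_zero]
    have i2 : IsInt (b - (s - a + e)) :=
      isInt_of_half (m := B - (2 * s - A + E)) (by push_cast; linarith) (by omega)
    rcases i2.neg_or_isNat with i2 | i2
    · rw [qCG, if_neg (fun hc => not_le.2 i2 hc.2.2.1.isNat.1.nonneg), sum_eq_zero, mul_zero, mul_zero,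
        mul_zero]
      intro z hz
      rw [hTK s (by linarith) z hz]
      simp only [mul_zero]
    have i3 : IsInt (d - (g - h - (s - a + e))) :=
      isInt_of_half (m := D - (E + F - H - (2 * s - A + E))) (by push_cast; linarith) (by omega)
    rcases i3.neg_or_isNat with i3 | i3
    · rw [qCG, if_neg (fun hc => not_le.2 i3 hc.2.1.isNat.1.nonneg), sum_eq_zero, mul_zero, mul_zero,
        mul_zero]
      intro z _
      rw [qFact_inv_of_neg q (show d - a - f + h + s - (z : ℝ) < 0 by
        linarith [(isNat_natCast z).nonneg])]
      simp only [mul_zero, zero_mul]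
    have i4 : IsNat (b + (s - a + e)) := by
      rw [show b + (s - a + e) = (b + e - a) + s by ring, hδ]
      exact (isNat_natCast _).add (isNat_natCast _)
    have i5 : IsNat (d + (g - h - (s - a + e))) := by
      rw [show d + (g - h - (s - a + e)) = (d + f - c) + (a + c - h - s) by rw [g_eq]; ring, h₁]
      exact (isNat_of_half (m := D + F - C) (by push_cast; linarith) (by omega) (by omega)).add i1
    have i6 : IsNat (b - d + k) := isNat_of_half (m := B - D + K) (by push_cast; linarith) (by omega) (by omega)
    have i7 : IsNat (d + k - b) := isNat_of_half (m := D - B + K) (by push_cast; linarith) (by omega) (by omega)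
    have i8 : IsProj k (g - h) := ⟨isNat_of_half (m := K - (E + F - H)) (by push_cast; linarith) (by omega) (by omega),
      isNat_of_half (m := K + (E + F - H)) (by push_cast; linarith) (by omega) (by omega)⟩
    have hcg := sqrt_mul_qCG hq (n := n₂) hbdk.perm₁₂ ⟨i3, i5⟩ ⟨i2, i4⟩ i8 (by ring)
      (by rw [← h₂]; ring)
    -- W and W' are j₁ - m₁ and j₂ + m₂ for j₁ = d, m₁ = g - h - m, j₂ = b and m₂ = m.
    have hB := sum_transform_van_der_waerden hq (U := b - d + k) (W := d - (g - h - (s - a + e)))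
      (C := a - d - e + k - s) (V := 2 * d) (W' := b + (s - a + e)) (C' := k - b + (g - h - (s - a + e)))
      (n := n₂) (σ := -(g - h + k + 1)) (τ := -(d + b + k + 1)) i6 i3
      (by rwa [← h₂, show a - d - e + k - s + (b + d - k) = b - (s - a + e) by ring])
      (by rwa [← h₂, show 2 * d - (b + d - k) = d + k - b by ring]) i4
      (by rwa [← h₂, show k - b + (g - h - (s - a + e)) + (b + d - k) = d + (g - h - (s - a + e)) by ring])
      (by ring) (by rw [← h₂]; ring) (by rw [← h₂, g_eq]; ring) (by ring)
    rw [← h₂, show 2 * d - (b + d - k) = d + k - b by ring,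
      show k - b + (g - h - (s - a + e)) + (b + d - k) = d + (g - h - (s - a + e)) by ring, h₂] at hB
    have hR : ∑ z ∈ range (n₂ + 1), (-1) ^ n₁ * (-1) ^ n₂ * (-1) ^ s * (-1) ^ z *
        q ^ (-(s : ℝ) * (g + h - k + 1) - z * (g - h + k + 1)) *
        ((qFact q s)⁻¹ * (qFact q ((n₁ : ℝ) - s))⁻¹ * (qFact q z)⁻¹ * (qFact q (b + d - k - z))⁻¹ *
        qFact q (2 * a - s) * qFact q (c + h - a + s) * qFact q (2 * d - z) * qFact q (b - d + k + z) *
        (qFact q (d - a - f + h + s - z))⁻¹ * (qFact q (a - d - e + k - s + z))⁻¹) =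
        ((-1) ^ n₁ * (-1) ^ n₂ * (-1) ^ s * q ^ (-(s : ℝ) * (g + h - k + 1)) * ((qFact q s)⁻¹ *
          (qFact q ((n₁ : ℝ) - s))⁻¹ * qFact q (2 * a - s) * qFact q (c + h - a + s))) *
        ∑ x ∈ range (n₂ + 1), (-1) ^ x * (qFact q (b - d + k + x) *
          (qFact q (d - (g - h - (s - a + e)) - x))⁻¹ * (qFact q (a - d - e + k - s + x))⁻¹ *
          qFact q (2 * d - x) * (qFact q x)⁻¹ * (qFact q ((n₂ : ℝ) - x))⁻¹) *
          q ^ ((x : ℝ) * -(g - h + k + 1)) := by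
      rw [mul_sum]
      refine sum_congr rfl fun z _ => ?_
      rw [show -(s : ℝ) * (g + h - k + 1) - z * (g - h + k + 1) = -(s : ℝ) * (g + h - k + 1) +
        z * -(g - h + k + 1) by ring, Real.rpow_add hq, h₂,
        show d - a - f + h + s - (z : ℝ) = d - (g - h - (s - a + e)) - z by rw [g_eq]; ring]
      ring
    rw [hR, hB, show a + b + c + d - h - k = ((n₁ + n₂ : ℕ) : ℝ) by push_cast; linarith,
      show d + g - h - (s - a + e) = d + (g - h - (s - a + e)) by ring,
      show d - g + h + (s - a + e) = d - (g - h - (s - a + e)) by ring, sgn_natCast, sgn_natCast, pow_add,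
      mul_assoc (_ * _ * _ / _) (Real.sqrt _) (qCG _ _ _ _ _ _ _), hcg]
    simp only [show ∀ z : ℕ, k - d - (s - a + e) + (z : ℝ) = a - d - e + k - s + z from fun z => by ring]
    rw [← h₂]
    have hpow : q ^ (2 * a * f - (a + b - e) * (a + d + f - h) + b * (g - h) +
        (b + d - k) * (b + d + k + 1) / 2 - (a - e) * (g + h - b - d + 1) + (zz b + zz d + zz g + zz h)) *
        q ^ (-(s - a + e) * (g + h + 1)) *
        q ^ ((d + b - k) * (d + b + k + 1) / 2 + d * (s - a + e) - b * (g - h - (s - a + e))) =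
        q ^ ((b + d - k) * (a + b + f - h + k + 1) - (a + b - e) * (a + d + f - h) + 2 * a * f +
          (zz b + zz d + zz g + zz h)) * q ^ (-(s : ℝ) * (g + h - k + 1)) *
        q ^ ((d - (g - h - (s - a + e))) * (b + d - k)) := by
      simp only [← Real.rpow_add hq]; congr 1; rw [g_eq]; ring
    rw [mul_div_assoc ((-1) ^ n₁ * (-1) ^ n₂), mul_div_assoc ((-1) ^ s * _), div_eq_mul_inv (_ * _) (qFact q s * _),
      mul_inv (qFact q s)]
    generalize Real.sqrt (qFact q (2 * e) * qFact q (2 * f) * qFact q (h + k - g) * qFact q (g - h + k) *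
      qFact q (g + h - k) * qFact q (g + h + k + 1)) / _ = w₁ at *
    generalize Real.sqrt (qFact q (2 * e) * qFact q (2 * f) * qFact q (g + h - k) *
      qFact q (g + h + k + 1)) / _ = w₂ at *
    generalize triDelta q d b k = w₃ at *
    generalize Real.sqrt (qNum q (2 * k + 1)) = w₄ at *
    generalize Real.sqrt (qFact q (k + (g - h)) * qFact q (k - (g - h))) = w₅ at *
    generalize ∑ z ∈ range (n₂ + 1), (_ : ℝ) = w₆
    generalize q ^ (2 * a * f - (a + b - e) * (a + d + f - h) + b * (g - h) +
        (b + d - k) * (b + d + k + 1) / 2 - (a - e) * (g + h - b - d + 1) + (zz b + zz d + zz g + zz h)) = y₁ at *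
    generalize q ^ ((b + d - k) * (a + b + f - h + k + 1) - (a + b - e) * (a + d + f - h) + 2 * a * f +
          (zz b + zz d + zz g + zz h)) = y₂ at *
    generalize q ^ (-(s - a + e) * (g + h + 1)) = y₃ at *
    generalize q ^ ((d + b - k) * (d + b + k + 1) / 2 + d * (s - a + e) - b * (g - h - (s - a + e))) = y₄ at *
    generalize qFact q (d + (g - h - (s - a + e))) = x₁
    generalize qFact q (b + (s - a + e)) = x₂
    linear_combination ((-1) ^ n₁ * (-1) ^ n₂ * (-1) ^ s * (qFact q (2 * a - s) * qFact q (c + h - a + s) *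
      (qFact q s)⁻¹ * (qFact q ((n₁ : ℝ) - s))⁻¹ * x₁ * x₂ * w₆)) *
      (w₁ * (qFact q (b - d + k) * qFact q (d + k - b)) * hpow - y₁ * y₃ * y₄ * hpre)
  · intro m' hm'
    have h1 : 0 ≤ (m' : ℝ) - δ := by
      by_contra hc
      refine hm' ?_
      simp only
      rw [qFact_of_neg q (show a - e + (-b + (m' : ℝ)) < 0 by linarith)]
      simp only [mul_zero, zero_mul, div_zero]
    have h2 : (m' : ℝ) - δ ≤ n₁ := by
      by_contra hc
      refine hm' ?_
      simp only
      rw [qFact_of_neg q (show c + e - h - (-b + (m' : ℝ)) < 0 by linarith)]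
      simp only [mul_zero, zero_mul, div_zero]
    have h1' : 0 ≤ (m' : ℤ) - δ := by exact_mod_cast h1
    have h2' : (m' : ℤ) - δ ≤ n₁ := by exact_mod_cast h2
    push_cast
    omega
  · intro s hs
    have h0 : (s : ℝ) ≤ a + b - e := by
      by_contra hc
      refine hs ?_
      rw [sum_eq_zero, mul_zero]
      intro z hz
      rw [hTK s (not_le.1 hc) z hz]
      simp only [mul_zero]
    have : (s : ℝ) + δ ≤ n₃ := by linarith
    have : s + δ ≤ n₃ := by exact_mod_cast this
    push_cast
    omega

/-! ### The further double sum (stbK). -/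

theorem sqrt_stretched_mul (hq : 0 < q) {a b e f g : ℝ} (hg : g = e + f) (he : IsNat (2 * e))
    (hf : IsNat (2 * f)) (habe : IsTriad a b e) :
    Real.sqrt (qFact q (2 * e) * qFact q (2 * f) * qFact q (a - b + e) * qFact q (a + b - e) /
      (qFact q (2 * g + 1) * qFact q (e - a + b) * qFact q (a + b + e + 1))) =
    triDelta q f g e * triDelta q a b e * (qFact q (e - a + b))⁻¹ := by
  obtain ⟨h1, h2, h3, h4, h5⟩ := habe.isNat
  have n5 := qFact_ne_zero hq h5
  have n3 := qFact_pos hq h3.nonneg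
  have nG : 0 < qFact q (2 * g + 1) := qFact_pos hq (by linarith [he.nonneg, hf.nonneg])
  have s1 := triDelta_mul_self hq f g e
  have s2 := triDelta_mul_self hq a b e
  rw [triSq, show f + g - e = 2 * f by rw [hg]; ring, show f - g + e = 0 by rw [hg]; ring,
    show g + e - f = 2 * e by rw [hg]; ring, show f + g + e + 1 = 2 * g + 1 by rw [hg]; ring,
    qFact_zero] at s1
  rw [triSq] at s2
  rw [show e - a + b = b + e - a by ring]
  rw [Real.sqrt_eq_iff_mul_self_eq_of_pos]
  · rw [show ∀ x y z : ℝ, x * y * z * (x * y * z) = (x * x) * (y * y) * (z * z) by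
      intros; ring, s1, s2]
    generalize qFact q (2 * g + 1) = G at *
    generalize qFact q (a + b + e + 1) = T at *
    generalize qFact q (b + e - a) = T' at *
    field_simp
  · refine mul_pos (mul_pos ?_ (triDelta_pos hq habe)) (inv_pos.2 n3)
    refine triDelta_pos hq ⟨?_, ?_, ?_⟩
    · obtain ⟨n, hn⟩ := he; exact ⟨n, by rw [← hn, hg]; ring⟩
    · exact ⟨0, by rw [hg]; push_cast; ring⟩
    · obtain ⟨n, hn⟩ := hf; exact ⟨n, by rw [← hn, hg]; ring⟩

/-- The factor relating the further double sum to the coefficient. -/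
theorem exprK'_eq (hq : 0 < q) {a b e c d f h k g : ℝ} {A B E C D F H K : ℤ}
    (S : Spins a b e c d f h k g A B E C D F H K)
    (habe : IsTriad a b e) (hcdf : IsTriad c d f) (hhkg : IsTriad h k g)
    (hach : IsTriad a c h) (hbdk : IsTriad b d k) :
    exprK' q a b e c d f h k g = triProd q a b e c d f h k g * (qFact q (g + h + k + 1) *
      qFact q (b + d + k + 1) * (qFact q (e - a + b))⁻¹ * (qFact q (h + k - g))⁻¹ *
      (qFact q (d + k - b))⁻¹ * (qFact q (f + c - d))⁻¹ * (qFact q (f - c + d))⁻¹ *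
      (qFact q (a + c - h))⁻¹ * (qFact q (a - c + h))⁻¹) *
      q ^ ((c + d - f) * (a + b - e + 1) - (a + b + e + 1) * (b + d - k) + 2 * e * d
        + (zz a + zz c + zz g + zz k)) * sumK' q a b e c d f h k g := by
  have he : IsNat (2 * e) := by
    refine isNat_of_half (m := 2 * E) (by push_cast; linarith [S.e2]) (by omega) ?_
    have := S.abe; omega
  have hf : IsNat (2 * f) := by
    refine isNat_of_half (m := 2 * F) (by push_cast; linarith [S.f2]) (by omega) ?_
    have := S.cdf; omega
  rw [exprK', sqrt_stretched_mul hq S.g_eq he hf habe, div_eq_mul_inv, mul_inv,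
    nabla_inv hq (IsTriad.perm₁₂ hcdf.perm₂₃), nabla_inv hq hach, nabla_eq hq hbdk,
    nabla_eq hq (IsTriad.perm₁₂ hhkg.perm₂₃), triProd, triDelta_perm₂₃ q f d c,
    triDelta_perm₁₂ q h g k, triDelta_perm₂₃ q h k g, triDelta_perm₁₂ q k h g, triDelta_perm₂₃ q k g h,
    triDelta_perm₁₂ q d b k, triDelta_perm₂₃ q d k b, triDelta_perm₁₂ q k d b]
  ring

/-- The inner sum over `z` vanishes beyond the range of the triangle conditions. -/
theorem sum_eq_zero_of_beyond_row (hq : 0 < q) {a b e c d f h k g : ℝ} {A B E C D F H K : ℤ}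
    (S : Spins a b e c d f h k g A B E C D F H K) {n x : ℕ} (hn : b + d - k = n)
    (hx : g + k - h - x < 0) (hx' : 0 ≤ a + c - h - x) :
    ∑ z ∈ range (n + 1), (-1) ^ z * (qFact q (d + k - b + z) * qFact q (k - g + h + x + z) *
      (qFact q (2 * k + 1 + z))⁻¹ * (qFact q (c - b - f + k + z))⁻¹ * (qFact q z)⁻¹ *
      (qFact q ((n : ℝ) - z))⁻¹) * q ^ ((z : ℝ) * (g - h - x - f + b + c)) = 0 := by
  obtain ⟨a2, b2, e2, c2, d2, f2, h2, k2, g_eq, abe, cdf, ach, bdk, hkg⟩ := S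
  have g2 : 2 * g = ((E + F : ℤ) : ℝ) := by push_cast; linarith
  obtain ⟨r, hr⟩ : IsNat (d + f - c) := isNat_of_half (m := D + F - C) (by push_cast; linarith) (by omega) (by omega)
  have i0 : IsInt (x - (g + k - h)) := isInt_of_half (m := 2 * x - (E + F + K - H)) (by push_cast; linarith) (by omega)
  obtain ⟨s, hs⟩ : IsNat (x - (g + k - h) - 1) := by
    refine (i0.sub (by simpa using (isNat_natCast 1).isInt)).isNat ?_
    have := i0.neg.le_neg_one (by linarith)
    linarith
  have i1 : IsNat (b + e - a) := isNat_of_half (m := B + E - A) (by push_cast; linarith) (by omega) (by omega)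
  have i2 : IsNat (d + k - b) := isNat_of_half (m := D + K - B) (by push_cast; linarith) (by omega) (by omega)
  have i3 : IsNat (2 * k + 1) := (isNat_of_half (m := 2 * K) (by push_cast; linarith) (by omega) (by omega)).add_one
  -- The difference n - r - s is b + c + e - h - x + 1, at least 1 because a ≤ b + e and x ≤ a + c -
  -- h.
  have hlt : r + s + 0 < n := by
    have : ((r + s : ℕ) : ℝ) < n := by push_cast; linarith [i1.nonneg]
    exact_mod_cast this
  have hzero := sum_qPoch_eq_zero hq (c - b - f + k + 1) (2 * k + 1 + 1) 0 hlt
  have hnF := (qFact_natCast_pos hq n).ne'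
  calc _ = ∑ z ∈ range (n + 1), (qFact q n)⁻¹ * (qBin q n z * ((-1) ^ z *
        q ^ ((z : ℝ) * (n - 1 - (r + s + (0 : ℕ)))) * (qPoch q (c - b - f + k + 1 + z) r *
          qPoch q (2 * k + 1 + 1 + z) s * qPoch q (0 + z) 0))) := by
        refine sum_congr rfl fun z hz => ?_
        have e1 := qFact_mul_inv_eq_qPoch hq (C := c - b - f + k + z) (n := r) (by
          rw [← hr, show c - b - f + k + z + (d + f - c) = d + k - b + z by ring]
          exact i2.add (isNat_natCast z))
        have e2 := qFact_mul_inv_eq_qPoch hq (C := 2 * k + 1 + z) (n := s)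
          ((i3.add (isNat_natCast z)).add (isNat_natCast s))
        rw [← hr, show c - b - f + k + z + (d + f - c) = d + k - b + z by ring,
          show c - b - f + k + (z : ℝ) + 1 = c - b - f + k + 1 + z by ring] at e1
        rw [← hs, show 2 * k + 1 + z + (x - (g + k - h) - 1) = k - g + h + x + z by ring,
          show 2 * k + 1 + (z : ℝ) + 1 = 2 * k + 1 + 1 + z by ring] at e2
        rw [← e1, ← e2, qPoch_zero, qBin, div_eq_mul_inv, mul_inv,
          show (n : ℝ) - 1 - (r + s + (0 : ℕ)) = g - h - x - f + b + c by
            rw [← hn, ← hr, ← hs]; push_cast; ring]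
        have e6 := inv_mul_cancel₀ hnF
        generalize (qFact q n)⁻¹ = u at *
        generalize qFact q n = u' at *
        generalize q ^ ((z : ℝ) * (g - h - x - f + b + c)) = w' at *
        generalize (qFact q ((n : ℝ) - z))⁻¹ = w'' at *
        generalize (qFact q (z : ℝ))⁻¹ = y at *
        linear_combination (-((-1) ^ z * y * w'' * w' * qFact q (d + k - b + z) *
          (qFact q (c - b - f + k + z))⁻¹ * qFact q (k - g + h + x + z) * (qFact q (2 * k + 1 + z))⁻¹)) * e6
    _ = 0 := by rw [← mul_sum, hzero, mul_zero]

/-- `sum_transform_add` for the z-sum at fixed x. For x > g + k - h the left side is 0 through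
1/[g+k-h-x]!; the right side then vanishes through 1/[a+c-h-x]! or as a q-difference, so the
identity holds for every x. -/
theorem row_sum_transform (hq : 0 < q) {a b e c d f h k g : ℝ} {A B E C D F H K : ℤ}
    (S : Spins a b e c d f h k g A B E C D F H K) {n : ℕ} (hn : b + d - k = n) (x : ℕ) :
    qFact q (k + h - g + x) * (qFact q (a + c - h - x))⁻¹ * ((qFact q (g + k - h - x))⁻¹ *
    ∑ z ∈ range (n + 1), (-1) ^ z * (qFact q (g + k - h - x + z) * qFact q (d + k - b + z) *
      (qFact q (f + k - b - c + z))⁻¹ * (qFact q (2 * k + 1 + z))⁻¹ * (qFact q z)⁻¹ *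
      (qFact q ((n : ℝ) - z))⁻¹) * q ^ ((z : ℝ) * (c + g - h - x - b - f))) =
    (qFact q (a + c - h - x))⁻¹ * ((-1) ^ n * q ^ ((d + k - b + 1) * n) * (qFact q (c + d - f) *
      (qFact q (f + d - c))⁻¹) *
    ∑ z ∈ range (n + 1), (-1) ^ z * (qFact q (d + k - b + z) * qFact q (k - g + h + x + z) *
      (qFact q (2 * k + 1 + z))⁻¹ * (qFact q (c - b - f + k + z))⁻¹ * (qFact q z)⁻¹ *
      (qFact q ((n : ℝ) - z))⁻¹) * q ^ ((z : ℝ) * (g - h - x - f + b + c))) := by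
  have S' := S
  obtain ⟨a2, b2, e2, c2, d2, f2, h2, k2, g_eq, abe, cdf, ach, bdk, hkg⟩ := S
  have i1 : IsInt (a + c - h - x) := isInt_of_half (m := A + C - H - 2 * x) (by push_cast; linarith) (by omega)
  have i2 : IsInt (g + k - h - x) := isInt_of_half (m := E + F + K - H - 2 * x) (by push_cast; linarith) (by omega)
  rcases i1.neg_or_isNat with i1 | i1
  · rw [qFact_inv_of_neg q i1, mul_zero, zero_mul, zero_mul]
  rcases i2.neg_or_isNat with i2 | i2
  · rw [sum_eq_zero_of_beyond_row hq S' hn i2 i1.nonneg, qFact_inv_of_neg q i2]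
    simp only [mul_zero, zero_mul]
  have i3 : IsNat (d + k - b) := isNat_of_half (m := D + K - B) (by push_cast; linarith) (by omega) (by omega)
  have i4 : IsNat (k + h - g + x) := (isNat_of_half (m := K + H - (E + F)) (by push_cast; linarith) (by omega) (by omega)).add (isNat_natCast x)
  have i5 : IsNat (f + d - c) := isNat_of_half (m := F + D - C) (by push_cast; linarith) (by omega) (by omega)
  have i6 : IsNat (c + d - f) := isNat_of_half (m := C + D - F) (by push_cast; linarith) (by omega) (by omega)
  have i7 : IsNat (2 * k + 1) := (isNat_of_half (m := 2 * K) (by push_cast; linarith) (by omega) (by omega)).add_one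
  have e1 : f + k - b - c + n = f + d - c := by rw [← hn]; ring
  have e2 : c - b - f + k + n = c + d - f := by rw [← hn]; ring
  have hC := sum_transform_add hq (U₁ := g + k - h - x) (U₂ := d + k - b) (C₁ := f + k - b - c)
    (C₂ := 2 * k + 1) (U₃ := k + h - g + x) (C₃ := c - b - f + k) (n := n)
    (σ := c + g - h - x - b - f) (τ := g - h - x - f + b + c) i2 i3 (by rwa [e1])
    (i7.add (isNat_natCast n)) i4 (by rwa [e2]) (by ring) (by rw [← hn]; ring) (by rw [← hn]; ring)
    (by ring)
  rw [e1, e2] at hC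
  rw [hC]
  simp only [show ∀ z : ℕ, k - g + h + x + (z : ℝ) = k + h - g + x + z from fun z => by ring]
  have := mul_inv_cancel₀ (qFact_ne_zero hq i4)
  generalize qFact q (k + h - g + x) = u at *
  generalize ∑ z ∈ range (n + 1), (_ : ℝ) = w
  linear_combination ((qFact q (a + c - h - x))⁻¹ * ((-1) ^ n * q ^ ((d + k - b + 1) * n) *
    (qFact q (c + d - f) * (qFact q (f + d - c))⁻¹) * w)) * this

theorem sum_range_succ_congr {f g : ℕ → ℝ} {m n : ℕ} (h : ∀ i, f i = g i) (hm : ∀ i, m < i → f i = 0)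
    (hn : ∀ i, n < i → f i = 0) : ∑ i ∈ range (m + 1), f i = ∑ i ∈ range (n + 1), g i := by
  rw [← sum_congr rfl fun i _ => h i]
  rcases le_total m n with hmn | hmn
  · exact (sum_range_eq_of_zero (by omega) fun i hi => hm i hi).symm
  · exact sum_range_eq_of_zero (by omega) fun i hi => hn i hi

/-- Two 3F2 transformations in succession, `sum_transform_inv` and `sum_transform_mixed`. In
between, the factors 1/[n-x]! and 1/[N-x]! with N = c - b - f + k + z exchange roles: the sum of
length n is read as one of length N. -/
theorem column_sum_transform (hq : 0 < q) {a b e c d f h k g : ℝ} {A B E C D F H K : ℤ}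
    (S : Spins a b e c d f h k g A B E C D F H K) {n n' z : ℕ} (hn : a + c - h = n)
    (hn' : c + h - a = n') (hz : z ≤ b + d - k) :
    (qFact q (c - b - f + k + z))⁻¹ * ∑ x ∈ range (n + 1), (-1) ^ x * (qFact q (k - g + h + z + x) *
      qFact q (a + h - c + x) * (qFact q (b - e - c + h + x))⁻¹ * (qFact q (2 * h + 1 + x))⁻¹ *
      (qFact q x)⁻¹ * (qFact q ((n : ℝ) - x))⁻¹) * q ^ ((x : ℝ) * (b + f + c - k - z)) =
    sgn (c - b - f + k + z) * q ^ ((a + h - c + 1) * (c - b - f + k + z - (a + c - h))) *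
      (qFact q (a - b + e) * (qFact q (a + c + h + 1))⁻¹ * (qFact q (a + c - h))⁻¹) *
    ∑ s ∈ range (n' + 1), (-1) ^ s * (qFact q (a + h - c + s) * (qFact q ((n' : ℝ) - s))⁻¹ *
      (qFact q (a + g - c - k - z + s))⁻¹ * qFact q (2 * c - s) * (qFact q s)⁻¹ *
      (qFact q (c - b - f + k + z - s))⁻¹) * q ^ ((s : ℝ) * (-(a + b - e + 1))) := by
  obtain ⟨a2, b2, e2, c2, d2, f2, h2, k2, g_eq, abe, cdf, ach, bdk, hkg⟩ := S
  have i0 : IsInt (c - b - f + k + z) := isInt_of_half (m := C - B - F + K + 2 * z) (by push_cast; linarith) (by omega)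
  rcases i0.neg_or_isNat with i0 | ⟨N, hN⟩
  -- For negative c - b - f + k + z each side contains the inverse factorial of a negative integer.
  · rw [qFact_inv_of_neg q i0, zero_mul, sum_eq_zero, mul_zero]
    intro s _
    rw [qFact_inv_of_neg q (show c - b - f + k + z - (s : ℝ) < 0 by linarith [(isNat_natCast s).nonneg])]
    simp only [mul_zero, zero_mul]
  have i1 : IsNat (k - g + h + z) := (isNat_of_half (m := K + H - (E + F)) (by push_cast; linarith) (by omega) (by omega)).add (isNat_natCast z)
  have i2 : IsNat (a + h - c) := isNat_of_half (m := A + H - C) (by push_cast; linarith) (by omega) (by omega)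
  have i3 : IsNat (a + b - e) := isNat_of_half (m := A + B - E) (by push_cast; linarith) (by omega) (by omega)
  have i4 : IsNat (a + c + h + 1) := (isNat_of_half (m := A + C + H) (by push_cast; linarith) (by omega) (by omega)).add_one
  have i5 : IsNat (a - b + e) := isNat_of_half (m := A - B + E) (by push_cast; linarith) (by omega) (by omega)
  have i6 : IsNat (2 * c - N) := by
    rw [← hN]
    -- Here z ≤ b + d - k enters: 2c - N = c + b + f - k - z is then at least c + f - d.
    refine (isInt_of_half (m := 2 * C - (C - B - F + K + 2 * z)) (by push_cast; linarith) (by omega)).isNat ?_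
    have := (isNat_of_half (m := C + F - D) (x := c + f - d) (by push_cast; linarith) (by omega) (by omega)).nonneg
    linarith
  have i7 : IsNat (c + h - a) := ⟨n', hn'⟩
  have e1 : b - e - c + h + n = a + b - e := by rw [← hn]; ring
  have e2 : 2 * h + 1 + n = a + c + h + 1 := by rw [← hn]; ring
  have e3 : 2 * c - n = c + h - a := by rw [← hn]; ring
  have e4 : b - e - c + h + N = k - g + h + z := by rw [← hN, g_eq]; ring
  have e5 : a + g - c - k - z + N = a - b + e := by rw [← hN, g_eq]; ring
  have hD := sum_transform_inv hq (U₁ := k - g + h + z) (U₂ := a + h - c) (C₁ := b - e - c + h)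
    (C₂ := 2 * h + 1) (W := N) (V := 2 * c) (n := n) (σ := b + f + c - k - z)
    (τ := g + h - k - z + 1) i1 i2 (by rwa [e1]) (by rwa [e2]) (isNat_natCast N) (by rwa [e3])
    (by rw [← hN, g_eq]; ring) (by rw [← hn]; ring) (by rw [← hn, g_eq]; ring) (by ring)
  have hE := sum_transform_mixed hq (U := a + h - c) (W := n) (V := 2 * c) (C := b - e - c + h)
    (W' := c + h - a) (C' := a + g - c - k - z) (n := N) (σ := g + h - k - z + 1)
    (τ := -(a + b - e + 1)) i2 (isNat_natCast n) i6 (by rwa [e4]) i7 (by rwa [e5])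
    (by rw [← hn]; ring) (by rw [← hN, g_eq]; ring) (by rw [← hn, ← hN, g_eq]; ring) (by rw [← hn]; ring)
  rw [e2, e3] at hD
  rw [e4, e5] at hE
  have hcast : ∀ {m i : ℕ}, m < i → (m : ℝ) - i < 0 := fun {m i} h => by
    have : (m : ℝ) < i := Nat.cast_lt.2 h
    linarith
  -- Terms beyond either n or N vanish, so the upper limit may be replaced by N before the second
  -- transformation and by n' = c + h - a after it.
  rw [hD, sum_range_succ_congr (m := n) (n := N) (g := fun x : ℕ => (-1) ^ x * (qFact q (a + h - c + x) *
      (qFact q ((n : ℝ) - x))⁻¹ *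
      (qFact q (b - e - c + h + x))⁻¹ * qFact q (2 * c - x) * (qFact q x)⁻¹ * (qFact q ((N : ℝ) - x))⁻¹) *
      q ^ ((x : ℝ) * (g + h - k - z + 1))) (fun x => by ring)
      (fun i hi => by rw [qFact_inv_of_neg q (hcast hi)]; simp only [mul_zero, zero_mul])
      (fun i hi => by rw [qFact_inv_of_neg q (hcast hi)]; simp only [mul_zero, zero_mul]), hE,
    sum_range_succ_congr (m := N) (n := n') (g := fun s : ℕ => (-1) ^ s * (qFact q (a + h - c + s) *
      (qFact q ((n' : ℝ) - s))⁻¹ *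
      (qFact q (a + g - c - k - z + s))⁻¹ * qFact q (2 * c - s) * (qFact q s)⁻¹ *
      (qFact q (c - b - f + k + z - s))⁻¹) * q ^ ((s : ℝ) * (-(a + b - e + 1))))
      (fun s => by rw [hN, hn'])
      (fun i hi => by rw [qFact_inv_of_neg q (hcast hi)]; simp only [mul_zero, zero_mul])
      (fun i hi => by rw [hn', qFact_inv_of_neg q (hcast hi)]; simp only [mul_zero, zero_mul])]
  have hpow : q ^ (-((a + h - c + 1) * (n : ℝ))) * q ^ ((a + h - c + 1) * (N : ℝ)) =
      q ^ ((a + h - c + 1) * (c - b - f + k + z - (a + c - h))) := by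
    rw [← Real.rpow_add hq, hN, hn]; congr 1; ring
  rw [← hpow, hN, hn, sgn_natCast]
  have c1 := mul_inv_cancel₀ (qFact_ne_zero hq i1)
  have c2 := inv_mul_cancel₀ (qFact_ne_zero hq i7)
  have c3 := inv_mul_cancel₀ (qFact_natCast_pos hq N).ne'
  generalize qFact q (k - g + h + z) = x₁ at *
  generalize qFact q (c + h - a) = x₂ at *
  generalize qFact q (N : ℝ) = x₃ at *
  generalize ∑ s ∈ range (n' + 1), (_ : ℝ) = w
  linear_combination (q ^ (-((a + h - c + 1) * (n : ℝ))) * q ^ ((a + h - c + 1) * (N : ℝ)) * (-1) ^ N *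
    (qFact q (a + c + h + 1))⁻¹ * (qFact q n)⁻¹ * qFact q (a - b + e) * w) *
    (c1 * (x₂⁻¹ * x₂) * (x₃⁻¹ * x₃) + c2 * (x₃⁻¹ * x₃) + c3)

theorem sumK'_eq (q : ℝ) {a b e c d f h k g : ℝ} {n₁ n₂ : ℕ} (h₁ : c + h - a = n₁) (h₂ : b + d - k = n₂) :
    sumK' q a b e c d f h k g = ∑ s ∈ range (n₁ + 1), ∑ z ∈ range (n₂ + 1),
      sgn (c + k - b - f + s) * q ^ (-(s : ℝ) * (a + b - e + 1) + z * (a + b + e + 1)) *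
      (qFact q (2 * c - s) * qFact q (a + h - c + s) * qFact q (d + k - b + z) * (qFact q s)⁻¹ *
        (qFact q ((n₁ : ℝ) - s))⁻¹ * (qFact q z)⁻¹ * (qFact q ((n₂ : ℝ) - z))⁻¹ *
        (qFact q (2 * k + 1 + z))⁻¹ * (qFact q (c - b - f + k + z - s))⁻¹ *
        (qFact q (a + g - c - k - z + s))⁻¹) := by
  rw [sumK', h₁, h₂, Nat.floor_natCast, Nat.floor_natCast]
  refine sum_congr rfl fun s _ => sum_congr rfl fun z _ => ?_
  rw [show a + h - c + (s : ℝ) = a - c + h + s by ring, show d + k - b + (z : ℝ) = k - b + d + z by ring,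
    show a + g - c - k - z + (s : ℝ) = a - c + g - k - z + s by ring,
    show 2 * k + 1 + (z : ℝ) = 2 * k + z + 1 by ring]
  simp only [div_eq_mul_inv, mul_inv]
  ring_nf

/-- Starting from `nineJ_eq_of_row`, the z-sum is transformed at fixed x, the summations are
exchanged, and the x-sum is transformed at fixed z. The first step leaves an x-sum to which the
second applies. -/
theorem nineJ_eq_exprK' (hq : 0 < q) {a b e c d f h k g : ℝ} {A B E C D F H K : ℤ}
    (S : Spins a b e c d f h k g A B E C D F H K)
    (habe : IsTriad a b e) (hcdf : IsTriad c d f) (hhkg : IsTriad h k g)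
    (hach : IsTriad a c h) (hbdk : IsTriad b d k) :
    nineJ q a b e c d f h k g = exprK' q a b e c d f h k g := by
  obtain ⟨n₁, h₁⟩ := hach.isNat.1
  obtain ⟨n₂, h₂⟩ := hbdk.isNat.1
  obtain ⟨n₃, h₃⟩ := hach.isNat.2.2.1
  have hsg : sgn (b + d - k) = (-1) ^ n₂ := by rw [h₂, sgn_natCast]
  rw [nineJ_eq_of_row hq S habe hcdf hhkg hach hbdk (M := n₁ + 1) (N := n₂ + 1) (by push_cast; linarith)
    (by push_cast; linarith), exprK'_eq hq S habe hcdf hhkg hach hbdk, sumK'_eq q h₃ h₂, hsg]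
  have hrow := row_sum_transform hq S h₂
  have hcol := fun (z : ℕ) (hz : (z : ℝ) ≤ b + d - k) => column_sum_transform hq S h₁ h₃ hz
  obtain ⟨a2, b2, e2, c2, d2, f2, h2, k2, g_eq, abe, cdf, ach, bdk, hkg⟩ := S
  have hpow : ∀ x z : ℕ, q ^ (-((b + f) * (g + k - h - x + z + 1) - (c + g - h - x) * (k + z - c))) =
      q ^ (-((b + f) * (g + k - h + 1) - (c + g - h) * (k - c))) * q ^ ((x : ℝ) * (b + f + c - k)) *
        q ^ ((z : ℝ) * (c + g - h - x - b - f)) := by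
    intro x z
    rw [← Real.rpow_add hq, ← Real.rpow_add hq]; congr 1; ring
  -- The power of q with exponent -xz is moved from the z-sum to the x-sum, where
  -- `column_sum_transform` needs it.
  have hpow' : ∀ x z : ℕ, q ^ ((x : ℝ) * (b + f + c - k)) * q ^ ((z : ℝ) * (g - h - x - f + b + c)) =
      q ^ ((z : ℝ) * (g - h - f + b + c)) * q ^ ((x : ℝ) * (b + f + c - k - z)) := by
    intro x z
    rw [← Real.rpow_add hq, ← Real.rpow_add hq]; congr 1; ring
  have hpow'' : ∀ s z : ℕ, q ^ (zz d + zz e + zz h) *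
      q ^ (-((b + f) * (g + k - h + 1) - (c + g - h) * (k - c))) * q ^ ((d + k - b + 1) * n₂) *
      q ^ ((z : ℝ) * (g - h - f + b + c)) * q ^ ((a + h - c + 1) * (c - b - f + k + z - (a + c - h))) *
      q ^ ((s : ℝ) * (-(a + b - e + 1))) = q ^ ((c + d - f) * (a + b - e + 1) -
        (a + b + e + 1) * (b + d - k) + 2 * e * d + (zz a + zz c + zz g + zz k)) *
        q ^ (-(s : ℝ) * (a + b - e + 1) + z * (a + b + e + 1)) := by
    intro s z
    simp only [← Real.rpow_add hq]; congr 1; simp only [zz]; rw [g_eq, ← h₂]; ring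
  have hX : ∀ x : ℕ, ∑ z ∈ range (n₂ + 1), (-1) ^ x * (-1) ^ z *
      (qFact q (a + h - c + x) * qFact q (k + h - g + x) * (qFact q x)⁻¹ *
        (qFact q (a + c - h - x))⁻¹ * (qFact q (g + k - h - x))⁻¹ * (qFact q (2 * h + x + 1))⁻¹ *
        (qFact q (b - e - c + h + x))⁻¹ *
      (qFact q (d + k - b + z) * (qFact q z)⁻¹ * (qFact q (b + d - k - z))⁻¹ *
        (qFact q (f + k - b - c + z))⁻¹ * (qFact q (2 * k + z + 1))⁻¹ *
        qFact q (g + k - h - x + z))) *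
      q ^ (-((b + f) * (g + k - h - x + z + 1) - (c + g - h - x) * (k + z - c))) =
      ∑ z ∈ range (n₂ + 1), (q ^ (-((b + f) * (g + k - h + 1) - (c + g - h) * (k - c))) *
        ((-1) ^ n₂ * q ^ ((d + k - b + 1) * n₂) * (qFact q (c + d - f) * (qFact q (f + d - c))⁻¹)) *
        ((-1) ^ z * (qFact q (d + k - b + z) * (qFact q (2 * k + 1 + z))⁻¹ * (qFact q z)⁻¹ *
          (qFact q ((n₂ : ℝ) - z))⁻¹) * q ^ ((z : ℝ) * (g - h - f + b + c)))) *
        ((qFact q (c - b - f + k + z))⁻¹ * ((-1) ^ x * (qFact q (k - g + h + z + x) *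
        qFact q (a + h - c + x) * (qFact q (b - e - c + h + x))⁻¹ * (qFact q (2 * h + 1 + x))⁻¹ *
        (qFact q x)⁻¹ * (qFact q ((n₁ : ℝ) - x))⁻¹) * q ^ ((x : ℝ) * (b + f + c - k - z)))) := by
    intro x
    have := congrArg (((-1) ^ x * qFact q (a + h - c + x) * (qFact q x)⁻¹ * (qFact q (2 * h + 1 + x))⁻¹ *
      (qFact q (b - e - c + h + x))⁻¹ *
      (q ^ (-((b + f) * (g + k - h + 1) - (c + g - h) * (k - c))) * q ^ ((x : ℝ) * (b + f + c - k)))) * ·)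
      (hrow x)
    simp only [mul_sum] at this
    refine Eq.trans (sum_congr rfl fun z _ => ?_) (this.trans (sum_congr rfl fun z _ => ?_))
    · rw [hpow, ← h₂, show 2 * h + (x : ℝ) + 1 = 2 * h + 1 + x by ring,
        show 2 * k + (z : ℝ) + 1 = 2 * k + 1 + z by ring]
      ring
    · have hp := hpow' x z
      rw [← h₁, show k - g + h + x + (z : ℝ) = k - g + h + z + x by ring]
      generalize q ^ ((x : ℝ) * (b + f + c - k)) = y₁ at *
      generalize q ^ ((z : ℝ) * (g - h - x - f + b + c)) = y₂ at *
      generalize q ^ ((z : ℝ) * (g - h - f + b + c)) = y₃ at *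
      generalize q ^ ((x : ℝ) * (b + f + c - k - z)) = y₄ at *
      generalize q ^ (-((b + f) * (g + k - h + 1) - (c + g - h) * (k - c))) = y₅ at *
      generalize q ^ ((d + k - b + 1) * (n₂ : ℝ)) = y₆ at *
      linear_combination ((-1) ^ x * qFact q (a + h - c + x) * (qFact q x)⁻¹ * (qFact q (2 * h + 1 + x))⁻¹ *
        (qFact q (b - e - c + h + x))⁻¹ * y₅ * (qFact q (a + c - h - x))⁻¹ * (-1) ^ n₂ * y₆ *
        qFact q (c + d - f) * (qFact q (f + d - c))⁻¹ * (-1) ^ z * qFact q (d + k - b + z) *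
        qFact q (k - g + h + z + x) * (qFact q (2 * k + 1 + z))⁻¹ * (qFact q (c - b - f + k + z))⁻¹ *
        (qFact q z)⁻¹ * (qFact q ((n₂ : ℝ) - z))⁻¹) * hp
  rw [sum_congr rfl fun x _ => hX x, sum_comm, sum_comm (s := range (n₃ + 1)), mul_sum, mul_sum]
  refine sum_congr rfl fun z hz => ?_
  have hz : (z : ℝ) ≤ n₂ := by exact_mod_cast Nat.lt_succ_iff.1 (mem_range.1 hz)
  rw [← mul_sum, ← mul_sum, hcol z (by rwa [h₂])]
  simp only [mul_sum]
  refine sum_congr rfl fun s _ => ?_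
  have i1 : IsInt (c - b - f + k) := isInt_of_half (m := C - B - F + K) (by push_cast; linarith) (by omega)
  rw [show c + k - b - f + (s : ℝ) = c - b - f + k + s by ring, sgn_add i1 (isNat_natCast s).isInt,
    sgn_add i1 (isNat_natCast z).isInt, sgn_natCast, sgn_natCast,
    show k + g + h + 1 = g + h + k + 1 by ring, show a - c + h = a + h - c by ring,
    show e - a + b = b + e - a by ring, show f + c - d = c + f - d by ring,
    show f - c + d = f + d - c by ring, show h + k - g = k + h - g by ring]
  have d1 := mul_inv_cancel₀ (qFact_ne_zero hq (show IsNat (a + c + h + 1) from hach.isNat.2.2.2.2))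
  have d2 := mul_inv_cancel₀ (qFact_ne_zero hq (show IsNat (c + d - f) from hcdf.isNat.1))
  have d3 := mul_inv_cancel₀ (qFact_ne_zero hq (show IsNat (a - b + e) from habe.isNat.2.1))
  have d4 := neg_one_pow_mul_self n₂
  have d5 := neg_one_pow_mul_self z
  have hp := hpow'' s z
  rw [show a + e - b = a - b + e by ring]
  generalize qFact q (a + c + h + 1) = x₁ at *
  generalize qFact q (c + d - f) = x₂ at *
  generalize qFact q (a - b + e) = x₃ at *
  generalize q ^ (zz d + zz e + zz h) = y₁ at *
  generalize q ^ (-((b + f) * (g + k - h + 1) - (c + g - h) * (k - c))) = y₂ at *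
  generalize q ^ ((d + k - b + 1) * (n₂ : ℝ)) = y₃ at *
  generalize q ^ ((z : ℝ) * (g - h - f + b + c)) = y₄ at *
  generalize q ^ ((a + h - c + 1) * (c - b - f + k + z - (a + c - h))) = y₅ at *
  generalize q ^ ((s : ℝ) * (-(a + b - e + 1))) = y₆ at *
  generalize q ^ ((c + d - f) * (a + b - e + 1) -
        (a + b + e + 1) * (b + d - k) + 2 * e * d + (zz a + zz c + zz g + zz k)) = y₇ at *
  generalize q ^ (-(s : ℝ) * (a + b - e + 1) + z * (a + b + e + 1)) = y₈ at *
  generalize (-1 : ℝ) ^ n₂ = u₁ at *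
  generalize (-1 : ℝ) ^ z = u₂ at *
  have hall : u₁ * u₁ * (u₂ * u₂) * (x₁ * x₁⁻¹) * (x₂ * x₂⁻¹) * (x₃ * x₃⁻¹) *
      (y₁ * y₂ * y₃ * y₄ * y₅ * y₆) = y₇ * y₈ := by rw [d1, d2, d3, d4, d5, hp]; ring
  linear_combination (triProd q a b e c d f h k g * (qFact q (g + h + k + 1) * qFact q (b + d + k + 1) *
    (qFact q (a + h - c))⁻¹ * (qFact q (k + h - g))⁻¹ * (qFact q (d + k - b))⁻¹ *
    (qFact q (c + f - d))⁻¹ * (qFact q (b + e - a))⁻¹ * (qFact q (f + d - c))⁻¹ *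
    (qFact q (a + c - h))⁻¹) * sgn (c - b - f + k) * (-1) ^ s *
    (qFact q (2 * c - s) * qFact q (a + h - c + s) * qFact q (d + k - b + z) * (qFact q s)⁻¹ *
        (qFact q ((n₃ : ℝ) - s))⁻¹ * (qFact q z)⁻¹ * (qFact q ((n₂ : ℝ) - z))⁻¹ *
        (qFact q (2 * k + 1 + z))⁻¹ * (qFact q (c - b - f + k + z - s))⁻¹ *
        (qFact q (a + g - c - k - z + s))⁻¹)) * hall

/-! ### Symmetries of (stdK). -/

theorem sum_sum_reflect (φ : ℝ → ℝ → ℝ) (m n : ℕ) :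
    ∑ s ∈ range (m + 1), ∑ z ∈ range (n + 1), (-1) ^ s * (-1) ^ z * φ s z =
    ∑ s ∈ range (m + 1), ∑ z ∈ range (n + 1), (-1) ^ m * (-1) ^ n * (-1) ^ s * (-1) ^ z *
      φ (m - s) (n - z) := by
  rw [← sum_range_reflect]
  refine sum_congr rfl fun s hs => ?_
  rw [← sum_range_reflect]
  refine sum_congr rfl fun z hz => ?_
  have hs := Nat.lt_succ_iff.1 (mem_range.1 hs)
  have hz := Nat.lt_succ_iff.1 (mem_range.1 hz)
  rw [show m + 1 - 1 - s = m - s by omega, show n + 1 - 1 - z = n - z by omega, Nat.cast_sub hs,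
    Nat.cast_sub hz, neg_one_pow_sub hs, neg_one_pow_sub hz]
  ring

theorem nabla_perm₂₃ (q a b c : ℝ) : nabla q a c b = nabla q a b c := by
  rw [nabla, nabla]
  congr 1
  rw [show a + c - b = a - b + c by ring, show a - c + b = a + b - c by ring,
    show c + b - a = b + c - a by ring, show a + c + b + 1 = a + b + c + 1 by ring,
    mul_comm (qFact q (a - b + c))]

theorem nabla_inv_base (hq : 0 < q) (a b c : ℝ) : nabla q⁻¹ a b c = nabla q a b c := by
  simp only [nabla, qFact_inv hq]

/-- The sum of all nine spins exceeds (a + c - h) + (b + d - k) by 2(h + k + g), an even integer. -/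
theorem oddPhase_eq {a b e c d f h k g : ℝ} {n₁ n₂ : ℕ} (hg : g = e + f) (hhkg : IsTriad h k g)
    (h₁ : a + c - h = n₁) (h₂ : b + d - k = n₂) : oddPhase q a b e c d f h k g =
      (-1) ^ n₁ * (-1) ^ n₂ * q ^ ((zz d + zz e + zz h) + (zz b + zz c + zz g) + (zz a + zz f + zz k)) := by
  obtain ⟨m, hm⟩ := hhkg.isNat.2.2.2.1
  rw [oddPhase, ← pow_add, ← sgn_natCast]
  congr 1
  refine sgn_eq_of_half (n := m) ?_ ?_
  · refine ⟨n₁ + n₂ + 2 * m, ?_⟩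
    push_cast
    linarith
  · push_cast
    linarith

/-- Exchanging the columns exchanges the two summation indices; reversing both summations then
restores the original factorials, and the powers of q agree after q → q⁻¹ up to a constant. -/
theorem sumK_swap_columns (hq : 0 < q) {a b e c d f h k g : ℝ} {n₁ n₂ : ℕ}
    (h₁ : a + c - h = n₁) (h₂ : b + d - k = n₂) :
    sumK q⁻¹ b a e d c f k h g = (-1) ^ n₁ * (-1) ^ n₂ * q ^ ((a + c - h) * (g + h - k + 1) +
      (b + d - k) * (g - h + k + 1)) * sumK q a b e c d f h k g := by
  have hr := sum_sum_reflect (fun z s => (-1) ^ n₁ * (-1) ^ n₂ *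
    q ^ (s * (g + k - h + 1) + z * (g - k + h + 1)) *
      ((qFact q s)⁻¹ * (qFact q (n₂ - s))⁻¹ * (qFact q z)⁻¹ * (qFact q (n₁ - z))⁻¹ *
        qFact q (2 * b - s) * qFact q (d + k - b + s) * qFact q (2 * c - z) * qFact q (a - c + h + z) *
        (qFact q (c - b - f + k + s - z))⁻¹ * (qFact q (b - c - e + h - s + z))⁻¹)) n₁ n₂
  rw [sumK_eq _ h₂ h₁, sumK_eq _ h₁ h₂, sum_comm, mul_sum]
  refine Eq.trans (sum_congr rfl fun z _ => sum_congr rfl fun s _ => ?_) (hr.trans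
    (sum_congr rfl fun s _ => ?_))
  · simp only [qFact_inv hq, inv_rpow_eq hq]
    rw [h₁, h₂, show -(-(s : ℝ) * (g + k - h + 1) - z * (g - k + h + 1)) =
      s * (g + k - h + 1) + z * (g - k + h + 1) by ring]
    ring
  · rw [mul_sum]
    refine sum_congr rfl fun z _ => ?_
    have hp : q ^ ((a + c - h) * (g + h - k + 1) + (b + d - k) * (g - h + k + 1)) *
        q ^ (-(s : ℝ) * (g + h - k + 1) - z * (g - h + k + 1)) =
        q ^ (((n₂ : ℝ) - z) * (g + k - h + 1) + ((n₁ : ℝ) - s) * (g - k + h + 1)) := by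
      rw [← Real.rpow_add hq, ← h₁, ← h₂]; congr 1; ring
    rw [← hp, ← h₁, ← h₂, show 2 * b - (b + d - k - z) = b - d + k + z by ring,
      show d + k - b + (b + d - k - z) = 2 * d - (z : ℝ) by ring,
      show 2 * c - (a + c - h - s) = c + h - a + (s : ℝ) by ring,
      show a - c + h + (a + c - h - s) = 2 * a - (s : ℝ) by ring,
      show c - b - f + k + (b + d - k - z) - (a + c - h - s) = d - a - f + h + s - (z : ℝ) by ring,
      show b - c - e + h - (b + d - k - z) + (a + c - h - s) = a - d - e + k - s + (z : ℝ) by ring,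
      sub_sub_cancel, sub_sub_cancel]
    ring

/-- Reversal of both summations, this time with the indices keeping their roles. -/
theorem sumK_swap_rows (hq : 0 < q) {a b e c d f h k g : ℝ} {n₁ n₂ : ℕ}
    (h₁ : a + c - h = n₁) (h₂ : b + d - k = n₂) :
    sumK q⁻¹ c d f a b e h k g = (-1) ^ n₁ * (-1) ^ n₂ * q ^ ((a + c - h) * (g + h - k + 1) +
      (b + d - k) * (g - h + k + 1)) * sumK q a b e c d f h k g := by
  have hr := sum_sum_reflect (fun s z => (-1) ^ n₁ * (-1) ^ n₂ *
    q ^ (s * (g + h - k + 1) + z * (g - h + k + 1)) *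
      ((qFact q s)⁻¹ * (qFact q (n₁ - s))⁻¹ * (qFact q z)⁻¹ * (qFact q (n₂ - z))⁻¹ *
        qFact q (2 * c - s) * qFact q (a + h - c + s) * qFact q (2 * b - z) * qFact q (d - b + k + z) *
        (qFact q (b - c - e + h + s - z))⁻¹ * (qFact q (c - b - f + k - s + z))⁻¹)) n₁ n₂
  rw [sumK_eq _ ((add_comm c a ▸ rfl : c + a - h = a + c - h).trans h₁)
    ((add_comm d b ▸ rfl : d + b - k = b + d - k).trans h₂), sumK_eq _ h₁ h₂, mul_sum]
  refine Eq.trans (sum_congr rfl fun z _ => sum_congr rfl fun s _ => ?_) (hr.trans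
    (sum_congr rfl fun s _ => ?_))
  · simp only [qFact_inv hq, inv_rpow_eq hq]
    rw [add_comm c a, add_comm d b, h₁, h₂, show -(-(z : ℝ) * (g + h - k + 1) - s * (g - h + k + 1)) =
      z * (g + h - k + 1) + s * (g - h + k + 1) by ring]
    ring
  · rw [mul_sum]
    refine sum_congr rfl fun z _ => ?_
    have hp : q ^ ((a + c - h) * (g + h - k + 1) + (b + d - k) * (g - h + k + 1)) *
        q ^ (-(s : ℝ) * (g + h - k + 1) - z * (g - h + k + 1)) =
        q ^ (((n₁ : ℝ) - s) * (g + h - k + 1) + ((n₂ : ℝ) - z) * (g - h + k + 1)) := by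
      rw [← Real.rpow_add hq, ← h₁, ← h₂]; congr 1; ring
    rw [← hp, ← h₁, ← h₂, show 2 * b - (b + d - k - z) = b - d + k + z by ring,
      show d - b + k + (b + d - k - z) = 2 * d - (z : ℝ) by ring,
      show 2 * c - (a + c - h - s) = c + h - a + (s : ℝ) by ring,
      show a + h - c + (a + c - h - s) = 2 * a - (s : ℝ) by ring,
      show c - b - f + k - (a + c - h - s) + (b + d - k - z) = d - a - f + h + s - (z : ℝ) by ring,
      show b - c - e + h + (a + c - h - s) - (b + d - k - z) = a - d - e + k - s + (z : ℝ) by ring,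
      sub_sub_cancel, sub_sub_cancel]
    ring

theorem exprK_swap_columns (hq : 0 < q) {a b e c d f h k g : ℝ} (hg : g = e + f)
    (hhkg : IsTriad h k g) (hach : IsTriad a c h) (hbdk : IsTriad b d k) :
    exprK q a b e c d f h k g = oddPhase q a b e c d f h k g * exprK q⁻¹ b a e d c f k h g := by
  obtain ⟨n₁, h₁⟩ := hach.isNat.1
  obtain ⟨n₂, h₂⟩ := hbdk.isNat.1
  have hp : q ^ ((zz d + zz e + zz h) + (zz b + zz c + zz g) + (zz a + zz f + zz k)) *
      q ^ (-((a + c - h) * (b + a + f - k + h + 1) - (b + a - e) * (b + c + f - k) + 2 * b * f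
        + (zz a + zz c + zz g + zz k))) * q ^ ((a + c - h) * (g + h - k + 1) +
      (b + d - k) * (g - h + k + 1)) = q ^ ((b + d - k) * (a + b + f - h + k + 1) -
      (a + b - e) * (a + d + f - h) + 2 * a * f + (zz b + zz d + zz g + zz h)) := by
    rw [← Real.rpow_add hq, ← Real.rpow_add hq]; congr 1; simp only [zz]; rw [hg]; ring
  rw [oddPhase_eq hg hhkg h₁ h₂, exprK, exprK, sumK_swap_columns hq h₁ h₂, ← hp]
  simp only [nabla_inv_base hq, qFact_inv hq, inv_rpow_eq hq]
  rw [nabla_perm₂₃ q f c d, nabla_perm₂₃ q e a b,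
    show qFact q (2 * e) * qFact q (2 * f) * qFact q (k + h - g) * qFact q (g - k + h) *
      qFact q (g + k - h) * qFact q (g + k + h + 1) = qFact q (2 * e) * qFact q (2 * f) *
      qFact q (h + k - g) * qFact q (g - h + k) * qFact q (g + h - k) * qFact q (g + h + k + 1) by
      rw [show k + h - g = h + k - g by ring, show g - k + h = g + h - k by ring,
        show g + k - h = g - h + k by ring, show g + k + h + 1 = g + h + k + 1 by ring]; ring,
    show Real.sqrt (qFact q (2 * g + 1)) * nabla q k b d * nabla q f c d * nabla q e a b * nabla q h a c =
      Real.sqrt (qFact q (2 * g + 1)) * nabla q h a c * nabla q f c d * nabla q e a b * nabla q k b d by ring]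
  have s1 := neg_one_pow_mul_self n₁
  have s2 := neg_one_pow_mul_self n₂
  generalize (-1 : ℝ) ^ n₁ = u₁ at *
  generalize (-1 : ℝ) ^ n₂ = u₂ at *
  generalize Real.sqrt _ / _ = w
  generalize q ^ ((zz d + zz e + zz h) + (zz b + zz c + zz g) + (zz a + zz f + zz k)) = y₁
  generalize q ^ (-((a + c - h) * (b + a + f - k + h + 1) - (b + a - e) * (b + c + f - k) + 2 * b * f
        + (zz a + zz c + zz g + zz k))) = y₂
  generalize q ^ ((a + c - h) * (g + h - k + 1) + (b + d - k) * (g - h + k + 1)) = y₃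
  linear_combination (-(w * y₁ * y₂ * y₃ * sumK q a b e c d f h k g)) * (s1 * (u₂ * u₂) + s2)

theorem exprK_swap_rows (hq : 0 < q) {a b e c d f h k g : ℝ} (hg : g = e + f)
    (hhkg : IsTriad h k g) (hach : IsTriad a c h) (hbdk : IsTriad b d k) :
    exprK q a b e c d f h k g = oddPhase q a b e c d f h k g * exprK q⁻¹ c d f a b e h k g := by
  obtain ⟨n₁, h₁⟩ := hach.isNat.1
  obtain ⟨n₂, h₂⟩ := hbdk.isNat.1
  have hp : q ^ ((zz d + zz e + zz h) + (zz b + zz c + zz g) + (zz a + zz f + zz k)) *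
      q ^ (-((d + b - k) * (c + d + e - h + k + 1) - (c + d - f) * (c + b + e - h) + 2 * c * e
        + (zz d + zz b + zz g + zz h))) * q ^ ((a + c - h) * (g + h - k + 1) +
      (b + d - k) * (g - h + k + 1)) = q ^ ((b + d - k) * (a + b + f - h + k + 1) -
      (a + b - e) * (a + d + f - h) + 2 * a * f + (zz b + zz d + zz g + zz h)) := by
    rw [← Real.rpow_add hq, ← Real.rpow_add hq]; congr 1; simp only [zz]; rw [hg]; ring
  rw [oddPhase_eq hg hhkg h₁ h₂, exprK, exprK, sumK_swap_rows hq h₁ h₂, ← hp]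
  simp only [nabla_inv_base hq, qFact_inv hq, inv_rpow_eq hq]
  rw [nabla_perm₂₃ q h a c, nabla_perm₂₃ q k b d, mul_comm (qFact q (2 * f)),
    show Real.sqrt (qFact q (2 * g + 1)) * nabla q h a c * nabla q e a b * nabla q f c d * nabla q k b d =
      Real.sqrt (qFact q (2 * g + 1)) * nabla q h a c * nabla q f c d * nabla q e a b * nabla q k b d by ring]
  have s1 := neg_one_pow_mul_self n₁
  have s2 := neg_one_pow_mul_self n₂
  generalize (-1 : ℝ) ^ n₁ = u₁ at *
  generalize (-1 : ℝ) ^ n₂ = u₂ at *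
  generalize Real.sqrt _ / _ = w
  generalize q ^ ((zz d + zz e + zz h) + (zz b + zz c + zz g) + (zz a + zz f + zz k)) = y₁
  generalize q ^ (-((d + b - k) * (c + d + e - h + k + 1) - (c + d - f) * (c + b + e - h) + 2 * c * e
        + (zz d + zz b + zz g + zz h))) = y₂
  generalize q ^ ((a + c - h) * (g + h - k + 1) + (b + d - k) * (g - h + k + 1)) = y₃
  linear_combination (-(w * y₁ * y₂ * y₃ * sumK q a b e c d f h k g)) * (s1 * (u₂ * u₂) + s2)

/-! ### Kampé de Fériet forms. -/

theorem qPoch_neg_eq (hq : 0 < q) {W : ℝ} (hW : IsNat W) (x : ℕ) :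
    qPoch q (-W) x = (-1) ^ x * (qFact q W * (qFact q (W - x))⁻¹) := by
  have h1 := neg_one_pow_mul_self x
  have h2 := mul_inv_cancel₀ (qFact_ne_zero hq hW)
  rw [qFact_sub_upper hq hW x x le_rfl]
  linear_combination (-(qPoch q (-W) x)) * (h1 * (qFact q W * (qFact q W)⁻¹) + h2)

theorem qPoch_add_one_eq (hq : 0 < q) {U : ℝ} (hU : IsNat U) (x : ℕ) :
    qPoch q (U + 1) x = (qFact q U)⁻¹ * qFact q (U + x) := by
  rw [qFact_add_natCast q hU, inv_mul_cancel_left₀ (qFact_ne_zero hq hU)]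

theorem inv_neg_one_pow (n : ℕ) : ((-1 : ℝ) ^ n)⁻¹ = (-1) ^ n := by
  rw [← inv_pow]; norm_num

/-- [G]! (G+1|q)_{s+t} = [G+s+t]!, so for a natural number G the regularized series is the ordinary
one divided by [G]!. -/
theorem qKdF_eq_qKdFReg (hq : 0 < q) (ε : ℝ) (A B D B' D' : List ℝ) {G : ℝ} (hG : IsNat G) :
    qKdF ε q A [G + 1] B D B' D' = qFact q G * qKdFReg ε q A [G + 1] B D B' D' := by
  rw [qKdF, qKdFReg, ← tsum_mul_left]
  refine tsum_congr fun st => ?_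
  have h := qFact_add_natCast q hG (st.1 + st.2)
  have h0 := qFact_ne_zero hq hG
  have hx : qPochs q [G + 1] (st.1 + st.2) = (qFact q G)⁻¹ * qFact q (G + (st.1 + st.2 : ℕ)) := by
    rw [← qPoch_add_one_eq hq hG]; simp [qPochs]
  have hy : (List.map (fun c => qFact q (c + st.1 + st.2 - 1)) [G + 1]).prod =
      qFact q (G + (st.1 + st.2 : ℕ)) := by
    rw [List.map_singleton, List.prod_singleton]; congr 1; push_cast; ring
  rw [hx, hy]
  simp only [div_eq_mul_inv, mul_inv, inv_inv]
  ring

/-- The parameters -n₁ and -n₂ terminate the two summations, and (-P)_{s+t} becomes 1/[P-s-t]!. The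
remaining Pochhammer quotients enter as given functions φ₁, φ₂, so that one statement serves all
four double sums. G may be negative. -/
theorem qKdFReg_eq (hq : 0 < q) (ε : ℝ) {P G β₁ β₂ δ₁ δ₂ κ₁ κ₂ X Y : ℝ} {n₁ n₂ : ℕ} {φ₁ φ₂ : ℕ → ℝ}
    (hP : IsNat P) (h₁ : ∀ s, qPoch q β₁ s * (qPoch q δ₁ s)⁻¹ = κ₁ * φ₁ s)
    (h₂ : ∀ t, qPoch q β₂ t * (qPoch q δ₂ t)⁻¹ = κ₂ * φ₂ t)
    (hX : X = ε * (-P - n₁ + β₁ - G - δ₁)) (hY : Y = -ε * (-P - n₂ + β₂ - G - δ₂)) :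
    qKdFReg ε q [-P] [G + 1] [-(n₁ : ℝ), β₁] [δ₁] [-(n₂ : ℝ), β₂] [δ₂] =
      κ₁ * κ₂ * (qFact q P * qFact q n₁ * qFact q n₂) * ∑ s ∈ range (n₁ + 1), ∑ t ∈ range (n₂ + 1),
        ((qFact q (P - s - t))⁻¹ * (qFact q (G + s + t))⁻¹ * ((qFact q ((n₁ : ℝ) - s))⁻¹ * φ₁ s *
          (qFact q s)⁻¹) * ((qFact q ((n₂ : ℝ) - t))⁻¹ * φ₂ t * (qFact q t)⁻¹)) *
          q ^ (s * X + t * Y) := by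
  have hterm : ∀ st : ℕ × ℕ, qPochs q [-P] (st.1 + st.2) /
      (List.map (fun c => qFact q (c + st.1 + st.2 - 1)) [G + 1]).prod *
      (qPochs q [-(n₁ : ℝ), β₁] st.1 * qPochs q [-(n₂ : ℝ), β₂] st.2 /
        (qPochs q [δ₁] st.1 * qPochs q [δ₂] st.2)) *
      (kdfPower ε q [-P] [G + 1] [-(n₁ : ℝ), β₁] [δ₁] [-(n₂ : ℝ), β₂] [δ₂] st.1 st.2 /
        (qFact q st.1 * qFact q st.2)) =
      κ₁ * κ₂ * (qFact q P * qFact q n₁ * qFact q n₂) *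
        (((qFact q (P - st.1 - st.2))⁻¹ * (qFact q (G + st.1 + st.2))⁻¹ *
          ((qFact q ((n₁ : ℝ) - st.1))⁻¹ * φ₁ st.1 * (qFact q st.1)⁻¹) *
          ((qFact q ((n₂ : ℝ) - st.2))⁻¹ * φ₂ st.2 * (qFact q st.2)⁻¹)) * q ^ (st.1 * X + st.2 * Y)) := by
    rintro ⟨s, t⟩
    -- There is one upper and one lower joint parameter, so δ = 1: the exponent of y has the sign
    -- opposite to that of x, and the mixed power in s t is absent.
    have hk : kdfPower ε q [-P] [G + 1] [-(n₁ : ℝ), β₁] [δ₁] [-(n₂ : ℝ), β₂] [δ₂] s t =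
        q ^ (s * X + t * Y) := by
      simp only [kdfPower, List.sum_cons, List.sum_nil, List.length_singleton, if_true]
      rw [← Real.rpow_mul hq.le, ← Real.rpow_mul hq.le, ← Real.rpow_add hq, ← Real.rpow_add hq]
      congr 1
      rw [hX, hY]; push_cast; ring
    have e1 : qPochs q [-P] (s + t) = (-1) ^ s * (-1) ^ t * (qFact q P * (qFact q (P - s - t))⁻¹) := by
      rw [qPochs, List.map_singleton, List.prod_singleton, qPoch_neg_eq hq hP, pow_add]
      push_cast; rw [sub_sub]
    have e2 : qPochs q [-(n₁ : ℝ), β₁] s * (qPochs q [δ₁] s)⁻¹ =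
        (-1) ^ s * (qFact q n₁ * (qFact q ((n₁ : ℝ) - s))⁻¹) * (κ₁ * φ₁ s) := by
      simp only [qPochs, List.map_cons, List.map_nil, List.prod_cons, List.prod_nil, mul_one]
      rw [qPoch_neg_eq hq (isNat_natCast n₁), mul_assoc, h₁]
    have e3 : qPochs q [-(n₂ : ℝ), β₂] t * (qPochs q [δ₂] t)⁻¹ =
        (-1) ^ t * (qFact q n₂ * (qFact q ((n₂ : ℝ) - t))⁻¹) * (κ₂ * φ₂ t) := by
      simp only [qPochs, List.map_cons, List.map_nil, List.prod_cons, List.prod_nil, mul_one]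
      rw [qPoch_neg_eq hq (isNat_natCast n₂), mul_assoc, h₂]
    have e4 : (List.map (fun c => qFact q (c + s + t - 1)) [G + 1]).prod = qFact q (G + s + t) := by
      rw [List.map_singleton, List.prod_singleton]; congr 1; ring
    simp only [hk, e1, e4]
    rw [div_eq_mul_inv, mul_div_mul_comm, div_eq_mul_inv (qPochs _ _ s), div_eq_mul_inv (qPochs _ _ t),
      e2, e3, div_eq_mul_inv, mul_inv]
    have s1 := neg_one_pow_mul_self s
    have s2 := neg_one_pow_mul_self t
    generalize (-1 : ℝ) ^ s = u₁ at *
    generalize (-1 : ℝ) ^ t = u₂ at *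
    generalize q ^ (s * X + t * Y) = y
    linear_combination (κ₁ * κ₂ * (qFact q P * qFact q n₁ * qFact q n₂) *
        (((qFact q (P - s - t))⁻¹ * (qFact q (G + s + t))⁻¹ *
          ((qFact q ((n₁ : ℝ) - s))⁻¹ * φ₁ s * (qFact q s)⁻¹) *
          ((qFact q ((n₂ : ℝ) - t))⁻¹ * φ₂ t * (qFact q t)⁻¹)) * y)) * (s1 * (u₂ * u₂) + s2)
  rw [qKdFReg, tsum_congr hterm, tsum_mul_left, tsum_eq_sum (s := range (n₁ + 1) ×ˢ range (n₂ + 1)),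
    sum_product]
  rintro ⟨s, t⟩ hst
  simp only [mem_product, mem_range, not_and_or, not_lt] at hst
  rcases hst with h | h
  · rw [qFact_inv_of_neg q (x := (n₁ : ℝ) - s)]
    · simp only [mul_zero, zero_mul]
    · have : ((n₁ + 1 : ℕ) : ℝ) ≤ s := Nat.cast_le.2 h
      push_cast at this; linarith
  · rw [qFact_inv_of_neg q (x := (n₂ : ℝ) - t)]
    · simp only [mul_zero, zero_mul]
    · have : ((n₂ + 1 : ℕ) : ℝ) ≤ t := Nat.cast_le.2 h
      push_cast at this; linarith

/-- Valid for every s: beyond s = V the Pochhammer symbol in the denominator is 0, and so is [V-s]!.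
-/
theorem qPoch_ratio_add_sub (hq : 0 < q) {U V : ℝ} (hU : IsNat U) (hV : IsNat V) (s : ℕ) :
    qPoch q (U + 1) s * (qPoch q (-V) s)⁻¹ =
      ((qFact q U)⁻¹ * (qFact q V)⁻¹) * ((-1) ^ s * (qFact q (U + s) * qFact q (V - s))) := by
  rw [qPoch_add_one_eq hq hU, qPoch_neg_eq hq hV, mul_inv, mul_inv, inv_inv, inv_neg_one_pow]
  ring

theorem qPoch_ratio_sub_sub (hq : 0 < q) {W V : ℝ} (hW : IsNat W) (hV : IsNat V) (s : ℕ) :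
    qPoch q (-W) s * (qPoch q (-V) s)⁻¹ =
      (qFact q W * (qFact q V)⁻¹) * ((qFact q (W - s))⁻¹ * qFact q (V - s)) := by
  rw [qPoch_neg_eq hq hW, qPoch_neg_eq hq hV, mul_inv, mul_inv, inv_inv, inv_neg_one_pow]
  linear_combination (qFact q W * (qFact q (W - s))⁻¹ * ((qFact q V)⁻¹ * qFact q (V - s))) *
    neg_one_pow_mul_self s

theorem qPoch_ratio_add_add (hq : 0 < q) {U C : ℝ} (hU : IsNat U) (hC : IsNat C) (s : ℕ) :
    qPoch q (U + 1) s * (qPoch q (C + 1) s)⁻¹ =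
      ((qFact q U)⁻¹ * qFact q C) * (qFact q (U + s) * (qFact q (C + s))⁻¹) := by
  rw [qPoch_add_one_eq hq hU, qPoch_add_one_eq hq hC, mul_inv, inv_inv]
  ring

/-- Reflection of the summation in a finite sum of `n + 1` terms. -/
theorem sum_range_succ_reflect {f g : ℕ → ℝ} {n : ℕ} (h : ∀ t ≤ n, f (n - t) = g t) :
    ∑ z ∈ range (n + 1), f z = ∑ t ∈ range (n + 1), g t := by
  rw [← sum_range_reflect]
  refine sum_congr rfl fun t ht => ?_
  have ht := Nat.lt_succ_iff.1 (mem_range.1 ht)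
  rw [show n + 1 - 1 - t = n - t by omega, h t ht]

/-- The substitution z = b + d - k - t makes the last two factorials depend on s + t only, as
[h+k-a-b-f+s+t]! and [a+b-e-s-t]!. -/
theorem sumK_eq_qKdFReg_neg (hq : 0 < q) {a b e c d f h k g : ℝ} {A B E C D F H K : ℤ}
    (S : Spins a b e c d f h k g A B E C D F H K) :
    sumK q a b e c d f h k g =
      sgn (a + c - h) * q ^ (-(b + d - k) * (g - h + k + 1)) *
        (qFact q (2 * a) * qFact q (c + h - a) * qFact q (2 * b) * qFact q (d - b + k)) /
        (qFact q (a + c - h) * qFact q (b + d - k) * qFact q (a + b - e)) *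
        qKdFReg (-1) q [-(a + b - e)] [h + k - a - b - f + 1]
          [-(a + c - h), c + h - a + 1] [-(2 * a)]
          [-(b + d - k), d - b + k + 1] [-(2 * b)] := by
  obtain ⟨a2, b2, e2, c2, d2, f2, h2, k2, g_eq, abe, cdf, ach, bdk, hkg⟩ := S
  obtain ⟨n₁, h₁⟩ := isNat_of_half (x := a + c - h) (m := A + C - H) (by push_cast; linarith) (by omega) (by omega)
  obtain ⟨n₂, h₂⟩ := isNat_of_half (x := b + d - k) (m := B + D - K) (by push_cast; linarith) (by omega) (by omega)
  have i1 := isNat_of_half (x := a + b - e) (m := A + B - E) (by push_cast; linarith) (by omega) (by omega)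
  have i2 := isNat_of_half (x := c + h - a) (m := C + H - A) (by push_cast; linarith) (by omega) (by omega)
  have i3 := isNat_of_half (x := 2 * a) (m := 2 * A) (by push_cast; linarith) (by omega) (by omega)
  have i4 := isNat_of_half (x := d - b + k) (m := D - B + K) (by push_cast; linarith) (by omega) (by omega)
  have i5 := isNat_of_half (x := 2 * b) (m := 2 * B) (by push_cast; linarith) (by omega) (by omega)
  have i6 : IsNat (a + c - h) := ⟨n₁, h₁⟩
  have i7 : IsNat (b + d - k) := ⟨n₂, h₂⟩
  rw [sumK_eq q h₁ h₂, show -(a + c - h) = -(n₁ : ℝ) by rw [h₁], show -(b + d - k) = -(n₂ : ℝ) by rw [h₂],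
    qKdFReg_eq hq (-1) i1 (qPoch_ratio_add_sub hq i2 i3) (qPoch_ratio_add_sub hq i4 i5)
      (X := -(g + h - k + 1)) (Y := g - h + k + 1) (by rw [← h₁, g_eq]; ring) (by rw [← h₂, g_eq]; ring),
    show sgn (a + c - h) = (-1) ^ n₁ by rw [h₁, sgn_natCast]]
  simp only [mul_sum]
  refine sum_congr rfl fun s _ => ?_
  refine sum_range_succ_reflect fun t ht => ?_
  have hp : q ^ (-(s : ℝ) * (g + h - k + 1) - ((n₂ : ℝ) - t) * (g - h + k + 1)) =
      q ^ (-(n₂ : ℝ) * (g - h + k + 1)) * q ^ (s * -(g + h - k + 1) + t * (g - h + k + 1)) := by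
    rw [← Real.rpow_add hq]; congr 1; ring
  rw [Nat.cast_sub ht, neg_one_pow_sub ht, hp, ← h₁, ← h₂,
    show 2 * d - (b + d - k - t) = d - b + k + (t : ℝ) by ring,
    show b - d + k + (b + d - k - t) = 2 * b - (t : ℝ) by ring,
    show d - a - f + h + s - (b + d - k - t) = h + k - a - b - f + s + (t : ℝ) by ring,
    show a - d - e + k - s + (b + d - k - t) = a + b - e - s - (t : ℝ) by ring, sub_sub_cancel,
    div_eq_mul_inv, mul_inv, mul_inv]
  have c0 := mul_inv_cancel₀ (qFact_ne_zero hq i1)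
  have c1 := mul_inv_cancel₀ (qFact_ne_zero hq i2)
  have c2 := mul_inv_cancel₀ (qFact_ne_zero hq i3)
  have c3 := mul_inv_cancel₀ (qFact_ne_zero hq i4)
  have c4 := mul_inv_cancel₀ (qFact_ne_zero hq i5)
  have c5 := mul_inv_cancel₀ (qFact_ne_zero hq i6)
  have c6 := mul_inv_cancel₀ (qFact_ne_zero hq i7)
  have s1 := neg_one_pow_mul_self n₂
  generalize qFact q (a + b - e) = x0 at *
  generalize qFact q (c + h - a) = x1 at *
  generalize qFact q (2 * a) = x2 at *
  generalize qFact q (d - b + k) = x3 at *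
  generalize qFact q (2 * b) = x4 at *
  generalize qFact q (a + c - h) = x5 at *
  generalize qFact q (b + d - k) = x6 at *
  generalize (-1 : ℝ) ^ n₂ = u at *
  have hall : (x0 * x0⁻¹) * (x1 * x1⁻¹) * (x2 * x2⁻¹) * (x3 * x3⁻¹) * (x4 * x4⁻¹) * (x5 * x5⁻¹) * (x6 * x6⁻¹) = 1 := by rw [c0, c1, c2, c3, c4, c5, c6]; norm_num
  linear_combination ((-1) ^ n₁ * (-1) ^ s * (-1) ^ t * q ^ (-(b + d - k) * (g - h + k + 1)) *
    q ^ (s * -(g + h - k + 1) + t * (g - h + k + 1)) *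
    ((qFact q s)⁻¹ * (qFact q (a + c - h - s))⁻¹ * (qFact q (b + d - k - t))⁻¹ * (qFact q t)⁻¹ *
      qFact q (2 * a - s) * qFact q (c + h - a + s) * qFact q (d - b + k + t) * qFact q (2 * b - t) *
      (qFact q (h + k - a - b - f + s + t))⁻¹ * (qFact q (a + b - e - s - t))⁻¹)) * (s1 - hall)

/-- Here s is replaced by a + c - h - s; the coupling factorials become [c+d-f-s-t]! and
[h+k-c-d-e+s+t]!. -/
theorem sumK_eq_qKdFReg_pos (hq : 0 < q) {a b e c d f h k g : ℝ} {A B E C D F H K : ℤ}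
    (S : Spins a b e c d f h k g A B E C D F H K) :
    sumK q a b e c d f h k g =
        sgn (b + d - k) * q ^ (-(a + c - h) * (g + h - k + 1)) *
          (qFact q (2 * c) * qFact q (a + h - c) * qFact q (2 * d) * qFact q (b - d + k)) /
          (qFact q (a + c - h) * qFact q (b + d - k) * qFact q (c + d - f)) *
          qKdFReg 1 q [-(c + d - f)] [h + k - c - d - e + 1]
            [-(a + c - h), a + h - c + 1] [-(2 * c)]
            [-(b + d - k), b - d + k + 1] [-(2 * d)] := by
  obtain ⟨a2, b2, e2, c2, d2, f2, h2, k2, g_eq, abe, cdf, ach, bdk, hkg⟩ := S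
  obtain ⟨n₁, h₁⟩ := isNat_of_half (x := a + c - h) (m := A + C - H) (by push_cast; linarith) (by omega) (by omega)
  obtain ⟨n₂, h₂⟩ := isNat_of_half (x := b + d - k) (m := B + D - K) (by push_cast; linarith) (by omega) (by omega)
  have i1 := isNat_of_half (x := c + d - f) (m := C + D - F) (by push_cast; linarith) (by omega) (by omega)
  have i2 := isNat_of_half (x := a + h - c) (m := A + H - C) (by push_cast; linarith) (by omega) (by omega)
  have i3 := isNat_of_half (x := 2 * c) (m := 2 * C) (by push_cast; linarith) (by omega) (by omega)
  have i4 := isNat_of_half (x := b - d + k) (m := B - D + K) (by push_cast; linarith) (by omega) (by omega)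
  have i5 := isNat_of_half (x := 2 * d) (m := 2 * D) (by push_cast; linarith) (by omega) (by omega)
  have i6 : IsNat (a + c - h) := ⟨n₁, h₁⟩
  have i7 : IsNat (b + d - k) := ⟨n₂, h₂⟩
  rw [sumK_eq q h₁ h₂, show -(a + c - h) = -(n₁ : ℝ) by rw [h₁], show -(b + d - k) = -(n₂ : ℝ) by rw [h₂],
    qKdFReg_eq hq 1 i1 (qPoch_ratio_add_sub hq i2 i3) (qPoch_ratio_add_sub hq i4 i5)
      (X := g + h - k + 1) (Y := -(g - h + k + 1)) (by rw [← h₁, g_eq]; ring) (by rw [← h₂, g_eq]; ring),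
    show sgn (b + d - k) = (-1) ^ n₂ by rw [h₂, sgn_natCast]]
  simp only [mul_sum]
  refine sum_range_succ_reflect fun s hs => sum_congr rfl fun t _ => ?_
  have hp : q ^ (-((n₁ : ℝ) - s) * (g + h - k + 1) - t * (g - h + k + 1)) =
      q ^ (-(n₁ : ℝ) * (g + h - k + 1)) * q ^ (s * (g + h - k + 1) + t * -(g - h + k + 1)) := by
    rw [← Real.rpow_add hq]; congr 1; ring
  rw [Nat.cast_sub hs, neg_one_pow_sub hs, hp, ← h₁, ← h₂,
    show 2 * a - (a + c - h - s) = a + h - c + (s : ℝ) by ring,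
    show c + h - a + (a + c - h - s) = 2 * c - (s : ℝ) by ring,
    show d - a - f + h + (a + c - h - s) - t = c + d - f - s - (t : ℝ) by ring,
    show a - d - e + k - (a + c - h - s) + t = h + k - c - d - e + s + (t : ℝ) by ring, sub_sub_cancel,
    div_eq_mul_inv, mul_inv, mul_inv]
  have c0 := mul_inv_cancel₀ (qFact_ne_zero hq i1)
  have c1 := mul_inv_cancel₀ (qFact_ne_zero hq i2)
  have c2 := mul_inv_cancel₀ (qFact_ne_zero hq i3)
  have c3 := mul_inv_cancel₀ (qFact_ne_zero hq i4)
  have c4 := mul_inv_cancel₀ (qFact_ne_zero hq i5)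
  have c5 := mul_inv_cancel₀ (qFact_ne_zero hq i6)
  have c6 := mul_inv_cancel₀ (qFact_ne_zero hq i7)
  have s1 := neg_one_pow_mul_self n₁
  generalize qFact q (c + d - f) = x0 at *
  generalize qFact q (a + h - c) = x1 at *
  generalize qFact q (2 * c) = x2 at *
  generalize qFact q (b - d + k) = x3 at *
  generalize qFact q (2 * d) = x4 at *
  generalize qFact q (a + c - h) = x5 at *
  generalize qFact q (b + d - k) = x6 at *
  generalize (-1 : ℝ) ^ n₁ = u at *
  have hall : (x0 * x0⁻¹) * (x1 * x1⁻¹) * (x2 * x2⁻¹) * (x3 * x3⁻¹) * (x4 * x4⁻¹) * (x5 * x5⁻¹) * (x6 * x6⁻¹) = 1 := by rw [c0, c1, c2, c3, c4, c5, c6]; norm_num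
  linear_combination ((-1) ^ n₂ * (-1) ^ s * (-1) ^ t * q ^ (-(a + c - h) * (g + h - k + 1)) *
    q ^ (s * (g + h - k + 1) + t * -(g - h + k + 1)) *
    ((qFact q s)⁻¹ * (qFact q (a + c - h - s))⁻¹ * (qFact q (b + d - k - t))⁻¹ * (qFact q t)⁻¹ *
      qFact q (a + h - c + s) * qFact q (2 * c - s) * qFact q (2 * d - t) * qFact q (b - d + k + t) *
      (qFact q (c + d - f - s - t))⁻¹ * (qFact q (h + k - c - d - e + s + t))⁻¹)) * (s1 - hall)

/-- Again z is reversed. The factor [2k+1+z]! then decreases in t and supplies the second negative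
parameter -(b+d+k+1). -/
theorem sumK'_eq_qKdFReg_neg (hq : 0 < q) {a b e c d f h k g : ℝ} {A B E C D F H K : ℤ}
    (S : Spins a b e c d f h k g A B E C D F H K) :
    sumK' q a b e c d f h k g =
      sgn (c + k - b - f) * q ^ ((b + d - k) * (a + b + e + 1)) *
        (qFact q (2 * c) * qFact q (a + h - c) * qFact q (2 * d)) /
        (qFact q (c + h - a) * qFact q (b + d - k) * qFact q (b + d + k + 1) *
          qFact q (c + d - f)) *
        qKdFReg (-1) q [-(c + d - f)] [a + g - b - c - d + 1]
          [-(c + h - a), a + h - c + 1] [-(2 * c)]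
          [-(b + d - k), -(b + d + k + 1)] [-(2 * d)] := by
  obtain ⟨a2, b2, e2, c2, d2, f2, h2, k2, g_eq, abe, cdf, ach, bdk, hkg⟩ := S
  obtain ⟨n₁, h₁⟩ := isNat_of_half (x := c + h - a) (m := C + H - A) (by push_cast; linarith) (by omega) (by omega)
  obtain ⟨n₂, h₂⟩ := isNat_of_half (x := b + d - k) (m := B + D - K) (by push_cast; linarith) (by omega) (by omega)
  have i1 := isNat_of_half (x := c + d - f) (m := C + D - F) (by push_cast; linarith) (by omega) (by omega)
  have i2 := isNat_of_half (x := a + h - c) (m := A + H - C) (by push_cast; linarith) (by omega) (by omega)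
  have i3 := isNat_of_half (x := 2 * c) (m := 2 * C) (by push_cast; linarith) (by omega) (by omega)
  have i4 := isNat_of_half (x := b + d + k + 1) (m := B + D + K + 2) (by push_cast; linarith) (by omega) (by omega)
  have i5 := isNat_of_half (x := 2 * d) (m := 2 * D) (by push_cast; linarith) (by omega) (by omega)
  have i6 : IsNat (c + h - a) := ⟨n₁, h₁⟩
  have i7 : IsNat (b + d - k) := ⟨n₂, h₂⟩
  have i8 : IsInt (c + k - b - f) := isInt_of_half (m := C + K - B - F) (by push_cast; linarith) (by omega)
  rw [sumK'_eq q h₁ h₂, show -(c + h - a) = -(n₁ : ℝ) by rw [h₁], show -(b + d - k) = -(n₂ : ℝ) by rw [h₂],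
    qKdFReg_eq hq (-1) i1 (qPoch_ratio_add_sub hq i2 i3) (qPoch_ratio_sub_sub hq i4 i5)
      (X := -(a + b - e + 1)) (Y := -(a + b + e + 1)) (by rw [← h₁, g_eq]; ring) (by rw [← h₂, g_eq]; ring)]
  simp only [mul_sum]
  refine sum_congr rfl fun s _ => sum_range_succ_reflect fun t ht => ?_
  have hp : q ^ (-(s : ℝ) * (a + b - e + 1) + ((n₂ : ℝ) - t) * (a + b + e + 1)) =
      q ^ ((n₂ : ℝ) * (a + b + e + 1)) * q ^ (s * -(a + b - e + 1) + t * -(a + b + e + 1)) := by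
    rw [← Real.rpow_add hq]; congr 1; ring
  rw [Nat.cast_sub ht, sgn_add i8 (isNat_natCast s).isInt, sgn_natCast, hp, ← h₁, ← h₂,
    show d + k - b + (b + d - k - t) = 2 * d - (t : ℝ) by ring,
    show 2 * k + 1 + (b + d - k - t) = b + d + k + 1 - (t : ℝ) by ring,
    show c - b - f + k + (b + d - k - t) - s = c + d - f - s - (t : ℝ) by ring,
    show a + g - c - k - (b + d - k - t) + s = a + g - b - c - d + s + (t : ℝ) by ring, sub_sub_cancel,
    div_eq_mul_inv, mul_inv, mul_inv, mul_inv]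
  have c0 := mul_inv_cancel₀ (qFact_ne_zero hq i1)
  have c1 := mul_inv_cancel₀ (qFact_ne_zero hq i2)
  have c2 := mul_inv_cancel₀ (qFact_ne_zero hq i3)
  have c3 := mul_inv_cancel₀ (qFact_ne_zero hq i4)
  have c4 := mul_inv_cancel₀ (qFact_ne_zero hq i5)
  have c5 := mul_inv_cancel₀ (qFact_ne_zero hq i6)
  have c6 := mul_inv_cancel₀ (qFact_ne_zero hq i7)
  generalize qFact q (c + d - f) = x0 at *
  generalize qFact q (a + h - c) = x1 at *
  generalize qFact q (2 * c) = x2 at *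
  generalize qFact q (b + d + k + 1) = x3 at *
  generalize qFact q (2 * d) = x4 at *
  generalize qFact q (c + h - a) = x5 at *
  generalize qFact q (b + d - k) = x6 at *
  have hall : (x0 * x0⁻¹) * (x1 * x1⁻¹) * (x2 * x2⁻¹) * (x3 * x3⁻¹) * (x4 * x4⁻¹) * (x5 * x5⁻¹) * (x6 * x6⁻¹) = 1 := by rw [c0, c1, c2, c3, c4, c5, c6]; norm_num
  linear_combination (-(sgn (c + k - b - f) * (-1) ^ s * q ^ ((b + d - k) * (a + b + e + 1)) *
    q ^ (s * -(a + b - e + 1) + t * -(a + b + e + 1)) *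
    (qFact q (2 * c - s) * qFact q (a + h - c + s) * qFact q (2 * d - t) * (qFact q s)⁻¹ *
      (qFact q (c + h - a - s))⁻¹ * (qFact q (b + d - k - t))⁻¹ * (qFact q t)⁻¹ *
      (qFact q (b + d + k + 1 - t))⁻¹ * (qFact q (c + d - f - s - t))⁻¹ *
      (qFact q (a + g - b - c - d + s + t))⁻¹))) * hall

/-- Reversal of s. The factor [2k+1+z]! stays increasing and supplies the lower parameter 2k + 2. -/
theorem sumK'_eq_qKdFReg_pos (hq : 0 < q) {a b e c d f h k g : ℝ} {A B E C D F H K : ℤ}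
    (S : Spins a b e c d f h k g A B E C D F H K) :
    sumK' q a b e c d f h k g =
        sgn (2 * c + h + k - a - b - f) * q ^ (-(c + h - a) * (a + b - e + 1)) *
          (qFact q (a + c - h) * qFact q (2 * h) * qFact q (k - b + d)) /
          (qFact q (c + h - a) * qFact q (b + d - k) * qFact q (2 * k + 1) *
            qFact q (g + h - k)) *
          qKdFReg 1 q [-(g + h - k)] [a + k - b - f - h + 1]
            [-(c + h - a), a + c - h + 1] [-(2 * h)]
            [-(b + d - k), k - b + d + 1] [2 * k + 2] := by
  obtain ⟨a2, b2, e2, c2, d2, f2, h2, k2, g_eq, abe, cdf, ach, bdk, hkg⟩ := S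
  obtain ⟨n₁, h₁⟩ := isNat_of_half (x := c + h - a) (m := C + H - A) (by push_cast; linarith) (by omega) (by omega)
  obtain ⟨n₂, h₂⟩ := isNat_of_half (x := b + d - k) (m := B + D - K) (by push_cast; linarith) (by omega) (by omega)
  have i1 := isNat_of_half (x := g + h - k) (m := E + F + H - K) (by push_cast; linarith) (by omega) (by omega)
  have i2 := isNat_of_half (x := a + c - h) (m := A + C - H) (by push_cast; linarith) (by omega) (by omega)
  have i3 := isNat_of_half (x := 2 * h) (m := 2 * H) (by push_cast; linarith) (by omega) (by omega)
  have i4 := isNat_of_half (x := k - b + d) (m := K - B + D) (by push_cast; linarith) (by omega) (by omega)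
  have i5 := isNat_of_half (x := 2 * k + 1) (m := 2 * K + 2) (by push_cast; linarith) (by omega) (by omega)
  have i6 : IsNat (c + h - a) := ⟨n₁, h₁⟩
  have i7 : IsNat (b + d - k) := ⟨n₂, h₂⟩
  have i8 : IsInt (c + k - b - f) := isInt_of_half (m := C + K - B - F) (by push_cast; linarith) (by omega)
  rw [sumK'_eq q h₁ h₂, show -(c + h - a) = -(n₁ : ℝ) by rw [h₁], show -(b + d - k) = -(n₂ : ℝ) by rw [h₂],
    show 2 * k + 2 = 2 * k + 1 + 1 by ring,
    qKdFReg_eq hq 1 i1 (qPoch_ratio_add_sub hq i2 i3) (qPoch_ratio_add_add hq i4 i5)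
      (X := a + b - e + 1) (Y := a + b + e + 1) (by rw [← h₁, g_eq]; ring) (by rw [← h₂, g_eq]; ring),
    show 2 * c + h + k - a - b - f = c + k - b - f + n₁ by rw [← h₁]; ring,
    sgn_add i8 (isNat_natCast n₁).isInt, sgn_natCast]
  simp only [mul_sum]
  refine sum_range_succ_reflect fun s hs => sum_congr rfl fun t _ => ?_
  have hp : q ^ (-((n₁ : ℝ) - s) * (a + b - e + 1) + t * (a + b + e + 1)) =
      q ^ (-(n₁ : ℝ) * (a + b - e + 1)) * q ^ (s * (a + b - e + 1) + t * (a + b + e + 1)) := by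
    rw [← Real.rpow_add hq]; congr 1; ring
  rw [sgn_add i8 (isNat_natCast _).isInt, sgn_natCast, Nat.cast_sub hs, neg_one_pow_sub hs, hp, ← h₁, ← h₂,
    show 2 * c - (c + h - a - s) = a + c - h + (s : ℝ) by ring,
    show a + h - c + (c + h - a - s) = 2 * h - (s : ℝ) by ring,
    show c - b - f + k + t - (c + h - a - s) = a + k - b - f - h + s + (t : ℝ) by ring,
    show a + g - c - k - t + (c + h - a - s) = g + h - k - s - (t : ℝ) by ring, sub_sub_cancel,
    show d + k - b + (t : ℝ) = k - b + d + t by ring, div_eq_mul_inv, mul_inv, mul_inv, mul_inv]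
  have c0 := mul_inv_cancel₀ (qFact_ne_zero hq i1)
  have c1 := mul_inv_cancel₀ (qFact_ne_zero hq i2)
  have c2 := mul_inv_cancel₀ (qFact_ne_zero hq i3)
  have c3 := mul_inv_cancel₀ (qFact_ne_zero hq i4)
  have c4 := mul_inv_cancel₀ (qFact_ne_zero hq i5)
  have c5 := mul_inv_cancel₀ (qFact_ne_zero hq i6)
  have c6 := mul_inv_cancel₀ (qFact_ne_zero hq i7)
  generalize qFact q (g + h - k) = x0 at *
  generalize qFact q (a + c - h) = x1 at *
  generalize qFact q (2 * h) = x2 at *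
  generalize qFact q (k - b + d) = x3 at *
  generalize qFact q (2 * k + 1) = x4 at *
  generalize qFact q (c + h - a) = x5 at *
  generalize qFact q (b + d - k) = x6 at *
  have hall : (x0 * x0⁻¹) * (x1 * x1⁻¹) * (x2 * x2⁻¹) * (x3 * x3⁻¹) * (x4 * x4⁻¹) * (x5 * x5⁻¹) * (x6 * x6⁻¹) = 1 := by rw [c0, c1, c2, c3, c4, c5, c6]; norm_num
  linear_combination (-(sgn (c + k - b - f) * (-1) ^ n₁ * (-1) ^ s * q ^ (-(c + h - a) * (a + b - e + 1)) *
    q ^ (s * (a + b - e + 1) + t * (a + b + e + 1)) *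
    (qFact q (a + c - h + s) * qFact q (2 * h - s) * qFact q (k - b + d + t) * (qFact q s)⁻¹ *
      (qFact q (c + h - a - s))⁻¹ * (qFact q (b + d - k - t))⁻¹ * (qFact q t)⁻¹ *
      (qFact q (2 * k + 1 + t))⁻¹ * (qFact q (g + h - k - s - t))⁻¹ *
      (qFact q (a + k - b - f - h + s + t))⁻¹))) * hall

theorem mul_div_mul_qKdF (hq : 0 < q) (ε u v : ℝ) (A B D B' D' : List ℝ) {G : ℝ} (hG : IsNat G) :
    u / (v * qFact q G) * qKdF ε q A [G + 1] B D B' D' = u / v * qKdFReg ε q A [G + 1] B D B' D' := by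
  have := inv_mul_cancel₀ (qFact_ne_zero hq hG)
  rw [qKdF_eq_qKdFReg hq ε A B D B' D' hG, div_eq_mul_inv, div_eq_mul_inv, mul_inv]
  generalize qFact q G = x at *
  linear_combination (u * v⁻¹ * qKdFReg ε q A [G + 1] B D B' D') * this

end StretchedNineJ
end

/-! ### The theorem. -/

open StretchedNineJ in
theorem mainTheorem4 (q : ℝ) (hq : 0 < q) (a b e c d f h k g : ℝ)
    (hg : g = e + f)
    (habe : IsTriad a b e) (hcdf : IsTriad c d f) (hhkg : IsTriad h k g)
    (hach : IsTriad a c h) (hbdk : IsTriad b d k) :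
    -- the three expressions of the stretched coefficient
    nineJ q a b e c d f h k g = exprCG q a b e c d f h k g ∧
    nineJ q a b e c d f h k g = exprK q a b e c d f h k g ∧
    nineJ q a b e c d f h k g = exprK' q a b e c d f h k g ∧
    -- symmetry of the first double sum expression: first two columns, first two rows
    exprK q a b e c d f h k g =
      oddPhase q a b e c d f h k g * exprK q⁻¹ b a e d c f k h g ∧
    exprK q a b e c d f h k g =
      oddPhase q a b e c d f h k g * exprK q⁻¹ c d f a b e h k g ∧
    -- the first double sum as a Kampé de Fériet function: reversed second or first summation
    (0 ≤ h + k - a - b - f →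
      sumK q a b e c d f h k g =
        sgn (a + c - h) * q ^ (-(b + d - k) * (g - h + k + 1)) *
          (qFact q (2 * a) * qFact q (c + h - a) * qFact q (2 * b) * qFact q (d - b + k)) /
          (qFact q (a + c - h) * qFact q (b + d - k) * qFact q (a + b - e) *
            qFact q (h + k - a - b - f)) *
          qKdF (-1) q [-(a + b - e)] [h + k - a - b - f + 1]
            [-(a + c - h), c + h - a + 1] [-(2 * a)]
            [-(b + d - k), d - b + k + 1] [-(2 * b)]) ∧
    (0 ≤ h + k - c - d - e →
      sumK q a b e c d f h k g =
        sgn (b + d - k) * q ^ (-(a + c - h) * (g + h - k + 1)) *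
          (qFact q (2 * c) * qFact q (a + h - c) * qFact q (2 * d) * qFact q (b - d + k)) /
          (qFact q (a + c - h) * qFact q (b + d - k) * qFact q (c + d - f) *
            qFact q (h + k - c - d - e)) *
          qKdF 1 q [-(c + d - f)] [h + k - c - d - e + 1]
            [-(a + c - h), a + h - c + 1] [-(2 * c)]
            [-(b + d - k), b - d + k + 1] [-(2 * d)]) ∧
    -- and in all cases
    sumK q a b e c d f h k g =
      sgn (a + c - h) * q ^ (-(b + d - k) * (g - h + k + 1)) *
        (qFact q (2 * a) * qFact q (c + h - a) * qFact q (2 * b) * qFact q (d - b + k)) /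
        (qFact q (a + c - h) * qFact q (b + d - k) * qFact q (a + b - e)) *
        qKdFReg (-1) q [-(a + b - e)] [h + k - a - b - f + 1]
          [-(a + c - h), c + h - a + 1] [-(2 * a)]
          [-(b + d - k), d - b + k + 1] [-(2 * b)] ∧
    -- the second double sum as a Kampé de Fériet function
    (0 ≤ a + g - b - c - d →
      sumK' q a b e c d f h k g =
        sgn (c + k - b - f) * q ^ ((b + d - k) * (a + b + e + 1)) *
          (qFact q (2 * c) * qFact q (a + h - c) * qFact q (2 * d)) /
          (qFact q (c + h - a) * qFact q (b + d - k) * qFact q (b + d + k + 1) *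
            qFact q (c + d - f) * qFact q (a + g - b - c - d)) *
          qKdF (-1) q [-(c + d - f)] [a + g - b - c - d + 1]
            [-(c + h - a), a + h - c + 1] [-(2 * c)]
            [-(b + d - k), -(b + d + k + 1)] [-(2 * d)]) ∧
    (0 ≤ a + k - b - f - h →
      sumK' q a b e c d f h k g =
        sgn (2 * c + h + k - a - b - f) * q ^ (-(c + h - a) * (a + b - e + 1)) *
          (qFact q (a + c - h) * qFact q (2 * h) * qFact q (k - b + d)) /
          (qFact q (c + h - a) * qFact q (b + d - k) * qFact q (2 * k + 1) *
            qFact q (g + h - k) * qFact q (a + k - b - f - h)) *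
          qKdF 1 q [-(g + h - k)] [a + k - b - f - h + 1]
            [-(c + h - a), a + c - h + 1] [-(2 * h)]
            [-(b + d - k), k - b + d + 1] [2 * k + 2]) ∧
    -- and in all cases
    sumK' q a b e c d f h k g =
      sgn (c + k - b - f) * q ^ ((b + d - k) * (a + b + e + 1)) *
        (qFact q (2 * c) * qFact q (a + h - c) * qFact q (2 * d)) /
        (qFact q (c + h - a) * qFact q (b + d - k) * qFact q (b + d + k + 1) *
          qFact q (c + d - f)) *
        qKdFReg (-1) q [-(c + d - f)] [a + g - b - c - d + 1]
          [-(c + h - a), a + h - c + 1] [-(2 * c)]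
          [-(b + d - k), -(b + d + k + 1)] [-(2 * d)] := by
  obtain ⟨A, B, E, C, D, F, H, K, S⟩ := exists_spins hg habe hcdf hhkg hach hbdk
  have hK := nineJ_eq_exprK hq S habe hcdf hhkg hach hbdk
  have hint : ∀ {x : ℝ} {m : ℤ}, 0 ≤ x → 2 * x = m → m % 2 = 0 → IsNat x := fun h0 h h2 =>
    (isInt_of_half h h2).isNat h0
  refine ⟨hK.trans (exprK_eq_exprCG hq S hach hbdk), hK, nineJ_eq_exprK' hq S habe hcdf hhkg hach hbdk,
    exprK_swap_columns hq hg hhkg hach hbdk, exprK_swap_rows hq hg hhkg hach hbdk, fun h0 => ?_,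
    fun h0 => ?_, sumK_eq_qKdFReg_neg hq S, fun h0 => ?_, fun h0 => ?_, sumK'_eq_qKdFReg_neg hq S⟩
  -- In each conditional case the inequality makes γ - 1 a natural number, and the ordinary series
  -- is [γ-1]! times the regularized one.
  · rw [mul_div_mul_qKdF hq _ _ _ _ _ _ _ _ ?_]
    · exact sumK_eq_qKdFReg_neg hq S
    · obtain ⟨a2, b2, e2, c2, d2, f2, h2, k2, g_eq, abe, cdf, ach, bdk, hkg⟩ := S
      exact hint (m := H + K - A - B - F) h0 (by push_cast; linarith) (by omega)
  · rw [mul_div_mul_qKdF hq _ _ _ _ _ _ _ _ ?_]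
    · exact sumK_eq_qKdFReg_pos hq S
    · obtain ⟨a2, b2, e2, c2, d2, f2, h2, k2, g_eq, abe, cdf, ach, bdk, hkg⟩ := S
      exact hint (m := H + K - C - D - E) h0 (by push_cast; linarith) (by omega)
  · rw [mul_div_mul_qKdF hq _ _ _ _ _ _ _ _ ?_]
    · exact sumK'_eq_qKdFReg_neg hq S
    · obtain ⟨a2, b2, e2, c2, d2, f2, h2, k2, g_eq, abe, cdf, ach, bdk, hkg⟩ := S
      exact hint (m := A + (E + F) - B - C - D) h0 (by push_cast; linarith) (by omega)
  · rw [mul_div_mul_qKdF hq _ _ _ _ _ _ _ _ ?_]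
    · exact sumK'_eq_qKdFReg_pos hq S
    · obtain ⟨a2, b2, e2, c2, d2, f2, h2, k2, g_eq, abe, cdf, ach, bdk, hkg⟩ := S
      exact hint (m := A + K - B - F - H) h0 (by push_cast; linarith) (by omega)
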